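/- Consider the system $$x'=xy,\qquad y'=2x^2-y^2 \qquad (\ast)$$ on $\mathbb C^2\ni(x,y)$, and embed $\mathbb C^2$ in $\mathbb P^2$ by $(x,y)\mapsto[1:x:y]$. Starting from $\mathbb P^2$, blow up successively ten points: for $(c_1,\dots,c_{10})=(0,0,1,1,1,1,-1,-1,-1,-1)$, the centre of the $k$-th blow-up is the point at infinity of the strict transform of the line $x=c_ky$, that is, the limit of the point $(c_ky,y)\in\mathbb C^2$ as $y\to\infty$. Let $X$ be the resulting complex surface, which contains $\mathbb C^2$. A solution of $(\ast)$ on an open set $U\subset\mathbb C$ with values in $X$ is a holomorphic map $\gamma:U\to X$ which, off a discrete closed subset of $U$, takes values in $\mathbb C^2$ and satisfies $(\ast)$ there. The phase space $\mathcal X\subset X\times\mathbb C$ is the set of all points $(\gamma(t),t)$, where $\gamma$ is a solution on some open set containing $t$. **Theorem.** The surface $X$ is a (compact, connected) rational surface of type $E_7^{(1)}$, in the following sense: there are eight smooth rational curves $D_0,\dots,D_7$ on $X$ with self-intersection number $-2$, any two of which are disjoint or meet transversally in exactly one point, whose dual graph is the extended Dynkin diagram $E_7^{(1)}$ (a central vertex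 with arms of length $1,3,3$), and $$\mathcal X=\Bigl(X\setminus\bigcup_{v=0}^7D_v\Bigr)\times\mathbb C .$$ The phase space $\mathcal X$ is obtained by gluing four copies $U_j\times\mathbb C=\mathbb C^2\times\mathbb C\ni(x_j,y_j,t)$, $j=0,1,2,3$, via the birational transformations $$ \begin{aligned} 0)\ & x_0=x,\quad y_0=y, & 1)\ & x_1=xy,\quad y_1=\tfrac1y,\\ 2)\ & x_2=xy^3-y^4,\quad y_2=\tfrac1y, & 3)\ & x_3=xy^3+y^4,\quad y_3=\tfrac1y , \end{aligned} $$ that is: there are open holomorphic embeddings $\kappa_j:\mathbb C^2\to X$, where $\kappa_0$ is the inclusion of the original $\mathbb C^2$, such that $\mathcal X$ is the union of the sets $\kappa_j(\mathbb C^2)\times\mathbb C$, and for $j\ne k$ one has $\kappa_j(x_j,y_j)=\kappa_k(x_k,y_k)$ if and only if $(x_j,y_j)$ and $(x_k,y_k)$ are the images of one and the same $(x,y)\in\mathbb C^2$ with $y\neq0$ under the transformations $j)$ and $k)$. In each of the four charts the system $(\ast)$ becomes a polynomial system. For every $(q,t)\in\mathcal X$ there is a solution $\gamma:\mathbb C\to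 X$ of $(\ast)$, defined on all of $\mathbb C$, with $\gamma(t)=q$, and every solution $\delta$ on a connected open set $U\ni t$ with $\delta(t)=q$ coincides with $\gamma$ on $U$. -/

import Mathlib

open Set Filter Topology
open scoped Manifold ContDiff LinearAlgebra.Projectivization

/-! ### Complex surfaces -/

/-- A complex surface: a Hausdorff complex manifold of dimension two. -/
structure ComplexSurface where
  carrier : Type
  [top : TopologicalSpace carrier]
  [charted : ChartedSpace (ℂ × ℂ) carrier]
  [mfd : IsManifold 𝓘(ℂ, ℂ × ℂ) ω carrier]
  [t2 : T2Space carrier]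

namespace ComplexSurface

instance : CoeSort ComplexSurface Type := ⟨carrier⟩

attribute [instance] top charted mfd t2

end ComplexSurface

/-! ### The projective plane -/

namespace PlaneP2

/-- The set underlying `ℙ²`: lines through the origin of `ℂ³`. -/
abbrev Pt : Type := ℙ ℂ (Fin 3 → ℂ)

/-- The set `z_i ≠ 0`. -/
def nz (i : Fin 3) : Set Pt := {p | p.rep i ≠ 0}

/-- Affine coordinates `(z_{i+1}/z_i, z_{i+2}/z_i)`, indices modulo three. -/
noncomputable def coord (i : Fin 3) (p : Pt) : ℂ × ℂ :=
  (p.rep (i + 1) / p.rep i, p.rep (i + 2) / p.rep i)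

/-- The vector with entry `1` at `i`, `a` at `i+1` and `b` at `i+2`. -/
noncomputable def vec (i : Fin 3) (w : ℂ × ℂ) : Fin 3 → ℂ :=
  fun j => if j = i then 1 else if j = i + 1 then w.1 else w.2

theorem vec_self (i : Fin 3) (w : ℂ × ℂ) : vec i w i = 1 := by simp [vec]

theorem vec_ne (i : Fin 3) (w : ℂ × ℂ) : vec i w ≠ 0 := fun h => by
  have := congrFun h i
  simp [vec_self] at this

/-- The point with affine coordinates `w` in the chart `z_i ≠ 0`. -/
noncomputable def point (i : Fin 3) (w : ℂ × ℂ) : Pt := Projectivization.mk ℂ (vec i w) (vec_ne i w)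

/-- Homogeneous coordinates of a point are proportional to its representative. -/
theorem exists_rep (v : Fin 3 → ℂ) (hv : v ≠ 0) :
    ∃ c : ℂ, c ≠ 0 ∧ ∀ j, (Projectivization.mk ℂ v hv).rep j = c * v j := by
  obtain ⟨a, ha⟩ := Projectivization.exists_smul_eq_mk_rep ℂ v hv
  refine ⟨a, a.ne_zero, fun j => ?_⟩
  rw [← ha]; rfl

/-- The affine chart `z_i ≠ 0`. -/
noncomputable def chart (i : Fin 3) : PartialEquiv Pt (ℂ × ℂ) where
  toFun := coord i
  invFun := point i
  source := nz i
  target := univ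
  map_source' := fun _ _ => mem_univ _
  map_target' := fun w _ => by
    obtain ⟨c, hc, h⟩ := exists_rep (vec i w) (vec_ne i w)
    simp only [nz, mem_ofPred_eq, point, h, vec_self]
    simpa using hc
  left_inv' := fun p hp => by
    have hp' : p.rep i ≠ 0 := hp
    conv_rhs => rw [← p.mk_rep]
    rw [point, Projectivization.mk_eq_mk_iff']
    refine ⟨(p.rep i)⁻¹, ?_⟩
    funext j
    fin_cases i <;> fin_cases j <;> simp [vec, coord] at hp' ⊢ <;> field_simp
  right_inv' := fun w _ => by
    obtain ⟨c, hc, h⟩ := exists_rep (vec i w) (vec_ne i w)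
    simp only [coord, point, h]
    fin_cases i <;> ext <;> simp [vec] <;> field_simp

theorem point_mem_nz (i j : Fin 3) (w : ℂ × ℂ) : point i w ∈ nz j ↔ vec i w j ≠ 0 := by
  obtain ⟨c, hc, h⟩ := exists_rep (vec i w) (vec_ne i w)
  simp [nz, point, h, hc]

theorem coord_point (i j : Fin 3) (w : ℂ × ℂ) :
    coord j (point i w) = (vec i w (j + 1) / vec i w j, vec i w (j + 2) / vec i w j) := by
  obtain ⟨c, hc, h⟩ := exists_rep (vec i w) (vec_ne i w)
  simp only [coord, point, h, mul_div_mul_left _ _ hc]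

theorem contDiff_vec (i j : Fin 3) : ContDiff ℂ ω (fun w : ℂ × ℂ => vec i w j) := by
  unfold vec
  split_ifs
  · exact contDiff_const
  · exact contDiff_fst
  · exact contDiff_snd

theorem trans_source (i j : Fin 3) :
    ((chart i).symm.trans (chart j)).source = {w | vec i w j ≠ 0} := by
  ext w
  simp only [PartialEquiv.trans_source, PartialEquiv.symm_source, mem_inter_iff, mem_preimage,
    mem_ofPred_eq]
  exact ⟨fun h => (point_mem_nz i j w).1 h.2, fun h => ⟨mem_univ _, (point_mem_nz i j w).2 h⟩⟩

theorem contDiffOn_trans (i j : Fin 3) :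
    ContDiffOn ℂ ω ((chart i).symm.trans (chart j)) {w | vec i w j ≠ 0} := by
  have : ((chart i).symm.trans (chart j) : ℂ × ℂ → ℂ × ℂ) =
      fun w => (vec i w (j + 1) / vec i w j, vec i w (j + 2) / vec i w j) := by
    funext w; exact coord_point i j w
  rw [this]
  exact ((contDiff_vec i _).contDiffOn.div (contDiff_vec i j).contDiffOn fun _ h => h).prodMk
    ((contDiff_vec i _).contDiffOn.div (contDiff_vec i j).contDiffOn fun _ h => h)

theorem exists_nz (p : Pt) : ∃ i, p ∈ nz i := by
  by_contra! h
  exact p.rep_nonzero (funext fun i => by simpa [nz] using h i)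

/-- The three affine charts of `ℙ²`. -/
noncomputable def core : ChartedSpaceCore (ℂ × ℂ) Pt where
  atlas := range chart
  chartAt p := chart (exists_nz p).choose
  mem_chart_source p := (exists_nz p).choose_spec
  chart_mem_atlas p := mem_range_self _
  open_source := by
    rintro _ _ ⟨i, rfl⟩ ⟨j, rfl⟩
    rw [trans_source]
    exact isOpen_ne_fun (contDiff_vec i j).continuous continuous_const
  continuousOn_toFun := by
    rintro _ _ ⟨i, rfl⟩ ⟨j, rfl⟩
    rw [trans_source]
    exact (contDiffOn_trans i j).continuousOn

noncomputable instance : TopologicalSpace Pt := core.toTopologicalSpace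

noncomputable instance : ChartedSpace (ℂ × ℂ) Pt := core.toChartedSpace

/-- The affine chart `z_i ≠ 0`, with its topology. -/
noncomputable def ochart (i : Fin 3) : OpenPartialHomeomorph Pt (ℂ × ℂ) :=
  core.openPartialHomeomorph (chart i) ⟨i, rfl⟩

theorem mem_atlas_iff (e : OpenPartialHomeomorph Pt (ℂ × ℂ)) :
    e ∈ atlas (ℂ × ℂ) Pt ↔ ∃ i, e = ochart i := by
  constructor
  · intro h
    obtain ⟨c, ⟨⟨i, rfl⟩, hc⟩⟩ := mem_iUnion₂.1 h
    exact ⟨i, hc⟩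
  · rintro ⟨i, rfl⟩
    exact mem_iUnion₂.2 ⟨chart i, ⟨i, rfl⟩, rfl⟩

instance : IsManifold 𝓘(ℂ, ℂ × ℂ) ω Pt := by
  apply isManifold_of_contDiffOn
  intro e e' he he'
  obtain ⟨i, rfl⟩ := (mem_atlas_iff e).1 he
  obtain ⟨j, rfl⟩ := (mem_atlas_iff e').1 he'
  have hs : ((ochart i).symm.trans (ochart j)).source = {w | vec i w j ≠ 0} := trans_source i j
  simp only [modelWithCornersSelf_coe, modelWithCornersSelf_coe_symm, Function.id_comp,
    Function.comp_id, preimage_id, range_id, inter_univ]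
  rw [hs]
  exact contDiffOn_trans i j

/-- The orthogonal projection onto a line, as a matrix; it separates points. -/
noncomputable def proj (p : Pt) : Fin 3 → Fin 3 → ℂ :=
  fun i j => p.rep i * star (p.rep j) / ∑ k, p.rep k * star (p.rep k)

theorem proj_point (i : Fin 3) (w : ℂ × ℂ) (j k : Fin 3) :
    proj (point i w) j k =
      vec i w j * star (vec i w k) / ∑ l, vec i w l * star (vec i w l) := by
  obtain ⟨c, hc, h⟩ := exists_rep (vec i w) (vec_ne i w)
  have hc' : c * star c ≠ 0 := mul_ne_zero hc (star_ne_zero.2 hc)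
  have e : ∀ a b, (c * a) * star (c * b) = (c * star c) * (a * star b) := fun a b => by
    rw [star_mul']; ring
  simp only [proj, point, h, e, ← Finset.mul_sum, mul_div_mul_left _ _ hc']

theorem sum_ne (v : Fin 3 → ℂ) (hv : v ≠ 0) : ∑ l, v l * star (v l) ≠ 0 := by
  have : (∑ l, v l * star (v l)) = ((∑ l, Complex.normSq (v l) : ℝ) : ℂ) := by
    push_cast
    exact Finset.sum_congr rfl fun l _ => Complex.mul_conj (v l)
  rw [this, Complex.ofReal_ne_zero]
  intro h
  rw [Finset.sum_eq_zero_iff_of_nonneg fun l _ => Complex.normSq_nonneg _] at h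
  exact hv (funext fun l => Complex.normSq_eq_zero.1 (h l (Finset.mem_univ l)))

theorem proj_injective : Function.Injective proj := by
  intro p q h
  obtain ⟨k, hk⟩ := exists_nz q
  have hp := sum_ne _ p.rep_nonzero
  have hq := sum_ne _ q.rep_nonzero
  rw [← p.mk_rep, ← q.mk_rep]
  symm
  rw [Projectivization.mk_eq_mk_iff']
  have hk' : star (q.rep k) ≠ 0 := star_ne_zero.2 hk
  refine ⟨star (p.rep k) / (∑ l, p.rep l * star (p.rep l)) *
    (∑ l, q.rep l * star (q.rep l)) / star (q.rep k), ?_⟩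
  funext j
  have := congrFun (congrFun h j) k
  simp only [proj] at this
  rw [div_eq_div_iff hp hq] at this
  simp only [Pi.smul_apply, smul_eq_mul]
  field_simp
  linear_combination this

theorem continuous_proj : Continuous proj := by
  rw [continuous_iff_continuousAt]
  intro p
  obtain ⟨i, hi⟩ := exists_nz p
  have hopen : IsOpen (nz i) := (ochart i).open_source
  have hcont : ContinuousOn (coord i) (nz i) := (ochart i).continuousOn
  have hvec : ∀ j, Continuous fun w : ℂ × ℂ => vec i w j := fun j => (contDiff_vec i j).continuous
  have h2 : Continuous fun w : ℂ × ℂ => proj (point i w) := by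
    refine continuous_pi fun j => continuous_pi fun k => ?_
    simp only [proj_point]
    refine ((hvec j).mul (hvec k).star).div
      (continuous_finsetSum _ fun l _ => (hvec l).mul (hvec l).star) fun w => ?_
    exact sum_ne _ (vec_ne i w)
  have h3 : ContinuousOn (fun q => proj (point i (coord i q))) (nz i) :=
    h2.comp_continuousOn hcont
  refine (h3.congr fun q hq => ?_).continuousAt (hopen.mem_nhds hi)
  exact congrArg proj ((chart i).left_inv hq).symm

instance : T2Space Pt := T2Space.of_injective_continuous proj_injective continuous_proj

end PlaneP2

/-- The complex projective plane, with homogeneous coordinates `[z_0 : z_1 : z_2]`. -/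
noncomputable def projectivePlane : ComplexSurface where
  carrier := PlaneP2.Pt

/-- The embedding `(x, y) ↦ [1 : x : y]` of `ℂ²` into the projective plane. -/
noncomputable def affinePlane (z : ℂ × ℂ) : projectivePlane :=
  Projectivization.mk ℂ ![1, z.1, z.2] fun h => one_ne_zero (congrFun h 0)

/-! ### Blowing up -/

/-- `π : X' → X` is the blow-up of the complex surface `X` at the point `p`: it is biholomorphic
away from `p`, and over a coordinate neighbourhood of `p`, with coordinates `(u, v)` centred at `p`,
it is given by the two standard charts `(u, v) = (a, a b)` and `(u, v) = (a b, b)`. -/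
def IsBlowUpAt {X X' : ComplexSurface} (π : X' → X) (p : X) : Prop :=
  ContMDiff 𝓘(ℂ, ℂ × ℂ) 𝓘(ℂ, ℂ × ℂ) ω π ∧
  (∃ σ : X → X', ContMDiffOn 𝓘(ℂ, ℂ × ℂ) 𝓘(ℂ, ℂ × ℂ) ω σ {p}ᶜ ∧
    (∀ q, q ≠ p → π (σ q) = q) ∧ ∀ q', π q' ≠ p → σ (π q') = q') ∧
  ∃ φ ∈ IsManifold.maximalAtlas 𝓘(ℂ, ℂ × ℂ) ω X, p ∈ φ.source ∧ φ p = 0 ∧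
    ∃ α ∈ IsManifold.maximalAtlas 𝓘(ℂ, ℂ × ℂ) ω X',
    ∃ β ∈ IsManifold.maximalAtlas 𝓘(ℂ, ℂ × ℂ) ω X',
      α.source ∪ β.source = π ⁻¹' φ.source ∧
      α.target = {c | (c.1, c.1 * c.2) ∈ φ.target} ∧
      (∀ q ∈ α.source, φ (π q) = ((α q).1, (α q).1 * (α q).2)) ∧
      β.target = {c | (c.1 * c.2, c.2) ∈ φ.target} ∧
      (∀ q ∈ β.source, φ (π q) = ((β q).1 * (β q).2, (β q).2))

/-- `IsIteratedBlowUp [c_n, …, c_1] X ι` says that the complex surface `X` arises from the projective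
plane by `n` successive blow-ups, and that `ι : ℂ² → X` is the lift of the affine plane. The centre
of the `k`-th blow-up is the point at infinity of the strict transform of the line `x = c_k y`. -/
inductive IsIteratedBlowUp : List ℂ → (X : ComplexSurface) → (ℂ × ℂ → X) → Prop
  | plane : IsIteratedBlowUp [] projectivePlane affinePlane
  | blowUp {L : List ℂ} {X : ComplexSurface} {ι : ℂ × ℂ → X} (h : IsIteratedBlowUp L X ι)
      (c : ℂ) (p : X) (hp : Tendsto (fun y : ℂ => ι (c * y, y)) (cocompact ℂ) (𝓝 p))
      (X' : ComplexSurface) (π : X' → X) (hπ : IsBlowUpAt π p)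
      (ι' : ℂ × ℂ → X') (hι : ∀ z, π (ι' z) = ι z) : IsIteratedBlowUp (c :: L) X' ι'

/-! ### Curves and their intersections -/

/-- `C` is a smooth rational curve (a copy of `ℙ¹`) in `X` with self-intersection number `n`.
The maps `a` and `b` are the two affine parametrisations of `C`, related by `s ↦ 1/s`. The functions
`f₀` and `f₁` are local equations of `C` near the two affine parts, so that `f₀/f₁` is the transition
function of the line bundle `𝒪(C)`, and `n` is the degree of the restriction of `𝒪(C)` to `C`,
that is, of the normal bundle of `C`. -/
def IsRationalCurve {X : ComplexSurface} (C : Set X) (n : ℤ) : Prop :=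
  ∃ a b : ℂ → X,
    ContMDiff 𝓘(ℂ, ℂ) 𝓘(ℂ, ℂ × ℂ) ω a ∧ ContMDiff 𝓘(ℂ, ℂ) 𝓘(ℂ, ℂ × ℂ) ω b ∧
    Function.Injective a ∧ Function.Injective b ∧ (∀ s, s ≠ 0 → a s = b s⁻¹) ∧
    b 0 ∉ range a ∧ C = range a ∪ range b ∧
  ∃ (W₀ W₁ : Set X) (f₀ f₁ g : X → ℂ),
    IsOpen W₀ ∧ IsOpen W₁ ∧ range a ⊆ W₀ ∧ range b ⊆ W₁ ∧
    ContMDiffOn 𝓘(ℂ, ℂ × ℂ) 𝓘(ℂ, ℂ) ω f₀ W₀ ∧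
    ContMDiffOn 𝓘(ℂ, ℂ × ℂ) 𝓘(ℂ, ℂ) ω f₁ W₁ ∧
    (∀ q ∈ W₀, q ∈ C ↔ f₀ q = 0) ∧ (∀ q ∈ W₁, q ∈ C ↔ f₁ q = 0) ∧
    (∀ q ∈ C ∩ W₀, mfderiv 𝓘(ℂ, ℂ × ℂ) 𝓘(ℂ, ℂ) f₀ q ≠ 0) ∧
    (∀ q ∈ C ∩ W₁, mfderiv 𝓘(ℂ, ℂ × ℂ) 𝓘(ℂ, ℂ) f₁ q ≠ 0) ∧
    ContMDiffOn 𝓘(ℂ, ℂ × ℂ) 𝓘(ℂ, ℂ) ω g (W₀ ∩ W₁) ∧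
    (∀ q ∈ W₀ ∩ W₁, f₁ q = g q * f₀ q) ∧
    ∀ s, s ≠ 0 → g (a s) = s ^ (-n)

/-- `C` and `C'` meet in exactly one point, and transversally there. -/
def MeetOnceTransversally {X : ComplexSurface} (C C' : Set X) : Prop :=
  ∃ q, C ∩ C' = {q} ∧ ∃ φ ∈ IsManifold.maximalAtlas 𝓘(ℂ, ℂ × ℂ) ω X, q ∈ φ.source ∧
    (∀ r ∈ φ.source, r ∈ C ↔ (φ r).1 = 0) ∧ ∀ r ∈ φ.source, r ∈ C' ↔ (φ r).2 = 0

/-- The extended Dynkin diagram of type `E_7^{(1)}`: a central vertex `0` with arms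
`1`, `2 - 3 - 4` and `5 - 6 - 7`. -/
def affineE7 : SimpleGraph (Fin 8) :=
  SimpleGraph.fromEdgeSet {s(0, 1), s(0, 2), s(2, 3), s(3, 4), s(0, 5), s(5, 6), s(6, 7)}

/-- Eight `(-2)`-curves whose dual graph is the extended Dynkin diagram of type `E_7^{(1)}`. -/
def IsE7Configuration {X : ComplexSurface} (D : Fin 8 → Set X) : Prop :=
  (∀ v, IsRationalCurve (D v) (-2)) ∧
  ∀ v w, v ≠ w → (affineE7.Adj v w → MeetOnceTransversally (D v) (D w)) ∧
    (¬ affineE7.Adj v w → Disjoint (D v) (D w))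

/-! ### The system, its solutions and its phase space -/

/-- The right-hand side of the system `x' = x y`, `y' = 2 x² - y²`. -/
def inceField (z : ℂ × ℂ) : ℂ × ℂ := (z.1 * z.2, 2 * z.1 ^ 2 - z.2 ^ 2)

/-- On `U`, the curve `γ` is a solution of the system with values in `X ⊇ ℂ²`: it is holomorphic and,
off a set of times that is discrete and closed in `U`, it runs in `ℂ²` and satisfies the system. -/
def IsSolutionOn {X : ComplexSurface} (ι : ℂ × ℂ → X) (γ : ℂ → X) (U : Set ℂ) : Prop :=
  ∀ t ∈ U, ContMDiffAt 𝓘(ℂ, ℂ) 𝓘(ℂ, ℂ × ℂ) ω γ t ∧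
    ∀ᶠ s in 𝓝[≠] t, ∃ z : ℂ → ℂ × ℂ,
      (∀ᶠ r in 𝓝 s, γ r = ι (z r)) ∧ HasDerivAt z (inceField (z s)) s

/-- The phase space: the set of all points `(q, t)` of `X × ℂ` through which a solution passes. -/
def phaseSpace {X : ComplexSurface} (ι : ℂ × ℂ → X) : Set (X × ℂ) :=
  {P | ∃ (γ : ℂ → X) (U : Set ℂ), IsOpen U ∧ P.2 ∈ U ∧ IsSolutionOn ι γ U ∧ γ P.2 = P.1}

/-- The birational maps `(x, y) ↦ (x_j, y_j)`; for `j ≠ 0` they are used where `y ≠ 0`. -/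
noncomputable def gluingMap (j : Fin 4) (z : ℂ × ℂ) : ℂ × ℂ :=
  ![(z.1, z.2), (z.1 * z.2, 1 / z.2), (z.1 * z.2 ^ 3 - z.2 ^ 4, 1 / z.2),
    (z.1 * z.2 ^ 3 + z.2 ^ 4, 1 / z.2)] j

/-! Put u = x/y and v = 1/y. The function H = x²(y² − x²) (`hamiltonian`) is constant along
solutions, and H v⁴ = u²(1 − u²). A level curve therefore reaches the line at infinity v = 0 only at
the three centres u = 0, 1, −1 (`ctr`), where u = O(v²) and u ∓ 1 = O(v⁴) respectively. Blowing up m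
times at u = c along the line x = c y amounts to the substitution u = c + a v^m. For m = 2, 4, 4
(`mult`) this pulls the closures of the level curves off the line at infinity and off all
exceptional curves except the last one over each centre (`levelClosure_notMem_line`,
`levelClosure_notMem_exc`). The curves avoided in this way are the eight curves of the theorem.

In the coordinates (a, v) the system reads v' = 1 − 2u², with a' polynomial because its pole at v =
0 cancels for exactly these m (`tipField`). On v = 0 one has v' = ±1, so a solution crosses the last
exceptional curve and is back in ℂ² at once. Hence every point off the eight curves lies on a
solution (`exists_isSolutionOn_ball`), and conservation of H shows that no solution meets the curves
(`exists_mem_phaseChart`). Solutions are global because X is compact: the closure of a level set is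
compact and lies off the curves, so solutions through its points exist on discs of one common radius
(`exists_isSolutionOn_of_isCompact`), and a solution can be continued by this radius again and again
(`exists_extension`).

The line at infinity has self-intersection 1 and passes through the first centre of each of the
three series, but through no later one: 1 − 3 = −2. An exceptional curve has self-intersection −1
and contains just the next centre, which gives −2 unless it is the last of its series. There remain
the line and chains of 1, 3 and 3 curves, which is the diagram E₇⁽¹⁾. The numbers are read off from
explicit transition functions (`isRationalCurve_exc`, `isRationalCurve_line`).

The surface is built together with a list of charts (`Tower`) in which (u, v), or (y/x, 1/x) near u
= ∞, is an explicit expression in the coordinates. Relations between charts are checked on the dense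
set where both pairs of coordinates are nonzero, all points there being in ℂ², and extended by
continuity (`HasParam.rel`, `eq_of_offAxes`). -/

/-! ### Gluing a complex surface from charts -/

/-- A set `S` with a family of bijections from subsets of `S` to subsets of `ℂ²` which are
holomorphically compatible, cover `S` and separate its points. -/
structure GluingAtlas (S K : Type) where
  chart : K → PartialEquiv S (ℂ × ℂ)
  exists_mem : ∀ x, ∃ k, x ∈ (chart k).source
  isOpen_trans : ∀ j k, IsOpen ((chart j).symm.trans (chart k)).source
  contDiffOn_trans : ∀ j k, ContDiffOn ℂ ω ((chart j).symm.trans (chart k))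
    ((chart j).symm.trans (chart k)).source
  separated : ∀ x y, x ≠ y → ∃ j k, ∃ U V : Set (ℂ × ℂ), IsOpen U ∧ IsOpen V ∧
    x ∈ (chart j).source ∧ chart j x ∈ U ∧ y ∈ (chart k).source ∧ chart k y ∈ V ∧
    ∀ z ∈ (chart j).source, chart j z ∈ U → z ∈ (chart k).source → chart k z ∉ V

namespace GluingAtlas

variable {S K : Type} (G : GluingAtlas S K)

/-- The set underlying the glued surface. -/
def Carrier (_ : GluingAtlas S K) : Type := S

/-- The charts as a core for a charted space structure. -/
noncomputable def core : ChartedSpaceCore (ℂ × ℂ) G.Carrier where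
  atlas := range G.chart
  chartAt x := G.chart (G.exists_mem x).choose
  mem_chart_source x := (G.exists_mem x).choose_spec
  chart_mem_atlas _ := mem_range_self _
  open_source := by
    rintro _ _ ⟨i, rfl⟩ ⟨j, rfl⟩
    exact G.isOpen_trans i j
  continuousOn_toFun := by
    rintro _ _ ⟨i, rfl⟩ ⟨j, rfl⟩
    exact (G.contDiffOn_trans i j).continuousOn

noncomputable instance : TopologicalSpace G.Carrier := G.core.toTopologicalSpace

noncomputable instance : ChartedSpace (ℂ × ℂ) G.Carrier := G.core.toChartedSpace

/-- The chart with index `k`, with its topology. -/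
noncomputable def ochart (k : K) : OpenPartialHomeomorph G.Carrier (ℂ × ℂ) :=
  G.core.openPartialHomeomorph (G.chart k) ⟨k, rfl⟩

theorem mem_atlas_iff (e : OpenPartialHomeomorph G.Carrier (ℂ × ℂ)) :
    e ∈ atlas (ℂ × ℂ) G.Carrier ↔ ∃ k, e = G.ochart k := by
  constructor
  · intro h
    obtain ⟨c, ⟨⟨i, rfl⟩, hc⟩⟩ := mem_iUnion₂.1 h
    exact ⟨i, hc⟩
  · rintro ⟨i, rfl⟩
    exact mem_iUnion₂.2 ⟨G.chart i, ⟨i, rfl⟩, rfl⟩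

instance : IsManifold 𝓘(ℂ, ℂ × ℂ) ω G.Carrier := by
  apply isManifold_of_contDiffOn
  intro e e' he he'
  obtain ⟨i, rfl⟩ := (G.mem_atlas_iff e).1 he
  obtain ⟨j, rfl⟩ := (G.mem_atlas_iff e').1 he'
  simp only [modelWithCornersSelf_coe, modelWithCornersSelf_coe_symm, Function.id_comp,
    Function.comp_id, preimage_id, range_id, inter_univ]
  exact G.contDiffOn_trans i j

instance : T2Space G.Carrier := by
  refine ⟨fun x y hxy => ?_⟩
  obtain ⟨j, k, U, V, hU, hV, hxj, hxU, hyk, hyV, h⟩ := G.separated x y hxy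
  refine ⟨(G.ochart j).source ∩ G.ochart j ⁻¹' U, (G.ochart k).source ∩ G.ochart k ⁻¹' V,
    (G.ochart j).isOpen_inter_preimage hU, (G.ochart k).isOpen_inter_preimage hV,
    ⟨hxj, hxU⟩, ⟨hyk, hyV⟩, ?_⟩
  rw [Set.disjoint_left]
  exact fun z hz hz' => h z hz.1 hz.2 hz'.1 hz'.2

/-- The glued surface. -/
noncomputable def surface : ComplexSurface where
  carrier := G.Carrier

theorem ochart_mem (k : K) :
    G.ochart k ∈ IsManifold.maximalAtlas 𝓘(ℂ, ℂ × ℂ) ω G.Carrier :=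
  IsManifold.subset_maximalAtlas ((G.mem_atlas_iff _).2 ⟨k, rfl⟩)

end GluingAtlas

namespace ComplexSurface

/-- The holomorphic charts of a complex surface. -/
abbrev charts (X : ComplexSurface) : Set (OpenPartialHomeomorph X (ℂ × ℂ)) :=
  IsManifold.maximalAtlas 𝓘(ℂ, ℂ × ℂ) ω X

variable {X : ComplexSurface} {e e' : OpenPartialHomeomorph X (ℂ × ℂ)}

theorem contDiffOn_trans (he : e ∈ X.charts) (he' : e' ∈ X.charts) :
    ContDiffOn ℂ ω (fun w => e' (e.symm w)) (e.target ∩ e.symm ⁻¹' e'.source) := by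
  rw [← contMDiffOn_iff_contDiffOn]
  exact (contMDiffOn_of_mem_maximalAtlas he').comp
    ((contMDiffOn_symm_of_mem_maximalAtlas he).mono inter_subset_left) fun w hw => hw.2

theorem mem_charts_iff :
    e ∈ X.charts ↔ ContMDiffOn 𝓘(ℂ, ℂ × ℂ) 𝓘(ℂ, ℂ × ℂ) ω e e.source ∧
      ContMDiffOn 𝓘(ℂ, ℂ × ℂ) 𝓘(ℂ, ℂ × ℂ) ω e.symm e.target :=
  IsManifold.mem_maximalAtlas_iff_contMDiffOn e

theorem exists_chart (q : X) : ∃ e ∈ X.charts, q ∈ e.source :=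
  ⟨chartAt _ q, IsManifold.chart_mem_maximalAtlas q, mem_chart_source _ q⟩

end ComplexSurface

/-! ### Existence of blow-ups -/

namespace BlowUp

variable {X : ComplexSurface}

/-- The set underlying the blow-up at `p`: the point `p` is replaced by a projective line. -/
abbrev Pt (p : X) : Type := {q : X // q ≠ p} ⊕ Option ℂ

/-- The blow-down map. -/
def down (p : X) : Pt p → X
  | .inl q => q
  | .inr _ => p

open Classical in
/-- The inverse of the blow-down map away from the centre. -/
noncomputable def up (p q : X) : Pt p := if h : q = p then .inr none else .inl ⟨q, h⟩

theorem up_of_ne {p q : X} (h : q ≠ p) : up p q = .inl ⟨q, h⟩ := dif_neg h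

theorem down_up (p q : X) : down p (up p q) = q := by
  by_cases h : q = p
  · rw [up, dif_pos h, h]; rfl
  · rw [up_of_ne h]; rfl

theorem up_down {p : X} {x : Pt p} (h : down p x ≠ p) : up p (down p x) = x := by
  rcases x with q | b
  · exact up_of_ne q.2
  · exact absurd rfl h

/-- The two standard charts of the blow-down map of `ℂ²` at the origin. -/
def blA (c : ℂ × ℂ) : ℂ × ℂ := (c.1, c.1 * c.2)

/-- The second standard chart of the blow-down map of `ℂ²` at the origin. -/
def blB (c : ℂ × ℂ) : ℂ × ℂ := (c.1 * c.2, c.2)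

theorem contDiff_blA : ContDiff ℂ ω blA := contDiff_fst.prodMk (contDiff_fst.mul contDiff_snd)

theorem contDiff_blB : ContDiff ℂ ω blB := (contDiff_fst.mul contDiff_snd).prodMk contDiff_snd

variable {φ : OpenPartialHomeomorph X (ℂ × ℂ)} {p : X}

theorem symm_eq_iff (hp : p ∈ φ.source) (h0 : φ p = 0) {w : ℂ × ℂ} (hw : w ∈ φ.target) :
    φ.symm w = p ↔ w = 0 := by
  constructor
  · intro h
    rw [← φ.right_inv hw, h, h0]
  · rintro rfl
    rw [← h0, φ.left_inv hp]

theorem zero_mem_target (hp : p ∈ φ.source) (h0 : φ p = 0) : ((0, 0) : ℂ × ℂ) ∈ φ.target := by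
  have := φ.map_source hp
  rwa [h0] at this

theorem coord_ne (hp : p ∈ φ.source) (h0 : φ p = 0) {q : X} (hq : q ∈ φ.source) (h : q ≠ p) :
    ¬ ((φ q).1 = 0 ∧ (φ q).2 = 0) := by
  rintro ⟨h1, h2⟩
  exact h (φ.injOn hq hp (by rw [h0]; exact Prod.ext h1 h2))

theorem apply_ne (h0 : φ p = 0) {q : X} (h : (φ q).1 ≠ 0 ∨ (φ q).2 ≠ 0) : q ≠ p := by
  rintro rfl
  simp [h0] at h

/-- A chart of `X`, without the centre, as a chart of the blow-up. -/
noncomputable def chartN (p : X) (e : OpenPartialHomeomorph X (ℂ × ℂ)) :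
    PartialEquiv (Pt p) (ℂ × ℂ) where
  toFun x := e (down p x)
  invFun w := up p (e.symm w)
  source := {x | down p x ≠ p ∧ down p x ∈ e.source}
  target := {w | w ∈ e.target ∧ e.symm w ≠ p}
  map_source' x hx := ⟨e.map_source hx.2, by rw [e.left_inv hx.2]; exact hx.1⟩
  map_target' w hw := by
    simp only [mem_ofPred_eq, down_up]
    exact ⟨hw.2, e.map_target hw.1⟩
  left_inv' x hx := by rw [e.left_inv hx.2, up_down hx.1]
  right_inv' w hw := by rw [down_up, e.right_inv hw.1]

open Classical in
/-- The first chart near the exceptional curve. -/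
noncomputable def chartA (hp : p ∈ φ.source) (h0 : φ p = 0) : PartialEquiv (Pt p) (ℂ × ℂ) where
  toFun x := match x with
    | .inl q => ((φ q).1, (φ q).2 / (φ q).1)
    -- On the exceptional curve `some b` is the direction of slope b, second over first coordinate,
    -- and `none` is the vertical direction. The latter lies outside this chart, so the default
    -- value is never used.
    | .inr b => (0, b.getD 0)
  invFun c := if c.1 = 0 then .inr (some c.2) else up p (φ.symm (blA c))
  source := {x | match x with
    | .inl q => q.1 ∈ φ.source ∧ (φ q).1 ≠ 0
    | .inr b => b ≠ none}
  target := {c | blA c ∈ φ.target}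
  map_source' x hx := by
    rcases x with q | b
    · simp only [mem_ofPred_eq, blA] at hx ⊢
      rw [mul_div_cancel₀ _ hx.2]
      exact φ.map_source hx.1
    · simp only [mem_ofPred_eq, blA, zero_mul]
      exact zero_mem_target hp h0
  map_target' c hc := by
    by_cases h : c.1 = 0
    · simp [h]
    · have h1 : φ.symm (blA c) ≠ p := fun h' =>
        h (congrArg Prod.fst ((symm_eq_iff hp h0 hc).1 h'))
      simp only [if_neg h, up_of_ne h1, mem_ofPred_eq]
      exact ⟨φ.map_target hc, by rw [φ.right_inv hc]; exact h⟩
  left_inv' x hx := by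
    rcases x with q | b
    · simp only [mem_ofPred_eq, blA] at hx ⊢
      rw [if_neg hx.2, mul_div_cancel₀ _ hx.2]
      change up p (φ.symm (φ q)) = _
      rw [φ.left_inv hx.1, up_of_ne q.2]
    · rcases b with _ | b
      · exact absurd rfl hx
      · simp
  right_inv' c hc := by
    by_cases h : c.1 = 0
    · simp only [h, if_true, Option.getD_some]
      exact Prod.ext h.symm rfl
    · have h1 : φ.symm (blA c) ≠ p := fun h' =>
        h (congrArg Prod.fst ((symm_eq_iff hp h0 hc).1 h'))
      simp only [if_neg h, up_of_ne h1, φ.right_inv hc]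
      simp [blA, h]

open Classical in
/-- The second chart near the exceptional curve. -/
noncomputable def chartB (hp : p ∈ φ.source) (h0 : φ p = 0) : PartialEquiv (Pt p) (ℂ × ℂ) where
  toFun x := match x with
    | .inl q => ((φ q).1 / (φ q).2, (φ q).2)
    -- The coordinate is the inverse slope. For `none` the default 0 and the convention 0⁻¹ = 0 give
    -- the correct value 0.
    | .inr b => ((b.getD 0)⁻¹, 0)
  invFun c := if c.2 = 0 then .inr (if c.1 = 0 then none else some c.1⁻¹)
    else up p (φ.symm (blB c))
  source := {x | match x with
    | .inl q => q.1 ∈ φ.source ∧ (φ q).2 ≠ 0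
    | .inr b => b ≠ some 0}
  target := {c | blB c ∈ φ.target}
  map_source' x hx := by
    rcases x with q | b
    · simp only [mem_ofPred_eq, blB] at hx ⊢
      rw [div_mul_cancel₀ _ hx.2]
      exact φ.map_source hx.1
    · simp only [mem_ofPred_eq, blB, mul_zero]
      exact zero_mem_target hp h0
  map_target' c hc := by
    by_cases h : c.2 = 0
    · by_cases h1 : c.1 = 0 <;> simp [h, h1]
    · have h1 : φ.symm (blB c) ≠ p := fun h' =>
        h (congrArg Prod.snd ((symm_eq_iff hp h0 hc).1 h'))
      simp only [if_neg h, up_of_ne h1, mem_ofPred_eq]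
      exact ⟨φ.map_target hc, by rw [φ.right_inv hc]; exact h⟩
  left_inv' x hx := by
    rcases x with q | b
    · simp only [mem_ofPred_eq, blB] at hx ⊢
      rw [if_neg hx.2, div_mul_cancel₀ _ hx.2]
      change up p (φ.symm (φ q)) = _
      rw [φ.left_inv hx.1, up_of_ne q.2]
    · rcases b with _ | b
      · simp
      · have hb : b ≠ 0 := fun h => hx (by rw [h])
        simp [hb]
  right_inv' c hc := by
    by_cases h : c.2 = 0
    · by_cases h1 : c.1 = 0
      · simp only [h, h1, if_true, Option.getD_none, inv_zero]
        exact Prod.ext h1.symm h.symm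
      · simp only [h, h1, if_true, if_false, Option.getD_some, inv_inv]
        exact Prod.ext rfl h.symm
    · have h1 : φ.symm (blB c) ≠ p := fun h' =>
        h (congrArg Prod.snd ((symm_eq_iff hp h0 hc).1 h'))
      simp only [if_neg h, up_of_ne h1, φ.right_inv hc]
      simp [blB, h]

theorem blA_symm_ne (hp : p ∈ φ.source) (h0 : φ p = 0) {c : ℂ × ℂ}
    (hc : blA c ∈ φ.target) (h : c.1 ≠ 0) :
    φ.symm (blA c) ≠ p :=
  fun h' => h (congrArg Prod.fst ((symm_eq_iff hp h0 hc).1 h'))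

theorem blB_symm_ne (hp : p ∈ φ.source) (h0 : φ p = 0) {c : ℂ × ℂ}
    (hc : blB c ∈ φ.target) (h : c.2 ≠ 0) :
    φ.symm (blB c) ≠ p :=
  fun h' => h (congrArg Prod.snd ((symm_eq_iff hp h0 hc).1 h'))

/-! ### Transition maps between the charts of a blow-up -/

section transitions

variable (hp : p ∈ φ.source) (h0 : φ p = 0)

theorem up_mem_chartA {q : X} (h : q ≠ p) :
    up p q ∈ (chartA hp h0).source ↔ q ∈ φ.source ∧ (φ q).1 ≠ 0 := by
  rw [up_of_ne h]; rfl

theorem up_mem_chartB {q : X} (h : q ≠ p) :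
    up p q ∈ (chartB hp h0).source ↔ q ∈ φ.source ∧ (φ q).2 ≠ 0 := by
  rw [up_of_ne h]; rfl

theorem chartA_up {q : X} (h : q ≠ p) :
    chartA hp h0 (up p q) = ((φ q).1, (φ q).2 / (φ q).1) := by
  rw [up_of_ne h]; rfl

theorem chartB_up {q : X} (h : q ≠ p) :
    chartB hp h0 (up p q) = ((φ q).1 / (φ q).2, (φ q).2) := by
  rw [up_of_ne h]; rfl

theorem chartA_symm_zero {c : ℂ × ℂ} (h : c.1 = 0) :
    (chartA hp h0).symm c = .inr (some c.2) := if_pos h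

theorem chartA_symm_ne {c : ℂ × ℂ} (h : c.1 ≠ 0) :
    (chartA hp h0).symm c = up p (φ.symm (blA c)) := if_neg h

theorem chartB_symm_zero {c : ℂ × ℂ} (h : c.2 = 0) :
    (chartB hp h0).symm c = .inr (open Classical in if c.1 = 0 then none else some c.1⁻¹) :=
  if_pos h

theorem chartB_symm_ne {c : ℂ × ℂ} (h : c.2 ≠ 0) :
    (chartB hp h0).symm c = up p (φ.symm (blB c)) := if_neg h

theorem down_chartA_symm {c : ℂ × ℂ} (hc : blA c ∈ φ.target) :
    down p ((chartA hp h0).symm c) = φ.symm (blA c) := by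
  by_cases h : c.1 = 0
  · rw [chartA_symm_zero hp h0 h]
    exact ((symm_eq_iff hp h0 hc).2 (by simp [blA, h])).symm
  · rw [chartA_symm_ne hp h0 h, down_up]

theorem down_chartB_symm {c : ℂ × ℂ} (hc : blB c ∈ φ.target) :
    down p ((chartB hp h0).symm c) = φ.symm (blB c) := by
  by_cases h : c.2 = 0
  · rw [chartB_symm_zero hp h0 h]
    exact ((symm_eq_iff hp h0 hc).2 (by simp [blB, h])).symm
  · rw [chartB_symm_ne hp h0 h, down_up]

/-- Holomorphic compatibility of two charts of a set. -/
def Compat {S : Type} (c d : PartialEquiv S (ℂ × ℂ)) : Prop :=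
  IsOpen (c.symm.trans d).source ∧ ContDiffOn ℂ ω (c.symm.trans d) (c.symm.trans d).source

/-- Reduces compatibility to an explicit formula on an explicit open set; each of the lemmas below
supplies such a pair. -/
theorem Compat.of_eq {S : Type} {c d : PartialEquiv S (ℂ × ℂ)} (s : Set (ℂ × ℂ))
    (f : ℂ × ℂ → ℂ × ℂ) (hs : IsOpen s) (hf : ContDiffOn ℂ ω f s)
    (h : ∀ w, (w ∈ c.target ∧ c.symm w ∈ d.source) ↔ w ∈ s) (hfs : ∀ w ∈ s, d (c.symm w) = f w) :
    Compat c d := by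
  have : (c.symm.trans d).source = s := by
    ext w
    rw [← h, PartialEquiv.trans_source]
    rfl
  rw [Compat, this]
  exact ⟨hs, hf.congr hfs⟩

theorem compat_refl {S : Type} (c : PartialEquiv S (ℂ × ℂ)) (h : IsOpen c.target) : Compat c c :=
  .of_eq c.target id h contDiffOn_id (fun _ => ⟨fun h => h.1, fun h => ⟨h, c.map_target h⟩⟩)
    fun _ hw => c.right_inv hw

theorem compat_NN {e e' : OpenPartialHomeomorph X (ℂ × ℂ)} (he : e ∈ X.charts)
    (he' : e' ∈ X.charts) : Compat (chartN p e) (chartN p e') := by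
  refine .of_eq (e.target ∩ e.symm ⁻¹' (e'.source ∩ {p}ᶜ)) (fun w => e' (e.symm w))
    (e.isOpen_inter_preimage_symm (e'.open_source.inter isOpen_compl_singleton))
    ((ComplexSurface.contDiffOn_trans he he').mono fun w hw => ⟨hw.1, hw.2.1⟩) (fun w => ?_) ?_
  · simp only [chartN, PartialEquiv.coe_symm_mk, mem_ofPred_eq, down_up, mem_inter_iff,
      mem_preimage, mem_compl_iff, mem_singleton_iff]
    tauto
  · intro w _
    simp [chartN, down_up]

theorem compat_NA {e : OpenPartialHomeomorph X (ℂ × ℂ)} (he : e ∈ X.charts)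
    (hφ : φ ∈ X.charts) : Compat (chartN p e) (chartA hp h0) := by
  have hO : IsOpen (e.target ∩ e.symm ⁻¹' (φ.source ∩ φ ⁻¹' {c | c.1 ≠ 0})) :=
    e.isOpen_inter_preimage_symm
      (φ.isOpen_inter_preimage (isOpen_ne_fun continuous_fst continuous_const))
  have hN : ∀ w, φ (e.symm w) ∈ {c : ℂ × ℂ | c.1 ≠ 0} → e.symm w ≠ p :=
    fun w hw => apply_ne h0 (Or.inl hw)
  have hc : ContDiffOn ℂ ω (fun w => φ (e.symm w))
      (e.target ∩ e.symm ⁻¹' (φ.source ∩ φ ⁻¹' {c | c.1 ≠ 0})) :=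
    (ComplexSurface.contDiffOn_trans he hφ).mono fun w hw => ⟨hw.1, hw.2.1⟩
  refine .of_eq _ (fun w => ((φ (e.symm w)).1, (φ (e.symm w)).2 / (φ (e.symm w)).1)) hO
    (hc.fst.prodMk (hc.snd.div hc.fst fun w hw => hw.2.2)) (fun w => ?_) ?_
  · constructor
    · rintro ⟨⟨h1, h2⟩, h3⟩
      exact ⟨h1, (up_mem_chartA hp h0 h2).1 h3⟩
    · rintro ⟨h1, h2⟩
      exact ⟨⟨h1, hN w h2.2⟩, (up_mem_chartA hp h0 (hN w h2.2)).2 h2⟩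
  · rintro w ⟨h1, h2⟩
    exact chartA_up hp h0 (hN w h2.2)

theorem compat_NB {e : OpenPartialHomeomorph X (ℂ × ℂ)} (he : e ∈ X.charts)
    (hφ : φ ∈ X.charts) : Compat (chartN p e) (chartB hp h0) := by
  have hO : IsOpen (e.target ∩ e.symm ⁻¹' (φ.source ∩ φ ⁻¹' {c | c.2 ≠ 0})) :=
    e.isOpen_inter_preimage_symm
      (φ.isOpen_inter_preimage (isOpen_ne_fun continuous_snd continuous_const))
  have hN : ∀ w, φ (e.symm w) ∈ {c : ℂ × ℂ | c.2 ≠ 0} → e.symm w ≠ p :=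
    fun w hw => apply_ne h0 (Or.inr hw)
  have hc : ContDiffOn ℂ ω (fun w => φ (e.symm w))
      (e.target ∩ e.symm ⁻¹' (φ.source ∩ φ ⁻¹' {c | c.2 ≠ 0})) :=
    (ComplexSurface.contDiffOn_trans he hφ).mono fun w hw => ⟨hw.1, hw.2.1⟩
  refine .of_eq _ (fun w => ((φ (e.symm w)).1 / (φ (e.symm w)).2, (φ (e.symm w)).2)) hO
    ((hc.fst.div hc.snd fun w hw => hw.2.2).prodMk hc.snd) (fun w => ?_) ?_
  · constructor
    · rintro ⟨⟨h1, h2⟩, h3⟩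
      exact ⟨h1, (up_mem_chartB hp h0 h2).1 h3⟩
    · rintro ⟨h1, h2⟩
      exact ⟨⟨h1, hN w h2.2⟩, (up_mem_chartB hp h0 (hN w h2.2)).2 h2⟩
  · rintro w ⟨h1, h2⟩
    exact chartB_up hp h0 (hN w h2.2)

theorem compat_AN {e : OpenPartialHomeomorph X (ℂ × ℂ)} (he : e ∈ X.charts)
    (hφ : φ ∈ X.charts) : Compat (chartA hp h0) (chartN p e) := by
  refine .of_eq (blA ⁻¹' (φ.target ∩ φ.symm ⁻¹' e.source) ∩ {c | c.1 ≠ 0})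
    (fun c => e (φ.symm (blA c)))
    (((φ.isOpen_inter_preimage_symm e.open_source).preimage contDiff_blA.continuous).inter
      (isOpen_ne_fun continuous_fst continuous_const))
    ((ComplexSurface.contDiffOn_trans hφ he).comp contDiff_blA.contDiffOn fun w hw => hw.1)
    (fun c => ?_) ?_
  · constructor
    · rintro ⟨h1, h2⟩
      have h3 : down p ((chartA hp h0).symm c) ∈ e.source := h2.2
      rw [down_chartA_symm hp h0 h1] at h3
      refine ⟨⟨h1, h3⟩, fun h => h2.1 ?_⟩
      rw [chartA_symm_zero hp h0 h]; rfl
    · rintro ⟨⟨h1, h3⟩, h⟩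
      refine ⟨h1, ?_, ?_⟩ <;> rw [down_chartA_symm hp h0 h1]
      · exact blA_symm_ne hp h0 h1 h
      · exact h3
  · rintro c ⟨⟨h1, h3⟩, h⟩
    exact congrArg e (down_chartA_symm hp h0 h1)

theorem compat_BN {e : OpenPartialHomeomorph X (ℂ × ℂ)} (he : e ∈ X.charts)
    (hφ : φ ∈ X.charts) : Compat (chartB hp h0) (chartN p e) := by
  refine .of_eq (blB ⁻¹' (φ.target ∩ φ.symm ⁻¹' e.source) ∩ {c | c.2 ≠ 0})
    (fun c => e (φ.symm (blB c)))
    (((φ.isOpen_inter_preimage_symm e.open_source).preimage contDiff_blB.continuous).inter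
      (isOpen_ne_fun continuous_snd continuous_const))
    ((ComplexSurface.contDiffOn_trans hφ he).comp contDiff_blB.contDiffOn fun w hw => hw.1)
    (fun c => ?_) ?_
  · constructor
    · rintro ⟨h1, h2⟩
      have h3 : down p ((chartB hp h0).symm c) ∈ e.source := h2.2
      rw [down_chartB_symm hp h0 h1] at h3
      refine ⟨⟨h1, h3⟩, fun h => h2.1 ?_⟩
      rw [chartB_symm_zero hp h0 h]; rfl
    · rintro ⟨⟨h1, h3⟩, h⟩
      refine ⟨h1, ?_, ?_⟩ <;> rw [down_chartB_symm hp h0 h1]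
      · exact blB_symm_ne hp h0 h1 h
      · exact h3
  · rintro c ⟨⟨h1, h3⟩, h⟩
    exact congrArg e (down_chartB_symm hp h0 h1)

/-- The two charts use reciprocal slopes, so the transition is (a, b) ↦ (1/b, ab). It has to be
verified separately on a = 0, where points are directions and not points of X. -/
theorem compat_AB : Compat (chartA hp h0) (chartB hp h0) := by
  refine .of_eq (blA ⁻¹' φ.target ∩ {c | c.2 ≠ 0}) (fun c => (1 / c.2, c.1 * c.2))
    ((φ.open_target.preimage contDiff_blA.continuous).inter
      (isOpen_ne_fun continuous_snd continuous_const))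
    ((contDiffOn_const.div contDiffOn_snd fun w hw => hw.2).prodMk
      (contDiffOn_fst.mul contDiffOn_snd)) (fun c => ?_) ?_
  · change (blA c ∈ φ.target ∧ _) ↔ blA c ∈ φ.target ∧ c.2 ≠ 0
    refine and_congr_right fun h1 => ?_
    by_cases h : c.1 = 0
    · rw [chartA_symm_zero hp h0 h]
      change some c.2 ≠ some 0 ↔ _
      simp
    · rw [chartA_symm_ne hp h0 h, up_mem_chartB hp h0 (blA_symm_ne hp h0 h1 h), φ.right_inv h1]
      have := φ.map_target h1
      simp_all [blA]
  · rintro c ⟨h1, h2⟩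
    by_cases h : c.1 = 0
    · rw [chartA_symm_zero hp h0 h]
      simp [chartB, h]
    · rw [chartA_symm_ne hp h0 h, chartB_up hp h0 (blA_symm_ne hp h0 h1 h), φ.right_inv h1]
      have : c.2 ≠ 0 := h2
      simp only [blA, Prod.mk.injEq, and_true]
      field_simp

theorem compat_BA : Compat (chartB hp h0) (chartA hp h0) := by
  refine .of_eq (blB ⁻¹' φ.target ∩ {c | c.1 ≠ 0}) (fun c => (c.1 * c.2, 1 / c.1))
    ((φ.open_target.preimage contDiff_blB.continuous).inter
      (isOpen_ne_fun continuous_fst continuous_const))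
    ((contDiffOn_fst.mul contDiffOn_snd).prodMk
      (contDiffOn_const.div contDiffOn_fst fun w hw => hw.2)) (fun c => ?_) ?_
  · change (blB c ∈ φ.target ∧ _) ↔ blB c ∈ φ.target ∧ c.1 ≠ 0
    refine and_congr_right fun h1 => ?_
    by_cases h : c.2 = 0
    · rw [chartB_symm_zero hp h0 h]
      change (if c.1 = 0 then none else some c.1⁻¹) ≠ none ↔ _
      by_cases h' : c.1 = 0 <;> simp [h']
    · rw [chartB_symm_ne hp h0 h, up_mem_chartA hp h0 (blB_symm_ne hp h0 h1 h), φ.right_inv h1]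
      have := φ.map_target h1
      simp_all [blB]
  · rintro c ⟨h1, h2⟩
    have h2' : c.1 ≠ 0 := h2
    by_cases h : c.2 = 0
    · rw [chartB_symm_zero hp h0 h]
      simp [chartA, h, h2']
    · rw [chartB_symm_ne hp h0 h, chartA_up hp h0 (blB_symm_ne hp h0 h1 h), φ.right_inv h1]
      simp only [blB, Prod.mk.injEq, true_and]
      field_simp

end transitions

end BlowUp

/-- `π : X' → X` is the blow-up of `X` at the centre `p` of the chart `φ`, with `σ` its inverse away
from the centre and `α`, `β` the two standard charts near the exceptional curve. -/
structure BlowUpData {X X' : ComplexSurface} (π : X' → X) (σ : X → X') (p : X)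
    (φ : OpenPartialHomeomorph X (ℂ × ℂ)) (α β : OpenPartialHomeomorph X' (ℂ × ℂ)) : Prop where
  contMDiff_down : ContMDiff 𝓘(ℂ, ℂ × ℂ) 𝓘(ℂ, ℂ × ℂ) ω π
  contMDiffOn_up : ContMDiffOn 𝓘(ℂ, ℂ × ℂ) 𝓘(ℂ, ℂ × ℂ) ω σ {p}ᶜ
  down_up : ∀ q, q ≠ p → π (σ q) = q
  up_down : ∀ q', π q' ≠ p → σ (π q') = q'
  chart_mem : φ ∈ X.charts
  mem_source : p ∈ φ.source
  chart_center : φ p = 0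
  left_mem : α ∈ X'.charts
  right_mem : β ∈ X'.charts
  source_union : α.source ∪ β.source = π ⁻¹' φ.source
  left_target : α.target = {c | (c.1, c.1 * c.2) ∈ φ.target}
  left_apply : ∀ q ∈ α.source, φ (π q) = ((α q).1, (α q).1 * (α q).2)
  right_target : β.target = {c | (c.1 * c.2, c.2) ∈ φ.target}
  right_apply : ∀ q ∈ β.source, φ (π q) = ((β q).1 * (β q).2, (β q).2)
  -- The last three fields describe how the two charts overlap. They are not part of `IsBlowUpAt`;
  -- compactness of the blow-up rests on them.
  mem_right_of_left : ∀ q ∈ α.source, (α q).2 ≠ 0 → q ∈ β.source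
  mem_left_of_right : ∀ q ∈ β.source, (β q).1 ≠ 0 → q ∈ α.source
  mul_eq_one : ∀ q ∈ α.source, q ∈ β.source → (α q).2 * (β q).1 = 1

theorem BlowUpData.isBlowUpAt {X X' : ComplexSurface} {π : X' → X} {σ : X → X'} {p : X}
    {φ : OpenPartialHomeomorph X (ℂ × ℂ)} {α β : OpenPartialHomeomorph X' (ℂ × ℂ)}
    (h : BlowUpData π σ p φ α β) : IsBlowUpAt π p :=
  ⟨h.contMDiff_down, ⟨σ, h.contMDiffOn_up, h.down_up, h.up_down⟩, φ, h.chart_mem, h.mem_source,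
    h.chart_center, α, h.left_mem, β, h.right_mem, h.source_union, h.left_target, h.left_apply,
    h.right_target, h.right_apply⟩

namespace BlowUp

variable {X : ComplexSurface} {φ : OpenPartialHomeomorph X (ℂ × ℂ)} {p : X}

/-- The charts of the blow-up: those of `X` without the centre, and the two standard ones. -/
inductive Index (X : ComplexSurface)
  | old (e : X.charts)
  | left
  | right

/-- The family of charts of the blow-up. -/
noncomputable def chart (hp : p ∈ φ.source) (h0 : φ p = 0) :
    Index X → PartialEquiv (Pt p) (ℂ × ℂ)
  | .old e => chartN p e
  | .left => chartA hp h0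
  | .right => chartB hp h0

theorem compat (hφ : φ ∈ X.charts) (hp : p ∈ φ.source) (h0 : φ p = 0) (j k : Index X) :
    Compat (chart hp h0 j) (chart hp h0 k) := by
  rcases j with e | _ | _ <;> rcases k with e' | _ | _
  · exact compat_NN e.2 e'.2
  · exact compat_NA hp h0 e.2 hφ
  · exact compat_NB hp h0 e.2 hφ
  · exact compat_AN hp h0 e'.2 hφ
  · exact compat_refl _ (φ.open_target.preimage contDiff_blA.continuous)
  · exact compat_AB hp h0
  · exact compat_BN hp h0 e'.2 hφ
  · exact compat_BA hp h0
  · exact compat_refl _ (φ.open_target.preimage contDiff_blB.continuous)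

theorem exists_mem_chart (hp : p ∈ φ.source) (h0 : φ p = 0) (x : Pt p) :
    ∃ k, x ∈ (chart hp h0 k).source := by
  rcases x with q | _ | b
  · obtain ⟨e, he, hq⟩ := X.exists_chart q
    exact ⟨.old ⟨e, he⟩, q.2, hq⟩
  · exact ⟨.right, nofun⟩
  · exact ⟨.left, nofun⟩

/-- Continuity of the blow-down map in each chart, phrased without a topology on the blow-up, which
does not exist before separation has been proved. It transports separating neighbourhoods from X. -/
theorem exists_nhd (hp : p ∈ φ.source) (h0 : φ p = 0) (k : Index X) {x : Pt p}
    (hx : x ∈ (chart hp h0 k).source) {V : Set X} (hV : IsOpen V) (hxV : down p x ∈ V) :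
    ∃ U : Set (ℂ × ℂ), IsOpen U ∧ chart hp h0 k x ∈ U ∧
      ∀ y ∈ (chart hp h0 k).source, chart hp h0 k y ∈ U → down p y ∈ V := by
  rcases k with e | _ | _
  · refine ⟨e.1.target ∩ e.1.symm ⁻¹' V, e.1.isOpen_inter_preimage_symm hV,
      ⟨e.1.map_source hx.2, ?_⟩, fun y hy hyU => ?_⟩
    · change e.1.symm (e.1 (down p x)) ∈ V
      rwa [e.1.left_inv hx.2]
    · have : e.1.symm (e.1 (down p y)) ∈ V := hyU.2
      rwa [e.1.left_inv hy.2] at this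
  · have key : ∀ y ∈ (chartA hp h0).source,
        φ.symm (blA (chartA hp h0 y)) = down p y := fun y hy => by
      rw [← down_chartA_symm hp h0 ((chartA hp h0).map_source hy), (chartA hp h0).left_inv hy]
    refine ⟨blA ⁻¹' (φ.target ∩ φ.symm ⁻¹' V),
      (φ.isOpen_inter_preimage_symm hV).preimage contDiff_blA.continuous,
      ⟨(chartA hp h0).map_source hx, ?_⟩, fun y hy hyU => ?_⟩
    · change φ.symm (blA (chartA hp h0 x)) ∈ V
      rwa [key x hx]
    · exact key y hy ▸ hyU.2
  · have key : ∀ y ∈ (chartB hp h0).source,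
        φ.symm (blB (chartB hp h0 y)) = down p y := fun y hy => by
      rw [← down_chartB_symm hp h0 ((chartB hp h0).map_source hy), (chartB hp h0).left_inv hy]
    refine ⟨blB ⁻¹' (φ.target ∩ φ.symm ⁻¹' V),
      (φ.isOpen_inter_preimage_symm hV).preimage contDiff_blB.continuous,
      ⟨(chartB hp h0).map_source hx, ?_⟩, fun y hy hyU => ?_⟩
    · change φ.symm (blB (chartB hp h0 x)) ∈ V
      rwa [key x hx]
    · exact key y hy ▸ hyU.2

theorem chartA_mul_chartB (hp : p ∈ φ.source) (h0 : φ p = 0) {x : Pt p}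
    (hA : x ∈ (chartA hp h0).source) (hB : x ∈ (chartB hp h0).source) :
    (chartA hp h0 x).2 * (chartB hp h0 x).1 = 1 := by
  rcases x with q | _ | b
  · have h1 : (φ q).1 ≠ 0 := hA.2
    have h2 : (φ q).2 ≠ 0 := hB.2
    simp only [chartA, chartB]
    field_simp
  · exact absurd rfl hA
  · have hb : b ≠ 0 := fun h => hB (congrArg some h)
    simp [chartA, chartB, hb]

theorem chartA_mem_chartB (hp : p ∈ φ.source) (h0 : φ p = 0) :
    ∀ x ∈ (chartA hp h0).source, (chartA hp h0 x).2 ≠ 0 → x ∈ (chartB hp h0).source := by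
  rintro (q | _ | b) hx h
  · exact ⟨hx.1, fun h2 => h (by simp [chartA, h2])⟩
  · exact absurd rfl hx
  · exact fun h2 => h (by simpa [chartA] using h2)

theorem chartB_mem_chartA (hp : p ∈ φ.source) (h0 : φ p = 0) :
    ∀ x ∈ (chartB hp h0).source, (chartB hp h0 x).1 ≠ 0 → x ∈ (chartA hp h0).source := by
  rintro (q | _ | b) hx h
  · exact ⟨hx.1, fun h2 => h (by simp [chartB, h2])⟩
  · exact absurd (by simp [chartB]) h
  · exact nofun

theorem separated (hp : p ∈ φ.source) (h0 : φ p = 0) (x y : Pt p) (hxy : x ≠ y) :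
    ∃ j k, ∃ U V : Set (ℂ × ℂ), IsOpen U ∧ IsOpen V ∧
    x ∈ (chart hp h0 j).source ∧ chart hp h0 j x ∈ U ∧
    y ∈ (chart hp h0 k).source ∧ chart hp h0 k y ∈ V ∧
    ∀ z ∈ (chart hp h0 j).source, chart hp h0 j z ∈ U → z ∈ (chart hp h0 k).source →
      chart hp h0 k z ∉ V := by
  by_cases h : down p x = down p y
  · have hab : ∀ b : ℂ, ∃ U V : Set (ℂ × ℂ), IsOpen U ∧ IsOpen V ∧
        chart hp h0 .left (.inr (some b)) ∈ U ∧ chart hp h0 .right (.inr none) ∈ V ∧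
        ∀ z ∈ (chart hp h0 .left).source, chart hp h0 .left z ∈ U →
          z ∈ (chart hp h0 .right).source → chart hp h0 .right z ∉ V := by
      intro b
      -- A bounded slope and a small inverse slope are incompatible, since their product is 1.
      refine ⟨{c | ‖c.2‖ < ‖b‖ + 1}, {c | ‖c.1‖ * (‖b‖ + 1) < 1},
        isOpen_lt (by fun_prop) (by fun_prop), isOpen_lt (by fun_prop) (by fun_prop),
        by simp [chart, chartA], by simp [chart, chartB], fun z hz hU hz' hV => ?_⟩
      have h1 := congrArg norm (chartA_mul_chartB hp h0 hz hz')
      rw [norm_mul, norm_one] at h1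
      have h2 : ‖(chartA hp h0 z).2‖ < ‖b‖ + 1 := hU
      have h3 : ‖(chartB hp h0 z).1‖ * (‖b‖ + 1) < 1 := hV
      nlinarith [norm_nonneg (chartB hp h0 z).1]
    rcases x with q | b <;> rcases y with q' | b'
    · exact absurd (congrArg Sum.inl (Subtype.ext h)) hxy
    · exact absurd h q.2
    · exact absurd h.symm q'.2
    · rcases b with _ | b <;> rcases b' with _ | b'
      · exact absurd rfl hxy
      · obtain ⟨U, V, hU, hV, h1, h2, h3⟩ := hab b'
        exact ⟨.right, .left, V, U, hV, hU, nofun, h2, nofun, h1,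
          fun z hz hzV hz' hzU => h3 z hz' hzU hz hzV⟩
      · obtain ⟨U, V, hU, hV, h1, h2, h3⟩ := hab b
        exact ⟨.left, .right, U, V, hU, hV, nofun, h1, nofun, h2, h3⟩
      · have hne : b ≠ b' := fun h => hxy (by rw [h])
        obtain ⟨U, V, hU, hV, hbU, hbV, hUV⟩ := t2_separation hne
        refine ⟨.left, .left, Prod.snd ⁻¹' U, Prod.snd ⁻¹' V, hU.preimage continuous_snd,
          hV.preimage continuous_snd, nofun, hbU, nofun, hbV, fun z _ hz _ hz' => ?_⟩
        exact Set.disjoint_left.1 hUV hz hz'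
  · obtain ⟨U, V, hU, hV, hxU, hyV, hUV⟩ := t2_separation h
    obtain ⟨j, hj⟩ := exists_mem_chart hp h0 x
    obtain ⟨k, hk⟩ := exists_mem_chart hp h0 y
    obtain ⟨U', hU', hxU', h1⟩ := exists_nhd hp h0 j hj hU hxU
    obtain ⟨V', hV', hyV', h2⟩ := exists_nhd hp h0 k hk hV hyV
    exact ⟨j, k, U', V', hU', hV', hj, hxU', hk, hyV', fun z hz hzU hz' hzV =>
      Set.disjoint_left.1 hUV (h1 z hz hzU) (h2 z hz' hzV)⟩

/-- The charts of the blow-up as a gluing atlas. -/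
noncomputable def gluing (hφ : φ ∈ X.charts) (hp : p ∈ φ.source) (h0 : φ p = 0) :
    GluingAtlas (Pt p) (Index X) where
  chart := chart hp h0
  exists_mem := exists_mem_chart hp h0
  isOpen_trans j k := (compat hφ hp h0 j k).1
  contDiffOn_trans j k := (compat hφ hp h0 j k).2
  separated := separated hp h0

end BlowUp

/-- Every point of a complex surface can be blown up. -/
theorem exists_blowUpData {X : ComplexSurface} {φ : OpenPartialHomeomorph X (ℂ × ℂ)} {p : X}
    (hφ : φ ∈ X.charts) (hp : p ∈ φ.source) (h0 : φ p = 0) :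
    ∃ (X' : ComplexSurface) (π : X' → X) (σ : X → X')
      (α β : OpenPartialHomeomorph X' (ℂ × ℂ)), BlowUpData π σ p φ α β := by
  let G := BlowUp.gluing hφ hp h0
  let π : G.surface → X := BlowUp.down p
  let σ : X → G.surface := BlowUp.up p
  let α : OpenPartialHomeomorph G.surface (ℂ × ℂ) := G.ochart .left
  let β : OpenPartialHomeomorph G.surface (ℂ × ℂ) := G.ochart .right
  have hα : α ∈ G.surface.charts := G.ochart_mem .left
  have hβ : β ∈ G.surface.charts := G.ochart_mem .right
  have hαt : ∀ c ∈ α.target, BlowUp.blA c ∈ φ.target := fun c hc => hc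
  have hβt : ∀ c ∈ β.target, BlowUp.blB c ∈ φ.target := fun c hc => hc
  have hαπ : ∀ x ∈ α.source, φ.symm (BlowUp.blA (α x)) = π x := fun x hx => by
    have := BlowUp.down_chartA_symm hp h0 (hαt _ (α.map_source hx))
    rw [← this]
    exact congrArg π (α.left_inv hx)
  have hβπ : ∀ x ∈ β.source, φ.symm (BlowUp.blB (β x)) = π x := fun x hx => by
    have := BlowUp.down_chartB_symm hp h0 (hβt _ (β.map_source hx))
    rw [← this]
    exact congrArg π (β.left_inv hx)
  have hφs := contMDiffOn_symm_of_mem_maximalAtlas hφ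
  refine ⟨G.surface, π, σ, α, β, ?_, ?_, fun q _ => BlowUp.down_up p q,
    fun q hq => BlowUp.up_down hq, hφ, hp, h0, hα, hβ, ?_, rfl, ?_, rfl, ?_,
    BlowUp.chartA_mem_chartB hp h0, BlowUp.chartB_mem_chartA hp h0,
    fun q hq hq' => BlowUp.chartA_mul_chartB hp h0 hq hq'⟩
  · intro x
    obtain ⟨k, hk⟩ := BlowUp.exists_mem_chart hp h0 x
    have hmem : (G.ochart k).source ∈ 𝓝 x := (G.ochart k).open_source.mem_nhds hk
    have hch := contMDiffOn_of_mem_maximalAtlas (G.ochart_mem k)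
    rcases k with e | _ | _
    · have hes := contMDiffOn_symm_of_mem_maximalAtlas e.2
      refine ContMDiffOn.contMDiffAt ((hes.comp hch fun y hy => ?_).congr fun y hy => ?_) hmem
      · exact e.1.map_source hy.2
      · exact (e.1.left_inv hy.2).symm
    · refine ContMDiffOn.contMDiffAt (((hφs.comp BlowUp.contDiff_blA.contMDiff.contMDiffOn
        fun c hc => hc).comp hch fun y hy => ?_).congr fun y hy => ?_) hmem
      · exact hαt _ (α.map_source hy)
      · exact (hαπ y hy).symm
    · refine ContMDiffOn.contMDiffAt (((hφs.comp BlowUp.contDiff_blB.contMDiff.contMDiffOn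
        fun c hc => hc).comp hch fun y hy => ?_).congr fun y hy => ?_) hmem
      · exact hβt _ (β.map_source hy)
      · exact (hβπ y hy).symm
  · intro q hq
    obtain ⟨e, he, hqe⟩ := X.exists_chart q
    have h1 := contMDiffOn_symm_of_mem_maximalAtlas (G.ochart_mem (.old ⟨e, he⟩))
    have h2 := contMDiffOn_of_mem_maximalAtlas he
    have h3 : ContMDiffOn 𝓘(ℂ, ℂ × ℂ) 𝓘(ℂ, ℂ × ℂ) ω σ (e.source ∩ {p}ᶜ) := by
      refine (h1.comp (h2.mono inter_subset_left) fun y hy => ?_).congr fun y hy => ?_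
      · exact ⟨e.map_source hy.1, by rw [e.left_inv hy.1]; exact hy.2⟩
      · exact congrArg σ (e.left_inv hy.1).symm
    exact (h3.contMDiffAt ((e.open_source.inter isOpen_compl_singleton).mem_nhds
      ⟨hqe, hq⟩)).contMDiffWithinAt
  · ext x
    constructor
    · rintro (hx | hx)
      · change π x ∈ φ.source
        rw [← hαπ x hx]
        exact φ.map_target (hαt _ (α.map_source hx))
      · change π x ∈ φ.source
        rw [← hβπ x hx]
        exact φ.map_target (hβt _ (β.map_source hx))
    · intro hx
      rcases x with q | _ | b
      · by_cases h1 : (φ q).1 = 0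
        · exact Or.inr ⟨hx, fun h2 => BlowUp.coord_ne hp h0 hx q.2 ⟨h1, h2⟩⟩
        · exact Or.inl ⟨hx, h1⟩
      · exact Or.inr nofun
      · exact Or.inl nofun
  · intro q hq
    rw [← hαπ q hq, φ.right_inv (hαt _ (α.map_source hq))]; rfl
  · intro q hq
    rw [← hβπ q hq, φ.right_inv (hβt _ (β.map_source hq))]; rfl

/-! ### Lifting charts to a blow-up, and its compactness -/

namespace BlowUpData

variable {X X' : ComplexSurface} {π : X' → X} {σ : X → X'} {p : X}
  {φ : OpenPartialHomeomorph X (ℂ × ℂ)} {α β : OpenPartialHomeomorph X' (ℂ × ℂ)}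
  (h : BlowUpData π σ p φ α β)

include h

theorem down_mem_left {q : X'} (hq : q ∈ α.source) : π q ∈ φ.source := by
  have : q ∈ α.source ∪ β.source := Or.inl hq
  rwa [h.source_union] at this

theorem down_mem_right {q : X'} (hq : q ∈ β.source) : π q ∈ φ.source := by
  have : q ∈ α.source ∪ β.source := Or.inr hq
  rwa [h.source_union] at this

/-- Off the exceptional curve the chart is determined by σ; in this way a parametrisation of `φ` is
passed on to the new charts. -/
theorem left_symm {c : ℂ × ℂ} (hc : c ∈ α.target) (h1 : c.1 ≠ 0) :
    α.symm c = σ (φ.symm (c.1, c.1 * c.2)) := by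
  have hq := α.map_target hc
  have e := h.left_apply _ hq
  rw [α.right_inv hc] at e
  have e2 : π (α.symm c) = φ.symm (c.1, c.1 * c.2) := by
    rw [← e, φ.left_inv (h.down_mem_left hq)]
  rw [← e2, h.up_down]
  intro hp
  rw [hp, h.chart_center] at e
  exact h1 (congrArg Prod.fst e).symm

theorem right_symm {c : ℂ × ℂ} (hc : c ∈ β.target) (h1 : c.2 ≠ 0) :
    β.symm c = σ (φ.symm (c.1 * c.2, c.2)) := by
  have hq := β.map_target hc
  have e := h.right_apply _ hq
  rw [β.right_inv hc] at e
  have e2 : π (β.symm c) = φ.symm (c.1 * c.2, c.2) := by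
    rw [← e, φ.left_inv (h.down_mem_right hq)]
  rw [← e2, h.up_down]
  intro hp
  rw [hp, h.chart_center] at e
  exact h1 (congrArg Prod.snd e).symm

/-- A chart away from the centre, as a chart of the blow-up. -/
noncomputable def liftChart (h : BlowUpData π σ p φ α β) (e : OpenPartialHomeomorph X (ℂ × ℂ))
    (hp : p ∉ e.source) : OpenPartialHomeomorph X' (ℂ × ℂ) where
  toFun q := e (π q)
  invFun w := σ (e.symm w)
  source := π ⁻¹' e.source
  target := e.target
  map_source' _ hq := e.map_source hq
  map_target' w hw := by
    have := e.map_target hw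
    rw [mem_preimage, h.down_up _ fun h' => hp (h' ▸ this)]
    exact this
  left_inv' q hq := by
    rw [e.left_inv hq, h.up_down _ fun h' => hp (h' ▸ hq)]
  right_inv' w hw := by
    rw [h.down_up _ fun h' => hp (h' ▸ e.map_target hw), e.right_inv hw]
  open_source := e.open_source.preimage h.contMDiff_down.continuous
  open_target := e.open_target
  continuousOn_toFun := e.continuousOn.comp h.contMDiff_down.continuous.continuousOn fun _ hq => hq
  continuousOn_invFun := h.contMDiffOn_up.continuousOn.comp e.continuousOn_symm
    fun _ hw h' => hp (mem_singleton_iff.1 h' ▸ e.map_target hw)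

omit h in

theorem liftChart_mem (h : BlowUpData π σ p φ α β) {e : OpenPartialHomeomorph X (ℂ × ℂ)} (he : e ∈ X.charts)
    (hp : p ∉ e.source) : h.liftChart e hp ∈ X'.charts := by
  rw [ComplexSurface.mem_charts_iff] at he ⊢
  exact ⟨he.1.comp h.contMDiff_down.contMDiffOn fun _ hq => hq,
    h.contMDiffOn_up.comp he.2 fun _ hw h' => hp (mem_singleton_iff.1 h' ▸ e.map_target hw)⟩

/-- The blow-up of a compact surface is compact. -/
theorem compactSpace [CompactSpace X] : CompactSpace X' := by
  have hφ0 : (0 : ℂ × ℂ) ∈ φ.target := by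
    rw [← h.chart_center]; exact φ.map_source h.mem_source
  obtain ⟨r, hr, hrt⟩ := Metric.nhds_basis_closedBall.mem_iff.1 (φ.open_target.mem_nhds hφ0)
  -- Over a small bidisc around the centre, the slope or the inverse slope of any point has modulus
  -- at most 1, so two compact bidiscs, one in each chart, cover its preimage. The rest is the image
  -- under σ of a compact set.
  let KA : Set (ℂ × ℂ) := Metric.closedBall 0 r ×ˢ Metric.closedBall 0 1
  let KB : Set (ℂ × ℂ) := Metric.closedBall 0 1 ×ˢ Metric.closedBall 0 r
  have hKA : IsCompact KA := (isCompact_closedBall _ _).prod (isCompact_closedBall _ _)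
  have hKB : IsCompact KB := (isCompact_closedBall _ _).prod (isCompact_closedBall _ _)
  have hA : KA ⊆ α.target := by
    rintro c ⟨h1, h2⟩
    rw [h.left_target]
    apply hrt
    rw [mem_closedBall_zero_iff] at h1 h2 ⊢
    refine max_le h1 ?_
    rw [norm_mul]
    exact (mul_le_of_le_one_right (norm_nonneg _) h2).trans h1
  have hB : KB ⊆ β.target := by
    rintro c ⟨h1, h2⟩
    rw [h.right_target]
    apply hrt
    rw [mem_closedBall_zero_iff] at h1 h2 ⊢
    refine max_le ?_ h2
    rw [norm_mul]
    exact (mul_le_of_le_one_left (norm_nonneg _) h1).trans h2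
  let O : Set X := φ.source ∩ φ ⁻¹' Metric.ball 0 r
  have hO : IsOpen O := φ.isOpen_inter_preimage Metric.isOpen_ball
  have hpO : p ∈ O := ⟨h.mem_source, by simp [h.chart_center, hr]⟩
  have hC : IsCompact (σ '' Oᶜ) :=
    hO.isClosed_compl.isCompact.image_of_continuousOn
      (h.contMDiffOn_up.continuousOn.mono fun q hq h' => hq (mem_singleton_iff.1 h' ▸ hpO))
  refine ⟨(((hKA.image_of_continuousOn (α.continuousOn_symm.mono hA)).union
    (hKB.image_of_continuousOn (β.continuousOn_symm.mono hB))).union hC).of_isClosed_subset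
    isClosed_univ fun q _ => ?_⟩
  by_cases hq : π q ∈ O
  · left
    have hball := mem_ball_zero_iff.1 hq.2
    have h1 : ‖(φ (π q)).1‖ ≤ r := (le_max_left _ _).trans hball.le
    have h2 : ‖(φ (π q)).2‖ ≤ r := (le_max_right _ _).trans hball.le
    have hL : ∀ hqα : q ∈ α.source, ‖(α q).2‖ ≤ 1 → q ∈ α.symm '' KA := fun hqα h3 => by
      rw [h.left_apply q hqα] at h1
      exact ⟨α q, ⟨mem_closedBall_zero_iff.2 h1, mem_closedBall_zero_iff.2 h3⟩, α.left_inv hqα⟩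
    have hR : ∀ hqβ : q ∈ β.source, ‖(β q).1‖ ≤ 1 → q ∈ β.symm '' KB := fun hqβ h3 => by
      rw [h.right_apply q hqβ] at h2
      exact ⟨β q, ⟨mem_closedBall_zero_iff.2 h3, mem_closedBall_zero_iff.2 h2⟩, β.left_inv hqβ⟩
    have hq' : q ∈ α.source ∪ β.source := by rw [h.source_union]; exact hq.1
    have hα : q ∈ α.source → q ∈ α.symm '' KA ∪ β.symm '' KB := fun hqα => by
      by_cases h3 : ‖(α q).2‖ ≤ 1
      · exact Or.inl (hL hqα h3)
      · have hb : (α q).2 ≠ 0 := fun h0 => h3 (by simp [h0])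
        have hqβ := h.mem_right_of_left q hqα hb
        have h4 := congrArg norm (h.mul_eq_one q hqα hqβ)
        rw [norm_mul, norm_one] at h4
        refine Or.inr (hR hqβ ?_)
        nlinarith [norm_nonneg (β q).1]
    rcases hq' with hqα | hqβ
    · exact hα hqα
    · by_cases h3 : ‖(β q).1‖ ≤ 1
      · exact Or.inr (hR hqβ h3)
      · exact hα (h.mem_left_of_right q hqβ fun h0 => h3 (by simp [h0]))
  · right
    exact ⟨π q, hq, h.up_down _ fun h' => hq (h' ▸ hpO)⟩

end BlowUpData

/-! ### Charts of a surface with rational coordinate changes -/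

/-- The points of `ℂ²` off the coordinate axes. -/
def offAxes : Set (ℂ × ℂ) := {w | w.1 ≠ 0 ∧ w.2 ≠ 0}

theorem isOpen_offAxes : IsOpen offAxes :=
  (isOpen_ne_fun continuous_fst continuous_const).inter
    (isOpen_ne_fun continuous_snd continuous_const)

theorem dense_offAxes : Dense offAxes := by
  have h : offAxes = ({0}ᶜ : Set ℂ) ×ˢ ({0}ᶜ : Set ℂ) := rfl
  rw [h]
  exact (dense_compl_singleton 0).prod (dense_compl_singleton 0)

namespace ComplexSurface

variable {X : ComplexSurface} {ι : ℂ × ℂ → X} {e e' : OpenPartialHomeomorph X (ℂ × ℂ)}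
  {P P' : ℂ × ℂ → ℂ × ℂ}

/-- The chart `e` is holomorphic, and `P` expresses the coordinates of `ι : ℂ² → X` in terms of
those of `e`, off the coordinate axes. -/
def HasParam (ι : ℂ × ℂ → X) (e : OpenPartialHomeomorph X (ℂ × ℂ)) (P : ℂ × ℂ → ℂ × ℂ) : Prop :=
  e ∈ X.charts ∧ ∀ w ∈ e.target, w ∈ offAxes → e.symm w = ι (P w)

theorem HasParam.eq (h : HasParam ι e P) {q : X} (hq : q ∈ e.source) (hw : e q ∈ offAxes) :
    q = ι (P (e q)) := by
  rw [← h.2 _ (e.map_source hq) hw, e.left_inv hq]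

/-- A point of an open set in the domain of a chart is a limit of points in this set with nonzero
coordinates. -/
theorem frequently_offAxes {O : Set X} (hO : IsOpen O) {q : X} (hq : q ∈ O) (he : q ∈ e.source) :
    ∃ᶠ r in 𝓝 q, r ∈ O ∧ r ∈ e.source ∧ e r ∈ offAxes := by
  rw [frequently_iff]
  intro U hU
  obtain ⟨V, hVU, hV, hqV⟩ := mem_nhds_iff.1 hU
  have h1 : IsOpen (e.target ∩ e.symm ⁻¹' (V ∩ O)) := e.isOpen_inter_preimage_symm (hV.inter hO)
  obtain ⟨w, ⟨hw, hwV⟩, hwo⟩ := dense_offAxes.inter_open_nonempty _ h1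
    ⟨e q, e.map_source he, by rw [mem_preimage, e.left_inv he]; exact ⟨hqV, hq⟩⟩
  exact ⟨e.symm w, hVU hwV.1, hwV.2, e.map_target hw, by rwa [e.right_inv hw]⟩

/-- The point is moved off the axes of `e` first and then, within the open set so reached, off those
of `e'`. -/
theorem frequently_offAxes₂ {q : X} (he : q ∈ e.source) (he' : q ∈ e'.source) :
    ∃ᶠ r in 𝓝 q, r ∈ e.source ∧ e r ∈ offAxes ∧ r ∈ e'.source ∧ e' r ∈ offAxes := by
  rw [frequently_iff]
  intro U hU
  obtain ⟨V, hVU, hV, hqV⟩ := mem_nhds_iff.1 hU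
  obtain ⟨r, hr, h1, h2⟩ := (frequently_offAxes (e := e) (hV.inter e'.open_source)
    ⟨hqV, he'⟩ he).exists
  have hO : IsOpen (V ∩ (e.source ∩ e ⁻¹' offAxes)) :=
    hV.inter (e.isOpen_inter_preimage isOpen_offAxes)
  obtain ⟨s, hs, h3, h4⟩ := (frequently_offAxes (e := e') hO ⟨hr.1, h1, h2⟩ hr.2).exists
  exact ⟨s, hVU hs.1, hs.2.1, hs.2.2, h3, h4⟩

/-- A closed relation between the coordinates in two charts may be checked off the axes. -/
theorem HasParam.rel (h : HasParam ι e P) (h' : HasParam ι e' P') (hι : Function.Injective ι)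
    (F : (ℂ × ℂ) × (ℂ × ℂ) → ℂ) (hF : Continuous F)
    (hrel : ∀ w ∈ offAxes, ∀ w' ∈ offAxes, P w = P' w' → F (w, w') = 0)
    {q : X} (hq : q ∈ e.source) (hq' : q ∈ e'.source) : F (e q, e' q) = 0 := by
  -- Otherwise F would be nonzero near q as well, in particular at a point off the axes of both
  -- charts, where injectivity of ι equates the two parametrisations.
  by_contra hne
  have hc : ContinuousAt (fun r => F (e r, e' r)) q :=
    hF.continuousAt.comp ((e.continuousAt hq).prodMk (e'.continuousAt hq'))
  obtain ⟨r, ⟨h1, h2, h3, h4⟩, h5⟩ :=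
    ((frequently_offAxes₂ hq hq').and_eventually (hc.eventually_ne hne)).exists
  exact h5 (hrel _ h2 _ h4 (hι (by rw [← h.eq h1 h2, ← h'.eq h3 h4])))

/-- An equality of continuous functions on `ℂ²` may be checked off the axes. -/
theorem eq_of_offAxes {f g : ℂ × ℂ → X} {w : ℂ × ℂ} (hf : ContinuousAt f w) (hg : ContinuousAt g w)
    (h : ∀ᶠ v in 𝓝 w, v ∈ offAxes → f v = g v) : f w = g w := by
  by_contra hne
  have hd : ∃ᶠ v in 𝓝 w, v ∈ offAxes := by
    rw [← mem_closure_iff_frequently]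
    exact dense_offAxes w
  obtain ⟨U, V, hU, hV, hUw, hVw, hUV⟩ := t2_separation hne
  obtain ⟨v, hv, h1, h2, h3⟩ := (hd.and_eventually (h.and ((hf.eventually_mem
    (hU.mem_nhds hUw)).and (hg.eventually_mem (hV.mem_nhds hVw))))).exists
  exact Set.disjoint_left.1 hUV h2 (h1 hv ▸ h3)

end ComplexSurface

open ComplexSurface

/-! ### The tower of blow-ups -/

/-- The slopes of the three lines `x = c y` along which points are blown up. -/
noncomputable def ctr : Fin 3 → ℂ := ![0, 1, -1]

theorem ctr_injective : Function.Injective ctr := by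
  intro i j h
  fin_cases i <;> fin_cases j <;> simp [ctr] at h ⊢ <;> norm_num [neg_eq_iff_add_eq_zero,
    eq_neg_iff_add_eq_zero] at h

/-- Applied with s = y/x at a point where x/y is a centre: the chart `inf` of a tower has no such
points at infinity. -/
theorem ctr_sq_of_mul_eq_one {i : Fin 3} {s : ℂ} (h : s * ctr i = 1) : s ^ 2 = 1 := by
  fin_cases i <;> simp [ctr] at h
  · simp [h]
  · have : s = -1 := by linear_combination -h
    simp [this]

/-- The affine coordinates of the point with `x / y = u` and `1 / y = v`. -/
noncomputable def ofUV (w : ℂ × ℂ) : ℂ × ℂ := (w.1 / w.2, 1 / w.2)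

theorem ofUV_injOn {w w' : ℂ × ℂ} (h : w.2 ≠ 0) (h' : w'.2 ≠ 0) (e : ofUV w = ofUV w') :
    w = w' := by
  simp only [ofUV, Prod.mk.injEq] at e
  have e2 : w.2 = w'.2 := by
    have := e.2
    field_simp at this
    exact this.symm
  refine Prod.ext ?_ e2
  have := e.1
  rw [e2] at this
  field_simp at this
  exact this

/-- The coordinates `(x / y, 1 / y)` in terms of those of the chart at the tip of a tower. -/
noncomputable def tipUV (i : Fin 3) (n : ℕ) (w : ℂ × ℂ) : ℂ × ℂ := (ctr i + w.1 * w.2 ^ n, w.2)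

/-- The coordinates `(x / y, 1 / y)` in terms of those of the chart near the intersection of the
exceptional curve with number `k` and the preceding curve. -/
noncomputable def midUV (i : Fin 3) (k : ℕ) (w : ℂ × ℂ) : ℂ × ℂ :=
  (ctr i + w.1 * (w.1 * w.2) ^ k, w.1 * w.2)

/-- The coordinates `(x, y)` in terms of `(y / x, 1 / x)`. -/
noncomputable def ofEnd (w : ℂ × ℂ) : ℂ × ℂ := (1 / w.2, w.1 / w.2)

theorem midUV_ne {i : Fin 3} {k : ℕ} {w : ℂ × ℂ} (hw : w ∈ offAxes) : (midUV i k w).2 ≠ 0 :=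
  mul_ne_zero hw.1 hw.2

theorem tipUV_ne {i : Fin 3} {n : ℕ} {w : ℂ × ℂ} (hw : w ∈ offAxes) : (tipUV i n w).2 ≠ 0 := hw.2

/-- The surface obtained from the projective plane by `n i` blow-ups on the line `x = ctr i * y`,
with its charts. -/
structure Tower (X : ComplexSurface) (ι : ℂ × ℂ → X) (n : Fin 3 → ℕ) where
  /-- The affine plane. -/
  aff : OpenPartialHomeomorph X (ℂ × ℂ)
  /-- The chart with coordinates `y / x` and `1 / x`. -/
  inf : OpenPartialHomeomorph X (ℂ × ℂ)
  /-- The charts in which the next blow-ups are centred at the origin. -/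
  tip : Fin 3 → OpenPartialHomeomorph X (ℂ × ℂ)
  /-- The charts near the intersections of the exceptional curves. -/
  mid : Fin 3 → ℕ → OpenPartialHomeomorph X (ℂ × ℂ)
  compact : CompactSpace X
  aff_mem : aff ∈ X.charts
  aff_target : aff.target = univ
  aff_symm : ∀ w, aff.symm w = ι w
  inf_param : HasParam ι inf ofEnd
  -- The centres u = ±1 are left out of the line at infinity `w.2 = 0`; u = 0 does not occur in this
  -- chart.
  inf_target : inf.target = {w | w.2 = 0 → w.1 ^ 2 ≠ 1}
  tip_param : ∀ i, HasParam ι (tip i) (fun w => ofUV (tipUV i (n i) w))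
  -- Before the first blow-up at `ctr i` the axis `w.2 = 0` is the line at infinity, and the other
  -- two centres are left out of it. Afterwards it is the newest exceptional curve and the target is
  -- all of ℂ².
  tip_target : ∀ i, (tip i).target = {w | n i = 0 → w.2 = 0 → ∀ j, j ≠ i → w.1 + ctr i ≠ ctr j}
  mid_param : ∀ i k, k < n i → HasParam ι (mid i k) (fun w => ofUV (midUV i k w))
  -- Only for k = 0 is `w.2 = 0` the line at infinity, with u = `w.1 + ctr i`.
  mid_target : ∀ i k, k < n i →
    (mid i k).target = {w | k = 0 → w.2 = 0 → ∀ j, j ≠ i → w.1 + ctr i ≠ ctr j}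
  cover : ∀ q, q ∈ aff.source ∨ q ∈ inf.source ∨ (∃ i, q ∈ (tip i).source) ∨
    ∃ i k, k < n i ∧ q ∈ (mid i k).source

/-! ### Relations between the coordinates of different charts -/

namespace Tower

variable {X : ComplexSurface} {ι : ℂ × ℂ → X} {n : Fin 3 → ℕ} (W : Tower X ι n)

include W

theorem aff_param : HasParam ι W.aff id := ⟨W.aff_mem, fun w _ _ => W.aff_symm w⟩

theorem mem_aff (z : ℂ × ℂ) : ι z ∈ W.aff.source := by
  rw [← W.aff_symm]
  exact W.aff.map_target (by rw [W.aff_target]; trivial)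

theorem aff_apply (z : ℂ × ℂ) : W.aff (ι z) = z := by
  rw [← W.aff_symm]
  exact W.aff.right_inv (by rw [W.aff_target]; trivial)

theorem injective : Function.Injective ι := fun z z' h => by
  rw [← W.aff_apply z, h, W.aff_apply]

theorem eq_of_mem_aff {q : X} (hq : q ∈ W.aff.source) : ι (W.aff q) = q := by
  rw [← W.aff_symm, W.aff.left_inv hq]

theorem continuous : Continuous ι := by
  have := W.aff.continuousOn_symm
  rw [W.aff_target, continuousOn_univ] at this
  exact this.congr W.aff_symm

/-- The parametrisation is assumed only off both axes; by continuity it holds on `w.1 = 0` too. -/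
theorem tip_symm {i : Fin 3} {w : ℂ × ℂ} (hw : w ∈ (W.tip i).target) (h2 : w.2 ≠ 0) :
    (W.tip i).symm w = ι (ofUV (tipUV i (n i) w)) := by
  refine eq_of_offAxes (g := fun w => ι (ofUV (tipUV i (n i) w)))
    ((W.tip i).symm.continuousAt hw) (ContinuousAt.comp (g := ι) W.continuous.continuousAt ?_) ?_
  · have h : ContinuousAt (fun w : ℂ × ℂ => ((ctr i + w.1 * w.2 ^ n i) / w.2, 1 / w.2)) w := by
      fun_prop (disch := assumption)
    exact h
  · filter_upwards [(W.tip i).open_target.eventually_mem hw] with v hv hv'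
    exact (W.tip_param i).2 v hv hv'

theorem aff_tip {q : X} (h : q ∈ W.aff.source) {i : Fin 3} (h' : q ∈ (W.tip i).source) :
    (W.aff q).2 * (W.tip i q).2 = 1 := by
  refine sub_eq_zero.1 (W.aff_param.rel (W.tip_param i) W.injective
    (fun w => w.1.2 * w.2.2 - 1) (by fun_prop) (fun w hw w' hw' e => ?_) h h')
  have := congrArg Prod.snd e
  simp only [id, ofUV, tipUV] at this
  rw [this]
  have := hw'.2
  field_simp
  simp

theorem aff_mid {q : X} (h : q ∈ W.aff.source) {i : Fin 3} {k : ℕ} (hk : k < n i)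
    (h' : q ∈ (W.mid i k).source) :
    (W.aff q).2 * ((W.mid i k q).1 * (W.mid i k q).2) = 1 := by
  refine sub_eq_zero.1 (W.aff_param.rel (W.mid_param i k hk) W.injective
    (fun w => w.1.2 * (w.2.1 * w.2.2) - 1) (by fun_prop) (fun w hw w' hw' e => ?_) h h')
  have := congrArg Prod.snd e
  simp only [id, ofUV, midUV] at this
  rw [this]
  have := hw'.2
  have := hw'.1
  field_simp
  simp

theorem aff_inf {q : X} (h : q ∈ W.aff.source) (h' : q ∈ W.inf.source) :
    (W.aff q).1 * (W.inf q).2 = 1 := by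
  refine sub_eq_zero.1 (W.aff_param.rel W.inf_param W.injective
    (fun w => w.1.1 * w.2.2 - 1) (by fun_prop) (fun w hw w' hw' e => ?_) h h')
  have := congrArg Prod.fst e
  simp only [id, ofEnd] at this
  rw [this]
  have := hw'.2
  field_simp
  simp

omit W in
theorem ofEnd_eq_ofUV {w w' : ℂ × ℂ} (hw : w ∈ offAxes) (hw' : w'.2 ≠ 0) (e : ofEnd w = ofUV w') :
    w.1 * w'.1 = 1 ∧ w.2 * w'.1 = w'.2 := by
  simp only [ofEnd, ofUV, Prod.mk.injEq] at e
  obtain ⟨e1, e2⟩ := e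
  have h1 := hw.1
  have h2 := hw.2
  field_simp at e1 e2
  constructor
  · exact mul_left_cancel₀ h2 (by linear_combination e2 - w.1 * e1)
  · linear_combination -e1

theorem inf_tip {q : X} (h : q ∈ W.inf.source) {i : Fin 3} (h' : q ∈ (W.tip i).source) :
    (W.inf q).1 * (tipUV i (n i) (W.tip i q)).1 = 1 ∧
      (W.inf q).2 * (tipUV i (n i) (W.tip i q)).1 = (W.tip i q).2 := by
  constructor
  · refine sub_eq_zero.1 (W.inf_param.rel (W.tip_param i) W.injective
      (fun w => w.1.1 * (tipUV i (n i) w.2).1 - 1) (by unfold tipUV; fun_prop)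
      (fun w hw w' hw' e => ?_) h h')
    exact sub_eq_zero.2 (ofEnd_eq_ofUV hw (tipUV_ne hw') e).1
  · refine sub_eq_zero.1 (W.inf_param.rel (W.tip_param i) W.injective
      (fun w => w.1.2 * (tipUV i (n i) w.2).1 - w.2.2) (by unfold tipUV; fun_prop)
      (fun w hw w' hw' e => ?_) h h')
    exact sub_eq_zero.2 (ofEnd_eq_ofUV hw (tipUV_ne hw') e).2

theorem inf_mid {q : X} (h : q ∈ W.inf.source) {i : Fin 3} {k : ℕ} (hk : k < n i)
    (h' : q ∈ (W.mid i k).source) :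
    (W.inf q).1 * (midUV i k (W.mid i k q)).1 = 1 ∧
      (W.inf q).2 * (midUV i k (W.mid i k q)).1 = (W.mid i k q).1 * (W.mid i k q).2 := by
  constructor
  · refine sub_eq_zero.1 (W.inf_param.rel (W.mid_param i k hk) W.injective
      (fun w => w.1.1 * (midUV i k w.2).1 - 1) (by unfold midUV; fun_prop)
      (fun w hw w' hw' e => ?_) h h')
    exact sub_eq_zero.2 (ofEnd_eq_ofUV hw (midUV_ne hw') e).1
  · refine sub_eq_zero.1 (W.inf_param.rel (W.mid_param i k hk) W.injective
      (fun w => w.1.2 * (midUV i k w.2).1 - w.2.1 * w.2.2) (by unfold midUV; fun_prop)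
      (fun w hw w' hw' e => ?_) h h')
    exact sub_eq_zero.2 (ofEnd_eq_ofUV hw (midUV_ne hw') e).2

/-- Two charts with coordinates expressed through `(x / y, 1 / y)` are related by the equality of
these. -/
theorem uv_eq {e e' : OpenPartialHomeomorph X (ℂ × ℂ)} {u u' : ℂ × ℂ → ℂ × ℂ}
    (h : HasParam ι e (fun w => ofUV (u w))) (h' : HasParam ι e' (fun w => ofUV (u' w)))
    (hu : Continuous u) (hu' : Continuous u') (hne : ∀ w ∈ offAxes, (u w).2 ≠ 0)
    (hne' : ∀ w ∈ offAxes, (u' w).2 ≠ 0) {q : X} (hq : q ∈ e.source) (hq' : q ∈ e'.source) :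
    u (e q) = u' (e' q) := by
  refine Prod.ext (sub_eq_zero.1 ?_) (sub_eq_zero.1 ?_)
  · refine h.rel h' W.injective (fun w => (u w.1).1 - (u' w.2).1) (by fun_prop) ?_ hq hq'
    intro w hw w' hw' e
    exact sub_eq_zero.2 (congrArg Prod.fst (ofUV_injOn (hne w hw) (hne' w' hw') e))
  · refine h.rel h' W.injective (fun w => (u w.1).2 - (u' w.2).2) (by fun_prop) ?_ hq hq'
    intro w hw w' hw' e
    exact sub_eq_zero.2 (congrArg Prod.snd (ofUV_injOn (hne w hw) (hne' w' hw') e))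

omit W in
theorem continuous_midUV (i : Fin 3) (k : ℕ) : Continuous (midUV i k) := by
  unfold midUV; fun_prop

omit W in
theorem continuous_tipUV (i : Fin 3) (k : ℕ) : Continuous (tipUV i k) := by
  unfold tipUV; fun_prop

theorem tip_tip_uv {q : X} {i j : Fin 3} (h : q ∈ (W.tip i).source) (h' : q ∈ (W.tip j).source) :
    tipUV i (n i) (W.tip i q) = tipUV j (n j) (W.tip j q) :=
  W.uv_eq (W.tip_param i) (W.tip_param j) (continuous_tipUV _ _) (continuous_tipUV _ _)
    (fun _ => tipUV_ne) (fun _ => tipUV_ne) h h'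

theorem tip_mid_uv {q : X} {i j : Fin 3} {k : ℕ} (hk : k < n j) (h : q ∈ (W.tip i).source)
    (h' : q ∈ (W.mid j k).source) :
    tipUV i (n i) (W.tip i q) = midUV j k (W.mid j k q) :=
  W.uv_eq (W.tip_param i) (W.mid_param j k hk) (continuous_tipUV _ _) (continuous_midUV _ _)
    (fun _ => tipUV_ne) (fun _ => midUV_ne) h h'

theorem mid_mid_uv {q : X} {i j : Fin 3} {k l : ℕ} (hk : k < n i) (hl : l < n j)
    (h : q ∈ (W.mid i k).source) (h' : q ∈ (W.mid j l).source) :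
    midUV i k (W.mid i k q) = midUV j l (W.mid j l q) :=
  W.uv_eq (W.mid_param i k hk) (W.mid_param j l hl) (continuous_midUV _ _) (continuous_midUV _ _)
    (fun _ => midUV_ne) (fun _ => midUV_ne) h h'

omit W in
theorem eq_mul_pow {a v A : ℂ} (ha : a ≠ 0) (hv : v ≠ 0) {k m : ℕ}
    (h : a * v ^ k = A * v ^ (k + m)) : a = A * v ^ m ∧ a ≠ 0 :=
  ⟨mul_right_cancel₀ (pow_ne_zero k hv) (by rw [h, pow_add]; ring), ha⟩

/-- Let (a, v) and (A, B) be the two pairs of coordinates. Off the axes v = AB and a v^n = A v^k;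
cancelling v^k and then A leaves the stated relation, which persists on the curves at infinity. It
forces B ≠ 0 on the overlap, and A ≠ 0 when m > 0. -/
theorem tip_mid {q : X} {i : Fin 3} {k m : ℕ} (hk : k + (m + 1) = n i)
    (h : q ∈ (W.tip i).source) (h' : q ∈ (W.mid i k).source) :
    (W.tip i q).1 * ((W.mid i k q).1 ^ m * (W.mid i k q).2 ^ (m + 1)) = 1 := by
  refine sub_eq_zero.1 ((W.tip_param i).rel (W.mid_param i k (by omega)) W.injective
    (fun w => w.1.1 * (w.2.1 ^ m * w.2.2 ^ (m + 1)) - 1) (by fun_prop)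
    (fun w hw w' hw' e => ?_) h h')
  have e := ofUV_injOn (tipUV_ne hw) (midUV_ne hw') e
  have e1 := congrArg Prod.fst e
  have e2 := congrArg Prod.snd e
  simp only [tipUV, midUV, add_right_inj] at e1 e2
  rw [e2, ← hk] at e1
  obtain ⟨e3, e4⟩ := eq_mul_pow hw'.1 (mul_ne_zero hw'.1 hw'.2) e1.symm
  refine sub_eq_zero.2 (mul_left_cancel₀ e4 ?_)
  rw [mul_one]
  conv_rhs => rw [e3]
  ring

/-- The first relation arises by the same cancellation as in `tip_mid`; the second follows from it
and from the equality of the two expressions for v. -/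
theorem mid_mid {q : X} {i : Fin 3} {k l m : ℕ} (hk : k + (m + 1) = l) (hl : l < n i)
    (h : q ∈ (W.mid i l).source) (h' : q ∈ (W.mid i k).source) :
    (W.mid i l q).1 * ((W.mid i k q).1 ^ m * (W.mid i k q).2 ^ (m + 1)) = 1 ∧
      (W.mid i l q).2 = (W.mid i k q).1 ^ (m + 1) * (W.mid i k q).2 ^ (m + 2) := by
  have h1 : (W.mid i l q).1 * ((W.mid i k q).1 ^ m * (W.mid i k q).2 ^ (m + 1)) = 1 := by
    refine sub_eq_zero.1 ((W.mid_param i l hl).rel (W.mid_param i k (by omega)) W.injective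
      (fun w => w.1.1 * (w.2.1 ^ m * w.2.2 ^ (m + 1)) - 1) (by fun_prop)
      (fun w hw w' hw' e => ?_) h h')
    have e := ofUV_injOn (midUV_ne hw) (midUV_ne hw') e
    have e1 := congrArg Prod.fst e
    have e2 := congrArg Prod.snd e
    simp only [midUV, add_right_inj] at e1 e2
    rw [e2, ← hk] at e1
    obtain ⟨e3, e4⟩ := eq_mul_pow hw'.1 (mul_ne_zero hw'.1 hw'.2) e1.symm
    refine sub_eq_zero.2 (mul_left_cancel₀ e4 ?_)
    rw [mul_one]
    conv_rhs => rw [e3]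
    ring
  refine ⟨h1, ?_⟩
  have h2 := congrArg Prod.snd (W.mid_mid_uv hl (by omega : k < n i) h h')
  simp only [midUV] at h2
  linear_combination (-(W.mid i l q).2) * h1 +
    ((W.mid i k q).1 ^ m * (W.mid i k q).2 ^ (m + 1)) * h2

theorem mid_mem_target {q : X} {i : Fin 3} {k : ℕ} (hk : k < n i) (h : q ∈ (W.mid i k).source) :
    k = 0 → (W.mid i k q).2 = 0 → ∀ j, j ≠ i → (W.mid i k q).1 + ctr i ≠ ctr j := by
  have := (W.mid i k).map_source h
  rwa [W.mid_target i k hk] at this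

theorem tip_mem_target {q : X} {i : Fin 3} (h : q ∈ (W.tip i).source) :
    n i = 0 → (W.tip i q).2 = 0 → ∀ j, j ≠ i → (W.tip i q).1 + ctr i ≠ ctr j := by
  have := (W.tip i).map_source h
  rwa [W.tip_target i] at this

theorem inf_mem_target {q : X} (h : q ∈ W.inf.source) :
    (W.inf q).2 = 0 → (W.inf q).1 ^ 2 ≠ 1 := by
  have := W.inf.map_source h
  rwa [W.inf_target] at this

end Tower

namespace ComplexSurface

theorem trans_mem_charts {X : ComplexSurface} {e : OpenPartialHomeomorph X (ℂ × ℂ)}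
    (he : e ∈ X.charts) (τ : OpenPartialHomeomorph (ℂ × ℂ) (ℂ × ℂ))
    (h : ContDiffOn ℂ ω τ τ.source) (h' : ContDiffOn ℂ ω τ.symm τ.target) :
    e.trans τ ∈ X.charts := by
  rw [mem_charts_iff] at he ⊢
  rw [e.trans_source, e.trans_target]
  exact ⟨h.contMDiffOn.comp (he.1.mono inter_subset_left) fun x hx => hx.2,
    he.2.comp (h'.contMDiffOn.mono inter_subset_left) fun x hx => hx.2⟩

end ComplexSurface

theorem isOpen_end_target : IsOpen {w : ℂ × ℂ | w.2 = 0 → w.1 ^ 2 ≠ 1} := by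
  have : {w : ℂ × ℂ | w.2 = 0 → w.1 ^ 2 ≠ 1} = {w | w.2 ≠ 0} ∪ {w | w.1 ^ 2 ≠ 1} := by
    ext w; exact imp_iff_not_or
  rw [this]
  exact (isOpen_ne_fun (by fun_prop) (by fun_prop)).union
    (isOpen_ne_fun (by fun_prop) (by fun_prop))

theorem isOpen_tip_target (i : Fin 3) :
    IsOpen {w : ℂ × ℂ | w.2 = 0 → ∀ j, j ≠ i → w.1 + ctr i ≠ ctr j} := by
  have : {w : ℂ × ℂ | w.2 = 0 → ∀ j, j ≠ i → w.1 + ctr i ≠ ctr j} =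
      {w | w.2 ≠ 0} ∪ ⋂ j, ⋂ (_ : j ≠ i), {w | w.1 + ctr i ≠ ctr j} := by
    ext w
    simp only [mem_union, mem_iInter]
    exact imp_iff_not_or
  rw [this]
  exact (isOpen_ne_fun (by fun_prop) (by fun_prop)).union
    (isOpen_iInter_of_finite fun j => isOpen_iInter_of_finite fun _ =>
      isOpen_ne_fun (by fun_prop) (by fun_prop))

/-! ### The projective plane as a tower without blow-ups -/

namespace PlaneP2

/-- The coordinate change from `(1 / y, x / y)` to `(x / y - c, 1 / y)`, without the points at
infinity on the other two lines. -/
noncomputable def shift (i : Fin 3) : OpenPartialHomeomorph (ℂ × ℂ) (ℂ × ℂ) where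
  toFun w := (w.2 - ctr i, w.1)
  invFun w := (w.2, w.1 + ctr i)
  source := {w | w.1 = 0 → ∀ j, j ≠ i → w.2 ≠ ctr j}
  target := {w | w.2 = 0 → ∀ j, j ≠ i → w.1 + ctr i ≠ ctr j}
  map_source' w hw := by simpa using hw
  map_target' w hw := by simpa using hw
  left_inv' w _ := by simp
  right_inv' w _ := by simp
  open_source := by
    have h := (isOpen_tip_target i).preimage
      (by fun_prop : Continuous fun w : ℂ × ℂ => (w.2 - ctr i, w.1))
    simpa using h
  open_target := isOpen_tip_target i
  continuousOn_toFun := by fun_prop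
  continuousOn_invFun := by fun_prop

theorem contDiffOn_shift (i : Fin 3) : ContDiffOn ℂ ω (shift i) (shift i).source :=
  ((contDiff_snd.sub contDiff_const).prodMk contDiff_fst).contDiffOn

theorem contDiffOn_shift_symm (i : Fin 3) :
    ContDiffOn ℂ ω (shift i).symm (shift i).target :=
  (contDiff_snd.prodMk (contDiff_fst.add contDiff_const)).contDiffOn

theorem point_eq_affinePlane (i : Fin 3) (w z : ℂ × ℂ) (a : ℂ)
    (h : a • vec i w = ![1, z.1, z.2]) : point i w = affinePlane z := by
  symm
  exact (Projectivization.mk_eq_mk_iff' ℂ _ _ _ _).2 ⟨a, h⟩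

theorem ochart_mem (i : Fin 3) : ochart i ∈ projectivePlane.charts :=
  IsManifold.subset_maximalAtlas ((mem_atlas_iff _).2 ⟨i, rfl⟩)

/-- Dividing by a homogeneous coordinate of largest modulus puts each point into the closed unit
bidisc of one of the three charts. -/
theorem compactSpace : CompactSpace projectivePlane := by
  have hK : ∀ i, IsCompact ((ochart i).symm '' (Metric.closedBall 0 1 : Set (ℂ × ℂ))) := fun i =>
    (isCompact_closedBall _ _).image_of_continuousOn
      ((ochart i).continuousOn_symm.mono fun _ _ => mem_univ _)
  refine ⟨(isCompact_iUnion hK).of_isClosed_subset isClosed_univ fun p _ => ?_⟩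
  obtain ⟨i, -, hi⟩ := Finset.exists_max_image Finset.univ
    (fun i => ‖Projectivization.rep (K := ℂ) p i‖) Finset.univ_nonempty
  have hp : Projectivization.rep (K := ℂ) p i ≠ 0 := fun h0 => by
    refine Projectivization.rep_nonzero (K := ℂ) p (funext fun j => ?_)
    have := hi j (Finset.mem_univ j)
    rw [h0, norm_zero] at this
    exact norm_le_zero_iff.1 this
  refine mem_iUnion.2 ⟨i, coord i p, mem_closedBall_zero_iff.2 (max_le ?_ ?_),
    (chart i).left_inv hp⟩
  all_goals
    simp only [coord, norm_div]
    exact div_le_one_of_le₀ (hi _ (Finset.mem_univ _)) (norm_nonneg _)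

end PlaneP2

/-- The projective plane as a tower without blow-ups. -/
noncomputable def Tower.plane : Tower projectivePlane affinePlane (fun _ => 0) where
  aff := PlaneP2.ochart 0
  inf := (PlaneP2.ochart 1).trans (.ofSet _ isOpen_end_target)
  tip i := (PlaneP2.ochart 2).trans (PlaneP2.shift i)
  -- An arbitrary value: no k satisfies k < 0.
  mid _ _ := PlaneP2.ochart 0
  compact := PlaneP2.compactSpace
  aff_mem := PlaneP2.ochart_mem 0
  aff_target := rfl
  aff_symm w := by
    refine PlaneP2.point_eq_affinePlane 0 w w 1 ?_
    funext j
    fin_cases j <;> simp [PlaneP2.vec]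
  inf_param := by
    refine ⟨trans_mem_charts (PlaneP2.ochart_mem 1) _ contDiffOn_id contDiffOn_id,
      fun w _ hw => ?_⟩
    refine PlaneP2.point_eq_affinePlane 1 w _ (1 / w.2) ?_
    have := hw.2
    funext j
    fin_cases j <;> simp [PlaneP2.vec, ofEnd, div_eq_mul_inv, mul_comm, this]
  inf_target := by
    rw [OpenPartialHomeomorph.trans_target]
    exact inter_univ _
  tip_param i := by
    refine ⟨trans_mem_charts (PlaneP2.ochart_mem 2) _ (PlaneP2.contDiffOn_shift i)
      (PlaneP2.contDiffOn_shift_symm i), fun w _ hw => ?_⟩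
    refine PlaneP2.point_eq_affinePlane 2 (w.2, w.1 + ctr i) _ (1 / w.2) ?_
    have := hw.2
    funext j
    fin_cases j <;> simp [PlaneP2.vec, ofUV, tipUV, div_eq_mul_inv, mul_comm, add_comm, this]
  tip_target i := by
    rw [OpenPartialHomeomorph.trans_target]
    refine (inter_univ _).trans ?_
    ext w
    exact ⟨fun h _ => h, fun h => h rfl⟩
  mid_param _ _ h := absurd h (Nat.not_lt_zero _)
  mid_target _ _ h := absurd h (Nat.not_lt_zero _)
  cover q := by
    have htip : q ∈ PlaneP2.nz 2 → ∃ i, q ∈ ((PlaneP2.ochart 2).trans (PlaneP2.shift i)).source := by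
      intro h2
      -- If x/y is a centre, the chart shifted to this centre is taken; otherwise any of the three
      -- contains the point.
      by_cases h : ∃ i, (PlaneP2.coord 2 q).2 = ctr i
      · obtain ⟨i, hi⟩ := h
        exact ⟨i, h2, fun _ j hj h' => hj (ctr_injective (h'.symm.trans hi))⟩
      · exact ⟨0, h2, fun _ j _ h' => h ⟨j, h'⟩⟩
    obtain ⟨i, hi⟩ := PlaneP2.exists_nz q
    by_cases h2 : q ∈ PlaneP2.nz 2
    · exact Or.inr (Or.inr (Or.inl (htip h2)))
    · fin_cases i
      · exact Or.inl hi
      · refine Or.inr (Or.inl ⟨hi, fun _ => ?_⟩)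
        have h0 : Projectivization.rep (K := ℂ) q 2 = 0 := not_not.1 h2
        change (Projectivization.rep (K := ℂ) q 2 / _) ^ 2 ≠ 1
        simp [h0]
      · exact absurd hi h2

/-! ### Adding one blow-up to a tower -/

namespace Tower

variable {X : ComplexSurface} {ι : ℂ × ℂ → X} {n : Fin 3 → ℕ} (W : Tower X ι n)

include W

/-- The centre of the next blow-up on the line `x = ctr i * y`. -/
noncomputable def center (i : Fin 3) : X := (W.tip i).symm 0

theorem zero_mem_tip (i : Fin 3) : (0 : ℂ × ℂ) ∈ (W.tip i).target := by
  rw [W.tip_target]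
  intro _ _ j hj h
  simp only [Prod.fst_zero, zero_add] at h
  exact hj (ctr_injective h).symm

theorem center_mem (i : Fin 3) : W.center i ∈ (W.tip i).source :=
  (W.tip i).map_target (W.zero_mem_tip i)

theorem tip_center (i : Fin 3) : W.tip i (W.center i) = 0 :=
  (W.tip i).right_inv (W.zero_mem_tip i)

/-- This and the next three lemmas show that, among the charts of the tower, the centre lies in `tip
i` alone, so that all others lift unchanged by `liftChart`. -/
theorem center_notMem_aff (i : Fin 3) : W.center i ∉ W.aff.source := fun h => by
  have := W.aff_tip h (W.center_mem i)
  simp [W.tip_center] at this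

theorem center_notMem_inf (i : Fin 3) : W.center i ∉ W.inf.source := fun h => by
  obtain ⟨h1, h2⟩ := W.inf_tip h (W.center_mem i)
  simp only [tipUV, W.tip_center, Prod.fst_zero, Prod.snd_zero, zero_mul, add_zero] at h1 h2
  have hc : ctr i ≠ 0 := fun h0 => by simp [h0] at h1
  exact W.inf_mem_target h ((mul_eq_zero.1 h2).resolve_right hc) (ctr_sq_of_mul_eq_one h1)

theorem center_notMem_tip {i j : Fin 3} (hij : j ≠ i) : W.center i ∉ (W.tip j).source := fun h => by
  have h1 := W.tip_tip_uv (W.center_mem i) h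
  simp only [tipUV, W.tip_center, Prod.fst_zero, Prod.snd_zero, zero_mul, add_zero,
    Prod.mk.injEq] at h1
  obtain ⟨h1, h2⟩ := h1
  rw [← h2] at h1
  by_cases hn : n j = 0
  · rw [hn, pow_zero, mul_one, add_comm] at h1
    exact W.tip_mem_target h hn h2.symm i hij.symm h1.symm
  · rw [zero_pow hn, mul_zero, add_zero] at h1
    exact hij (ctr_injective h1).symm

theorem center_notMem_mid {i j : Fin 3} {k : ℕ} (hk : k < n j) :
    W.center i ∉ (W.mid j k).source := fun h => by
  by_cases hij : i = j
  · subst hij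
    obtain ⟨m, hm⟩ := Nat.exists_eq_add_of_lt hk
    have := W.tip_mid (m := m) (by omega) (W.center_mem i) h
    simp [W.tip_center] at this
  · have h1 := W.tip_mid_uv hk (W.center_mem i) h
    simp only [tipUV, midUV, W.tip_center, Prod.fst_zero, Prod.snd_zero, zero_mul, add_zero,
      Prod.mk.injEq] at h1
    obtain ⟨h1, h2⟩ := h1
    rw [← h2] at h1
    by_cases h0 : k = 0
    · subst h0
      rw [pow_zero, mul_one] at h1
      rcases mul_eq_zero.1 h2.symm with ha | hb
      · rw [ha, add_zero] at h1
        exact hij (ctr_injective h1)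
      · exact W.mid_mem_target hk h rfl hb i hij (by rw [add_comm]; exact h1.symm)
    · rw [zero_pow h0, mul_zero, add_zero] at h1
      exact hij (ctr_injective h1)

/-- In the chart `tip i` the line x = `ctr i` y is the axis `w.1 = 0` with parameter v = 1/y, which
tends to the origin. -/
theorem tendsto_center (i : Fin 3) :
    Tendsto (fun y : ℂ => ι (ctr i * y, y)) (cocompact ℂ) (𝓝 (W.center i)) := by
  have h0 := W.zero_mem_tip i
  have h1 : Tendsto (fun y : ℂ => ((0, y⁻¹) : ℂ × ℂ)) (cocompact ℂ) (𝓝 0) :=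
    (Continuous.prodMk_right (0 : ℂ)).tendsto' (0 : ℂ) 0 rfl |>.comp
      (Metric.cobounded_eq_cocompact (α := ℂ) ▸ tendsto_inv₀_cobounded)
  have h2 := ((W.tip i).symm.continuousAt h0).tendsto.comp h1
  refine h2.congr' ?_
  have hy : ∀ᶠ y : ℂ in cocompact ℂ, y ≠ 0 := by
    have := (isCompact_singleton (x := (0 : ℂ))).compl_mem_cocompact
    exact this
  filter_upwards [hy, h1.eventually_mem ((W.tip i).open_target.mem_nhds h0)] with y hy hy'
  rw [Function.comp_apply, W.tip_symm hy' (inv_ne_zero hy)]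
  simp [ofUV, tipUV]

omit W in
theorem _root_.BlowUpData.liftChart_param {X' : ComplexSurface} {π : X' → X} {σ : X → X'} {p : X}
    {φ : OpenPartialHomeomorph X (ℂ × ℂ)} {α β : OpenPartialHomeomorph X' (ℂ × ℂ)}
    (D : BlowUpData π σ p φ α β) {e : OpenPartialHomeomorph X (ℂ × ℂ)} {P : ℂ × ℂ → ℂ × ℂ}
    (h : HasParam ι e P) (hp : p ∉ e.source) :
    HasParam (fun z => σ (ι z)) (D.liftChart e hp) P :=
  ⟨D.liftChart_mem h.1 hp, fun w hw hw' => congrArg σ (h.2 w hw hw')⟩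

open Classical in
/-- The tower after one more blow-up on the line `x = ctr i * y`. -/
noncomputable def blowUp {i : Fin 3} {X' : ComplexSurface} {π : X' → X} {σ : X → X'}
    {α β : OpenPartialHomeomorph X' (ℂ × ℂ)} (D : BlowUpData π σ (W.center i) (W.tip i) α β) :
    Tower X' (fun z => σ (ι z)) (Function.update n i (n i + 1)) where
  aff := D.liftChart W.aff (W.center_notMem_aff i)
  inf := D.liftChart W.inf (W.center_notMem_inf i)
  tip j := if h : j = i then β else D.liftChart (W.tip j) (W.center_notMem_tip h)
  -- Among the indices that count, the second case occurs only for j = i and k = n i: the chart α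
  -- then sits where the new exceptional curve meets the preceding curve, while β is the new tip.
  mid j k := if h : k < n j then D.liftChart (W.mid j k) (W.center_notMem_mid h) else α
  compact := have := W.compact; D.compactSpace
  aff_mem := D.liftChart_mem W.aff_mem _
  aff_target := W.aff_target
  aff_symm w := congrArg σ (W.aff_symm w)
  inf_param := D.liftChart_param W.inf_param _
  inf_target := W.inf_target
  tip_param j := by
    by_cases h : j = i
    · subst h
      rw [dif_pos rfl, Function.update_self]
      refine ⟨D.right_mem, fun w hw hw' => ?_⟩
      have ht := D.right_target ▸ hw
      rw [D.right_symm hw hw'.2, (W.tip_param j).2 _ ht ⟨mul_ne_zero hw'.1 hw'.2, hw'.2⟩]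
      simp only [tipUV]
      congr 4
      ring
    · rw [dif_neg h, Function.update_of_ne h]
      exact D.liftChart_param (W.tip_param j) _
  tip_target j := by
    by_cases h : j = i
    · subst h
      rw [dif_pos rfl, Function.update_self, D.right_target, W.tip_target]
      ext w
      refine ⟨fun _ h0 => absurd h0 (Nat.succ_ne_zero _), fun _ _ h2 k hk h => hk ?_⟩
      have h2 : w.2 = 0 := h2
      -- On the new exceptional curve the old first coordinate vanishes, so u = `ctr i` there and
      -- the excluded points do not occur.
      simp only [h2, mul_zero, zero_add] at h
      exact (ctr_injective h).symm
    · rw [dif_neg h, Function.update_of_ne h]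
      exact W.tip_target j
  mid_param j k hk := by
    by_cases h : k < n j
    · rw [dif_pos h]
      exact D.liftChart_param (W.mid_param j k h) _
    · rw [dif_neg h]
      have hj : j = i := by
        by_contra hj
        rw [Function.update_of_ne hj] at hk
        exact h hk
      subst hj
      rw [Function.update_self] at hk
      obtain rfl : k = n j := by omega
      refine ⟨D.left_mem, fun w hw hw' => ?_⟩
      have ht := D.left_target ▸ hw
      rw [D.left_symm hw hw'.1, (W.tip_param j).2 _ ht ⟨hw'.1, mul_ne_zero hw'.1 hw'.2⟩]
      rfl
  mid_target j k hk := by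
    by_cases h : k < n j
    · rw [dif_pos h]
      exact W.mid_target j k h
    · rw [dif_neg h]
      have hj : j = i := by
        by_contra hj
        rw [Function.update_of_ne hj] at hk
        exact h hk
      subst hj
      rw [Function.update_self] at hk
      obtain rfl : k = n j := by omega
      rw [D.left_target, W.tip_target]
      ext w
      refine ⟨fun h h0 h2 => h h0 (by simp [h2]), fun h h0 h2 l hl h' => ?_⟩
      rcases mul_eq_zero.1 h2 with h1 | h2
      · simp only [h1, zero_add] at h'
        exact hl (ctr_injective h').symm
      · exact h h0 h2 l hl h'
  cover q := by
    by_cases hq : π q ∈ (W.tip i).source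
    · have : q ∈ α.source ∪ β.source := by rw [D.source_union]; exact hq
      rcases this with h | h
      · refine Or.inr (Or.inr (Or.inr ⟨i, n i, by simp, ?_⟩))
        rwa [dif_neg (lt_irrefl _)]
      · refine Or.inr (Or.inr (Or.inl ⟨i, ?_⟩))
        rwa [dif_pos rfl]
    · rcases W.cover (π q) with h | h | ⟨j, h⟩ | ⟨j, k, hk, h⟩
      · exact Or.inl h
      · exact Or.inr (Or.inl h)
      · refine Or.inr (Or.inr (Or.inl ⟨j, ?_⟩))
        have hj : j ≠ i := fun hj => hq (hj ▸ h)
        rw [dif_neg hj]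
        exact h
      · refine Or.inr (Or.inr (Or.inr ⟨j, k, ?_, ?_⟩))
        · by_cases hj : j = i
          · subst hj
            rw [Function.update_self]
            omega
          · rwa [Function.update_of_ne hj]
        · rw [dif_pos hk]
          exact h

theorem exists_blowUp {L : List ℂ} (hL : IsIteratedBlowUp L X ι) (i : Fin 3) :
    ∃ (X' : ComplexSurface) (ι' : ℂ × ℂ → X'), IsIteratedBlowUp (ctr i :: L) X' ι' ∧
      Nonempty (Tower X' ι' (Function.update n i (n i + 1))) := by
  obtain ⟨X', π, σ, α, β, D⟩ := exists_blowUpData (W.tip_param i).1 (W.center_mem i)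
    (W.tip_center i)
  refine ⟨X', fun z => σ (ι z), .blowUp hL (ctr i) (W.center i) (W.tendsto_center i) X' π
    D.isBlowUpAt _ fun z => ?_, ⟨W.blowUp D⟩⟩
  exact D.down_up _ fun h => W.center_notMem_aff i (h ▸ W.mem_aff z)

omit W in
/-- Several blow-ups in a row on the line `x = ctr i * y`. -/
theorem exists_blowUps {L : List ℂ} (hL : IsIteratedBlowUp L X ι) (hW : Nonempty (Tower X ι n))
    (i : Fin 3) (m : ℕ) :
    ∃ (X' : ComplexSurface) (ι' : ℂ × ℂ → X'),
      IsIteratedBlowUp (List.replicate m (ctr i) ++ L) X' ι' ∧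
        Nonempty (Tower X' ι' (Function.update n i (n i + m))) := by
  induction m with
  | zero => exact ⟨X, ι, hL, by simpa using hW⟩
  | succ m ih =>
    obtain ⟨X', ι', h, ⟨W'⟩⟩ := ih
    obtain ⟨X'', ι'', h', hW'⟩ := W'.exists_blowUp h i
    refine ⟨X'', ι'', by simpa [List.replicate_succ] using h', ?_⟩
    simpa [add_assoc] using hW'

end Tower

/-- The multiplicities of the three centres. -/
def mult : Fin 3 → ℕ := ![2, 4, 4]

theorem exists_tower : ∃ (X : ComplexSurface) (ι : ℂ × ℂ → X),
    IsIteratedBlowUp [-1, -1, -1, -1, 1, 1, 1, 1, 0, 0] X ι ∧ Nonempty (Tower X ι mult) := by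
  obtain ⟨X₁, ι₁, h₁, W₁⟩ := Tower.exists_blowUps .plane ⟨Tower.plane⟩ 0 2
  obtain ⟨X₂, ι₂, h₂, W₂⟩ := Tower.exists_blowUps h₁ W₁ 1 4
  obtain ⟨X₃, ι₃, h₃, W₃⟩ := Tower.exists_blowUps h₂ W₂ 2 4
  refine ⟨X₃, ι₃, by simpa [ctr, List.replicate_succ] using h₃, ?_⟩
  convert W₃ using 2
  funext i
  fin_cases i <;> simp [mult, Function.update]

namespace Tower

variable {X : ComplexSurface} {ι : ℂ × ℂ → X} {n : Fin 3 → ℕ} (W : Tower X ι n)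

include W

/-! ### The line at infinity and the exceptional curves -/

/-- The strict transform of the line at infinity. -/
def line : Set X :=
  {q | q ∈ W.inf.source ∧ (W.inf q).2 = 0} ∪
    {q | ∃ i, q ∈ (W.mid i 0).source ∧ (W.mid i 0 q).2 = 0}

/-- The strict transform of the exceptional curve of the blow-up with number `k` on the line
`x = ctr i * y`, where `k + 1 < n i`. -/
def exc (i : Fin 3) (k : ℕ) : Set X :=
  {q | q ∈ (W.mid i k).source ∧ (W.mid i k q).1 = 0} ∪
    {q | q ∈ (W.mid i (k + 1)).source ∧ (W.mid i (k + 1) q).2 = 0}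

/-- The charts `mid j l` contain no point with v = 0 and u = `ctr i`, whereas v = 0 together with k
≠ 0 or a vanishing first coordinate in `mid i k` would give u = `ctr i`. -/
theorem mid_index_eq_zero {i j : Fin 3} (hij : i ≠ j) {k l : ℕ} (hk : k < n i) (hl : l < n j)
    {q : X} (h : q ∈ (W.mid i k).source) (h' : q ∈ (W.mid j l).source)
    (h0 : (W.mid i k q).1 * (W.mid i k q).2 = 0) : k = 0 ∧ (W.mid i k q).1 ≠ 0 := by
  have huv := W.mid_mid_uv hk hl h h'
  simp only [midUV, Prod.mk.injEq] at huv
  obtain ⟨hu, hv⟩ := huv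
  rw [← hv, h0] at hu
  rw [h0] at hv
  have hl0 : k ≠ 0 ∨ (W.mid i k q).1 = 0 → False := fun hk' => by
    have e : ctr i = ctr j + (W.mid j l q).1 * 0 ^ l := by
      rw [← hu]
      rcases hk' with hk' | hk'
      · rw [zero_pow hk', mul_zero, add_zero]
      · rw [hk', zero_mul, add_zero]
    by_cases hl0 : l = 0
    · subst hl0
      rw [pow_zero, mul_one] at e
      rcases mul_eq_zero.1 hv.symm with hA | hB
      · rw [hA, add_zero] at e
        exact hij (ctr_injective e)
      · exact W.mid_mem_target hl h' rfl hB i hij (by rw [e]; ring)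
    · rw [zero_pow hl0, mul_zero, add_zero] at e
      exact hij (ctr_injective e)
  exact ⟨by_contra fun h => hl0 (Or.inl h), fun h => hl0 (Or.inr h)⟩

theorem mid_of_ne {i j : Fin 3} (hij : i ≠ j) {k l : ℕ} (hk : k < n i) (hl : l < n j)
    {q : X} (h : q ∈ (W.mid i k).source) (h' : q ∈ (W.mid j l).source)
    (h0 : (W.mid j l q).1 = 0 ∨ (W.mid j l q).2 = 0) :
    (k = 0 ∧ (W.mid i k q).2 = 0) ∧ (l = 0 ∧ (W.mid j l q).1 ≠ 0) := by
  have h0' : (W.mid j l q).1 * (W.mid j l q).2 = 0 := mul_eq_zero.2 h0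
  have h1 : (W.mid i k q).1 * (W.mid i k q).2 = 0 := by
    have := congrArg Prod.snd (W.mid_mid_uv hk hl h h')
    exact this.trans h0'
  obtain ⟨h2, h3⟩ := W.mid_index_eq_zero hij hk hl h h' h1
  exact ⟨⟨h2, (mul_eq_zero.1 h1).resolve_left h3⟩, W.mid_index_eq_zero hij.symm hl hk h' h h0'⟩

/-- All claims are read off from `mid_mid`: the factors of a product equal to 1 do not vanish, and
the first coordinate of `mid i k` is among these factors unless m = 0, that is, l = k + 1. -/
theorem mid_of_lt {i : Fin 3} {k l : ℕ} (hkl : k < l) (hl : l < n i) {q : X}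
    (h : q ∈ (W.mid i k).source) (h' : q ∈ (W.mid i l).source) :
    (W.mid i k q).2 ≠ 0 ∧ (W.mid i l q).1 ≠ 0 ∧
      ((W.mid i k q).1 = 0 → l = k + 1) ∧ ((W.mid i k q).1 = 0 ↔ (W.mid i l q).2 = 0) := by
  obtain ⟨m, hm⟩ := Nat.exists_eq_add_of_lt hkl
  obtain ⟨h1, h2⟩ := W.mid_mid (m := m) (by omega) hl h' h
  have hb : (W.mid i k q).2 ≠ 0 := fun h0 => by simp [h0] at h1
  refine ⟨hb, fun h0 => by simp [h0] at h1, fun h0 => ?_, fun h0 => by simp [h2, h0], fun h0 => ?_⟩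
  · by_contra hne
    have hm0 : m ≠ 0 := by omega
    simp [h0, hm0] at h1
  · rw [h2] at h0
    simpa [hb] using h0

/-- In `mid i k` only the exceptional curves number k and k − 1 over the same centre are visible, as
the two axes. Disjointness, transversality and local equations are all deduced from this. -/
theorem mem_exc_iff {i j : Fin 3} {k l : ℕ} (hk : k < n i) (hl : l + 1 < n j) {q : X}
    (h : q ∈ (W.mid i k).source) :
    q ∈ W.exc j l ↔ j = i ∧ ((l = k ∧ (W.mid i k q).1 = 0) ∨
      (l + 1 = k ∧ (W.mid i k q).2 = 0)) := by
  constructor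
  · rintro (⟨h', h0⟩ | ⟨h', h0⟩)
    · by_cases hij : j = i
      · subst hij
        refine ⟨rfl, ?_⟩
        rcases lt_trichotomy k l with hkl | rfl | hkl
        · exact absurd h0 (W.mid_of_lt hkl (by omega) h h').2.1
        · exact Or.inl ⟨rfl, h0⟩
        · obtain ⟨h1, h2, h3, h4⟩ := W.mid_of_lt hkl hk h' h
          exact Or.inr ⟨(h3 h0).symm, h4.1 h0⟩
      · exact absurd h0 (W.mid_of_ne (Ne.symm hij) hk (by omega) h h' (Or.inl h0)).2.2
    · by_cases hij : j = i
      · subst hij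
        refine ⟨rfl, ?_⟩
        rcases lt_trichotomy k (l + 1) with hkl | rfl | hkl
        · obtain ⟨h1, h2, h3, h4⟩ := W.mid_of_lt hkl hl h h'
          exact Or.inl ⟨by have := h3 (h4.2 h0); omega, h4.2 h0⟩
        · exact Or.inr ⟨rfl, h0⟩
        · exact absurd h0 (W.mid_of_lt hkl hk h' h).1
      · exact absurd (W.mid_of_ne (Ne.symm hij) hk hl h h' (Or.inr h0)).2.1 (Nat.succ_ne_zero _)
  · rintro ⟨rfl, ⟨rfl, h0⟩ | ⟨rfl, h0⟩⟩
    · exact Or.inl ⟨h, h0⟩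
    · exact Or.inr ⟨h, h0⟩

theorem mem_line_iff {i : Fin 3} {k : ℕ} (hn : ∀ j, 0 < n j) (hk : k < n i) {q : X}
    (h : q ∈ (W.mid i k).source) : q ∈ W.line ↔ k = 0 ∧ (W.mid i k q).2 = 0 := by
  constructor
  · rintro (⟨h', h0⟩ | ⟨j, h', h0⟩)
    · obtain ⟨h1, h2⟩ := W.inf_mid h' hk h
      have hu : (midUV i k (W.mid i k q)).1 ≠ ctr i := fun hu =>
        W.inf_mem_target h' h0 (ctr_sq_of_mul_eq_one (hu ▸ h1))
      rw [h0, zero_mul] at h2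
      simp only [midUV, ← h2] at hu
      have hk0 : k = 0 := by
        by_contra hk0
        simp [hk0] at hu
      refine ⟨hk0, (mul_eq_zero.1 h2.symm).resolve_left fun ha => ?_⟩
      simp [ha] at hu
    · by_cases hij : j = i
      · subst hij
        rcases Nat.eq_zero_or_pos k with rfl | hk0
        · exact ⟨rfl, h0⟩
        · exact absurd h0 (W.mid_of_lt hk0 hk h' h).1
      · exact (W.mid_of_ne (Ne.symm hij) hk (hn j) h h' (Or.inr h0)).1
  · rintro ⟨rfl, h0⟩
    exact Or.inr ⟨i, h, h0⟩

theorem tip_mid_ne {i j : Fin 3} (hij : i ≠ j) {l : ℕ} (hn : 0 < n i) (hl : l < n j)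
    {q : X} (h : q ∈ (W.tip i).source) (h' : q ∈ (W.mid j l).source) :
    (W.mid j l q).1 * (W.mid j l q).2 ≠ 0 := fun h0 => by
  have huv := W.tip_mid_uv hl h h'
  simp only [tipUV, midUV, Prod.mk.injEq] at huv
  obtain ⟨hu, hv⟩ := huv
  rw [hv, h0, zero_pow hn.ne', mul_zero, add_zero] at hu
  by_cases hl0 : l = 0
  · subst hl0
    rw [pow_zero, mul_one] at hu
    rcases mul_eq_zero.1 h0 with hA | hB
    · rw [hA, add_zero] at hu
      exact hij (ctr_injective hu)
    · exact W.mid_mem_target hl h' rfl hB i hij (by rw [hu]; ring)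
  · rw [zero_pow hl0, mul_zero, add_zero] at hu
    exact hij (ctr_injective hu)

theorem tip_notMem_exc {i j : Fin 3} (hn : 0 < n i) {l : ℕ} (hl : l + 1 < n j) {q : X}
    (h : q ∈ (W.tip i).source) : q ∉ W.exc j l := by
  rintro (⟨h', h0⟩ | ⟨h', h0⟩)
  · by_cases hij : i = j
    · subst hij
      obtain ⟨m, hm⟩ := Nat.exists_eq_add_of_lt hl
      have := W.tip_mid (m := m + 1) (by omega) h h'
      simp [h0] at this
    · exact W.tip_mid_ne hij hn (by omega) h h' (by rw [h0, zero_mul])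
  · by_cases hij : i = j
    · subst hij
      obtain ⟨m, hm⟩ := Nat.exists_eq_add_of_lt hl
      have := W.tip_mid (m := m) (by omega) h h'
      simp [h0] at this
    · exact W.tip_mid_ne hij hn hl h h' (by rw [h0, mul_zero])

theorem tip_notMem_line (hn : ∀ j, 0 < n j) {i : Fin 3} {q : X} (h : q ∈ (W.tip i).source) :
    q ∉ W.line := by
  rintro (⟨h', h0⟩ | ⟨j, h', h0⟩)
  · obtain ⟨h1, h2⟩ := W.inf_tip h' h
    rw [h0, zero_mul] at h2
    simp only [tipUV, ← h2, zero_pow (hn i).ne', mul_zero, add_zero] at h1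
    exact W.inf_mem_target h' h0 (ctr_sq_of_mul_eq_one h1)
  · by_cases hij : i = j
    · subst hij
      obtain ⟨m, hm⟩ := Nat.exists_eq_add_of_lt (hn i)
      have := W.tip_mid (m := m) (by omega) h h'
      simp [h0] at this
    · exact W.tip_mid_ne hij (hn i) (hn j) h h' (by rw [h0, mul_zero])

theorem aff_notMem_exc {j : Fin 3} {l : ℕ} (hl : l + 1 < n j) {q : X}
    (h : q ∈ W.aff.source) : q ∉ W.exc j l := by
  rintro (⟨h', h0⟩ | ⟨h', h0⟩)
  · have := W.aff_mid h (by omega) h'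
    simp [h0] at this
  · have := W.aff_mid h hl h'
    simp [h0] at this

theorem aff_notMem_line (hn : ∀ j, 0 < n j) {q : X} (h : q ∈ W.aff.source) : q ∉ W.line := by
  rintro (⟨h', h0⟩ | ⟨j, h', h0⟩)
  · have := W.aff_inf h h'
    simp [h0] at this
  · have := W.aff_mid h (hn j) h'
    simp [h0] at this

theorem mem_aff_of_inf {q : X} (h : q ∈ W.inf.source) (h0 : (W.inf q).2 ≠ 0) :
    q ∈ W.aff.source := by
  have hw := W.inf.map_source h
  have h1 : W.inf.symm (W.inf q) = ι (ofEnd (W.inf q)) := by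
    refine eq_of_offAxes (g := fun w => ι (ofEnd w))
      (W.inf.symm.continuousAt hw) (ContinuousAt.comp (g := ι) W.continuous.continuousAt ?_) ?_
    · have h : ContinuousAt (fun w : ℂ × ℂ => (1 / w.2, w.1 / w.2)) (W.inf q) := by
        fun_prop (disch := assumption)
      exact h
    · filter_upwards [W.inf.open_target.eventually_mem hw] with v hv hv'
      exact W.inf_param.2 v hv hv'
  rw [W.inf.left_inv h] at h1
  rw [h1]
  exact W.mem_aff _

theorem mid_symm_eq_tip {i : Fin 3} {k : ℕ} (hk : k + 1 = n i) {w : ℂ × ℂ}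
    (hw : w ∈ (W.mid i k).target) (h2 : w.2 ≠ 0) :
    (1 / w.2, w.1 * w.2) ∈ (W.tip i).target ∧
      (W.mid i k).symm w = (W.tip i).symm (1 / w.2, w.1 * w.2) := by
  have ht : ∀ v, v ∈ (W.tip i).target := fun v => by
    rw [W.tip_target]
    exact fun h => by omega
  have hc : ContinuousAt (fun w : ℂ × ℂ => ((1 / w.2, w.1 * w.2) : ℂ × ℂ)) w := by
    fun_prop (disch := assumption)
  refine ⟨ht _, eq_of_offAxes (g := fun w => (W.tip i).symm (1 / w.2, w.1 * w.2))
    ((W.mid i k).symm.continuousAt hw)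
    (ContinuousAt.comp (g := (W.tip i).symm) ((W.tip i).symm.continuousAt (ht _)) hc) ?_⟩
  filter_upwards [(W.mid i k).open_target.eventually_mem hw] with v hv hv'
  have hv2 := hv'.2
  rw [(W.mid_param i k (by omega)).2 v hv hv', W.tip_symm (ht _) (mul_ne_zero hv'.1 hv'.2)]
  simp only [midUV, tipUV, ← hk]
  congr 4
  field_simp
  ring

/-- The new coordinates (a', b') satisfy a'b' = ab and a'(ab)^(k+1) = a(ab)^k, hence a' = 1/b and b'
= ab². On a = 0 this is the change of parameter s ↦ 1/s of the exceptional curve. -/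
theorem mid_symm_eq_succ {i : Fin 3} {k : ℕ} (hk : k + 1 < n i) {w : ℂ × ℂ}
    (hw : w ∈ (W.mid i k).target) (h2 : w.2 ≠ 0) :
    (1 / w.2, w.1 * w.2 ^ 2) ∈ (W.mid i (k + 1)).target ∧
      (W.mid i k).symm w = (W.mid i (k + 1)).symm (1 / w.2, w.1 * w.2 ^ 2) := by
  have ht : ∀ v, v ∈ (W.mid i (k + 1)).target := fun v => by
    rw [W.mid_target i (k + 1) hk]
    exact fun h => by omega
  have hc : ContinuousAt (fun w : ℂ × ℂ => ((1 / w.2, w.1 * w.2 ^ 2) : ℂ × ℂ)) w := by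
    fun_prop (disch := assumption)
  refine ⟨ht _, eq_of_offAxes (g := fun w => (W.mid i (k + 1)).symm (1 / w.2, w.1 * w.2 ^ 2))
    ((W.mid i k).symm.continuousAt hw) (ContinuousAt.comp (g := (W.mid i (k + 1)).symm)
      ((W.mid i (k + 1)).symm.continuousAt (ht _)) hc) ?_⟩
  filter_upwards [(W.mid i k).open_target.eventually_mem hw] with v hv hv'
  have hv2 := hv'.2
  rw [(W.mid_param i k (by omega)).2 v hv hv', (W.mid_param i (k + 1) hk).2 _ (ht _)
    ⟨one_div_ne_zero hv2, mul_ne_zero hv'.1 (pow_ne_zero 2 hv2)⟩]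
  simp only [midUV]
  congr 3 <;> field_simp
  ring

/-- The points off the line at infinity and the exceptional curves which have been blown up again
lie in the affine plane or in the charts at the tips of the tower. -/
theorem cover_compl (q : X) : q ∈ W.line ∨ (∃ i k, k + 1 < n i ∧ q ∈ W.exc i k) ∨
    q ∈ W.aff.source ∨ ∃ i, q ∈ (W.tip i).source := by
  rcases W.cover q with h | h | h | ⟨i, k, hk, h⟩
  · exact Or.inr (Or.inr (Or.inl h))
  · by_cases h0 : (W.inf q).2 = 0
    · exact Or.inl (Or.inl ⟨h, h0⟩)
    · exact Or.inr (Or.inr (Or.inl (W.mem_aff_of_inf h h0)))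
  · exact Or.inr (Or.inr (Or.inr h))
  · by_cases hb : (W.mid i k q).2 = 0
    · rcases k with _ | k
      · exact Or.inl (Or.inr ⟨i, h, hb⟩)
      · exact Or.inr (Or.inl ⟨i, k, hk, Or.inr ⟨h, hb⟩⟩)
    · by_cases ha : (W.mid i k q).1 = 0
      · by_cases hk1 : k + 1 < n i
        · exact Or.inr (Or.inl ⟨i, k, hk1, Or.inl ⟨h, ha⟩⟩)
        · obtain ⟨h1, h2⟩ := W.mid_symm_eq_tip (by omega) ((W.mid i k).map_source h) hb
          rw [(W.mid i k).left_inv h] at h2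
          exact Or.inr (Or.inr (Or.inr ⟨i, h2 ▸ (W.tip i).map_target h1⟩))
      · refine Or.inr (Or.inr (Or.inl ?_))
        rw [(W.mid_param i k hk).eq h ⟨ha, hb⟩]
        exact W.mem_aff _

end Tower

/-! ### Holomorphy and regularity of functions read in a chart -/

namespace ComplexSurface

variable {X : ComplexSurface} {e : OpenPartialHomeomorph X (ℂ × ℂ)} {q : X} {f : X → ℂ}
  {h : ℂ × ℂ → ℂ}

theorem contMDiffAt_of_chart (he : e ∈ X.charts) (hq : q ∈ e.source)
    (hf : f =ᶠ[𝓝 q] fun r => h (e r)) (hh : ContDiffAt ℂ ω h (e q)) :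
    ContMDiffAt 𝓘(ℂ, ℂ × ℂ) 𝓘(ℂ, ℂ) ω f q :=
  (hh.contMDiffAt.comp q ((contMDiffOn_of_mem_maximalAtlas he).contMDiffAt
    (e.open_source.mem_nhds hq))).congr_of_eventuallyEq hf

theorem contMDiffAt_symm_comp (he : e ∈ X.charts)
    {γ : ℂ → ℂ × ℂ} {s : ℂ} (hγ : ContDiffAt ℂ ω γ s) (hs : γ s ∈ e.target) :
    ContMDiffAt 𝓘(ℂ, ℂ) 𝓘(ℂ, ℂ × ℂ) ω (fun s => e.symm (γ s)) s :=
  ContMDiffAt.comp (I' := 𝓘(ℂ, ℂ × ℂ)) (g := e.symm) (f := γ) s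
    ((contMDiffOn_symm_of_mem_maximalAtlas he).contMDiffAt (e.open_target.mem_nhds hs))
    hγ.contMDiffAt

/-- By the chain rule for `f ∘ e.symm`, which agrees with `h` near `e q`, a vanishing derivative of
`f` would make that of `h` vanish. -/
theorem mfderiv_ne_zero_of_chart (he : e ∈ X.charts) (hq : q ∈ e.source)
    (hf : f =ᶠ[𝓝 q] fun r => h (e r)) (hh : DifferentiableAt ℂ h (e q))
    (hne : fderiv ℂ h (e q) ≠ 0) : mfderiv 𝓘(ℂ, ℂ × ℂ) 𝓘(ℂ, ℂ) f q ≠ 0 := by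
  intro h0
  have h1 : MDifferentiableAt 𝓘(ℂ, ℂ × ℂ) 𝓘(ℂ, ℂ) f q :=
    (hh.mdifferentiableAt.comp q (((contMDiffOn_of_mem_maximalAtlas he).contMDiffAt
      (e.open_source.mem_nhds hq)).mdifferentiableAt (by simp))).congr_of_eventuallyEq hf
  have h2 : MDifferentiableAt 𝓘(ℂ, ℂ × ℂ) 𝓘(ℂ, ℂ × ℂ) e.symm (e q) :=
    ((contMDiffOn_symm_of_mem_maximalAtlas he).contMDiffAt
      (e.open_target.mem_nhds (e.map_source hq))).mdifferentiableAt (by simp)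
  have h3 : f ∘ e.symm =ᶠ[𝓝 (e q)] h := by
    have hc : Tendsto e.symm (𝓝 (e q)) (𝓝 q) := by
      have := (e.symm.continuousAt (e.map_source hq)).tendsto
      rwa [e.left_inv hq] at this
    filter_upwards [hc.eventually hf, e.open_target.mem_nhds (e.map_source hq)] with w hw hw'
    rw [Function.comp_apply, hw, e.right_inv hw']
  have h1' : MDifferentiableAt 𝓘(ℂ, ℂ × ℂ) 𝓘(ℂ, ℂ) f (e.symm (e q)) := by rwa [e.left_inv hq]
  have h4 := mfderiv_comp (e q) h1' h2
  apply hne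
  rw [← mfderiv_eq_fderiv, ← h3.mfderiv_eq, h4]
  have h5 : mfderiv 𝓘(ℂ, ℂ × ℂ) 𝓘(ℂ, ℂ) f (e.symm (e q)) = 0 := by
    rw [e.left_inv hq]; exact h0
  rw [h5]
  exact ContinuousLinearMap.zero_comp _

/-- A local equation of a coordinate axis is regular. -/
theorem mfderiv_ne_zero_of_snd_mul (he : e ∈ X.charts) (hq : q ∈ e.source) {k : ℂ → ℂ}
    (hf : f =ᶠ[𝓝 q] fun r => (e r).2 * k (e r).1) (hk : DifferentiableAt ℂ k (e q).1)
    (hne : k (e q).1 ≠ 0) : mfderiv 𝓘(ℂ, ℂ × ℂ) 𝓘(ℂ, ℂ) f q ≠ 0 := by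
  have hk' : DifferentiableAt ℂ (fun w : ℂ × ℂ => k w.1) (e q) :=
    DifferentiableAt.comp (e q) hk differentiableAt_fst
  refine mfderiv_ne_zero_of_chart (h := fun w => w.2 * k w.1) he hq hf
    (differentiableAt_snd.mul hk') fun h0 => hne ?_
  have hd := (hasFDerivAt_snd (𝕜 := ℂ) (p := e q)).mul (hk.hasFDerivAt.comp (e q) hasFDerivAt_fst)
  have h1 := congrArg (fun L => L (0, 1)) (hd.fderiv.symm.trans h0)
  simpa using h1

theorem mfderiv_ne_zero_of_fst (he : e ∈ X.charts) (hq : q ∈ e.source) :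
    mfderiv 𝓘(ℂ, ℂ × ℂ) 𝓘(ℂ, ℂ) (fun r => (e r).1) q ≠ 0 := by
  refine mfderiv_ne_zero_of_chart (h := Prod.fst) he hq (.refl _ _)
    differentiableAt_fst fun h0 => ?_
  have h1 := congrArg (fun L => L (1, 0)) (fderiv_fst.symm.trans h0)
  simp at h1

end ComplexSurface

/-! ### The exceptional curves as rational curves -/

namespace Tower

variable {X : ComplexSurface} {ι : ℂ × ℂ → X} {n : Fin 3 → ℕ} (W : Tower X ι n)

include W

/-- The local equations are a = 0 in `mid i k` and b' = 0 in `mid i (k + 1)`. Since b' = ab², the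
transition function is b², which equals s² at the parameter s = b: the degree is −2. -/
theorem isRationalCurve_exc {i : Fin 3} {k : ℕ} (hk : k + 1 < n i) :
    IsRationalCurve (W.exc i k) (-2) := by
  have hk' : k < n i := by omega
  have ta : ∀ s : ℂ, ((0, s) : ℂ × ℂ) ∈ (W.mid i k).target := fun s => by
    rw [W.mid_target i k hk']
    intro _ _ j hj h
    rw [zero_add] at h
    exact hj (ctr_injective h).symm
  have tb : ∀ s : ℂ, ((s, 0) : ℂ × ℂ) ∈ (W.mid i (k + 1)).target := fun s => by
    rw [W.mid_target i (k + 1) hk]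
    exact fun h => absurd h (Nat.succ_ne_zero _)
  have ma := (W.mid_param i k hk').1
  have mb := (W.mid_param i (k + 1) hk).1
  refine ⟨fun s => (W.mid i k).symm (0, s), fun s => (W.mid i (k + 1)).symm (s, 0), ?_, ?_, ?_, ?_,
    ?_, ?_, ?_, (W.mid i k).source, (W.mid i (k + 1)).source, fun q => (W.mid i k q).1,
    fun q => (W.mid i (k + 1) q).2, fun q => (W.mid i k q).2 ^ 2, (W.mid i k).open_source,
    (W.mid i (k + 1)).open_source, ?_, ?_, ?_, ?_, ?_, ?_, ?_, ?_, ?_, ?_, ?_⟩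
  · exact fun s => contMDiffAt_symm_comp ma (by fun_prop) (ta s)
  · exact fun s => contMDiffAt_symm_comp mb (by fun_prop) (tb s)
  · intro s s' h
    exact congrArg Prod.snd ((W.mid i k).symm.injOn (ta s) (ta s') h)
  · intro s s' h
    exact congrArg Prod.fst ((W.mid i (k + 1)).symm.injOn (tb s) (tb s') h)
  · intro s hs
    have := (W.mid_symm_eq_succ hk (ta s) hs).2
    simpa using this
  · rintro ⟨s, hs⟩
    have h1 := (W.mid i k).map_target (ta s)
    have h2 := (W.mid i (k + 1)).map_target (tb 0)
    change (W.mid i k).symm (0, s) = (W.mid i (k + 1)).symm (0, 0) at hs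
    rw [hs] at h1
    exact (W.mid_of_lt (Nat.lt_succ_self k) hk h1 h2).2.1
      (congrArg Prod.fst ((W.mid i (k + 1)).right_inv (tb 0)))
  · ext q
    constructor
    · rintro (⟨h, h0⟩ | ⟨h, h0⟩)
      · refine Or.inl ⟨(W.mid i k q).2, ?_⟩
        change (W.mid i k).symm (0, _) = q
        rw [← h0]
        exact (W.mid i k).left_inv h
      · refine Or.inr ⟨(W.mid i (k + 1) q).1, ?_⟩
        change (W.mid i (k + 1)).symm (_, 0) = q
        rw [← h0]
        exact (W.mid i (k + 1)).left_inv h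
    · rintro (⟨s, rfl⟩ | ⟨s, rfl⟩)
      · exact Or.inl ⟨(W.mid i k).map_target (ta s), by rw [(W.mid i k).right_inv (ta s)]⟩
      · exact Or.inr ⟨(W.mid i (k + 1)).map_target (tb s),
          by rw [(W.mid i (k + 1)).right_inv (tb s)]⟩
  · rintro _ ⟨s, rfl⟩
    exact (W.mid i k).map_target (ta s)
  · rintro _ ⟨s, rfl⟩
    exact (W.mid i (k + 1)).map_target (tb s)
  · exact fun q hq => (contMDiffAt_of_chart (h := Prod.fst) ma hq (.refl _ _)
      contDiffAt_fst).contMDiffWithinAt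
  · exact fun q hq => (contMDiffAt_of_chart (h := Prod.snd) mb hq (.refl _ _)
      contDiffAt_snd).contMDiffWithinAt
  · intro q hq
    rw [W.mem_exc_iff hk' hk hq]
    simp
  · intro q hq
    rw [W.mem_exc_iff hk hk hq]
    simp
  · exact fun q hq => mfderiv_ne_zero_of_fst ma hq.2
  · exact fun q hq => mfderiv_ne_zero_of_snd_mul (k := fun _ => 1) mb hq.2
      (.of_eq (funext fun r => (mul_one _).symm)) (by fun_prop) one_ne_zero
  · exact fun q hq => (contMDiffAt_of_chart (h := fun w => w.2 ^ 2) ma hq.1 (.refl _ _)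
      (by fun_prop)).contMDiffWithinAt
  · rintro q ⟨h, h'⟩
    have : (W.mid i (k + 1) q).2 = _ := (W.mid_mid (m := 0) rfl hk h' h).2
    simp only [this]
    ring
  · intro s _
    simp only [(W.mid i k).right_inv (ta s)]
    norm_cast

end Tower

/-! ### The cubic with zeros at the three centres -/

theorem eventually_ne_ctr {i : Fin 3} {s : ℂ} (h : ∀ j, j ≠ i → s ≠ ctr j) :
    ∀ᶠ r in 𝓝 s, ∀ j, j ≠ i → r ≠ ctr j := by
  rw [eventually_all]
  intro j
  by_cases hj : j = i
  · simp [hj]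
  · filter_upwards [isOpen_compl_singleton.eventually_mem (h j hj)] with r hr _
    exact hr

theorem sq_ne_one_iff_ne {s : ℂ} : s ^ 2 ≠ 1 ↔ s ≠ 1 ∧ s ≠ -1 := by
  rw [Ne, sq_eq_one_iff, not_or]

/-- The quotient of `u ^ 3 - u` by `u - ctr i`. -/
noncomputable def cofactor (i : Fin 3) (u : ℂ) : ℂ := u ^ 2 + ctr i * u + ctr i ^ 2 - 1

/-- The right-hand side does not depend on i. In `mid i 0` one has v = (u − `ctr i`) b, so b /
`cofactor i u` is the function v/(u³ − u), whichever chart is used. -/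
theorem mul_cofactor (i : Fin 3) (u : ℂ) : (u - ctr i) * cofactor i u = u ^ 3 - u := by
  have : ctr i ^ 3 = ctr i := by fin_cases i <;> simp [ctr]; norm_num
  unfold cofactor
  linear_combination -this

theorem cofactor_ne_zero {i : Fin 3} {u : ℂ} (h : ∀ j, j ≠ i → u ≠ ctr j) :
    cofactor i u ≠ 0 := by
  intro h0
  fin_cases i
  · have h1 := h 1 (by decide)
    have h2 := h 2 (by decide)
    simp only [ctr, Matrix.cons_val] at h1 h2
    apply sq_ne_one_iff_ne.2 ⟨h1, h2⟩
    simp [cofactor, ctr] at h0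
    linear_combination h0
  · have h1 := h 0 (by decide)
    have h2 := h 2 (by decide)
    simp only [ctr, Matrix.cons_val] at h1 h2
    simp [cofactor, ctr] at h0
    have : u * (u + 1) = 0 := by linear_combination h0
    rcases mul_eq_zero.1 this with h3 | h3
    · exact h1 h3
    · exact h2 (eq_neg_of_add_eq_zero_left h3)
  · have h1 := h 0 (by decide)
    have h2 := h 1 (by decide)
    simp only [ctr, Matrix.cons_val] at h1 h2
    simp [cofactor, ctr] at h0
    have : u * (u - 1) = 0 := by linear_combination h0
    rcases mul_eq_zero.1 this with h3 | h3
    · exact h1 h3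
    · exact h2 (sub_eq_zero.1 h3)

namespace Tower

variable {X : ComplexSurface} {ι : ℂ × ℂ → X} {n : Fin 3 → ℕ} (W : Tower X ι n)
  (hn : ∀ i, 0 < n i)

/-! ### The line at infinity as a rational curve -/

section parametrisation

include hn

theorem mem_mid_zero_target {i : Fin 3} {s : ℂ} :
    ((s - ctr i, 0) : ℂ × ℂ) ∈ (W.mid i 0).target ↔ ∀ j, j ≠ i → s ≠ ctr j := by
  rw [W.mid_target i 0 (hn i)]
  simp

theorem mid_symm_eq_mid (i j : Fin 3) {s : ℂ} (hs : ∀ k, s ≠ ctr k) :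
    (W.mid i 0).symm (s - ctr i, 0) = (W.mid j 0).symm (s - ctr j, 0) := by
  have hi := (W.mem_mid_zero_target hn (i := i) (s := s)).2 fun k _ => hs k
  have hj := (W.mem_mid_zero_target hn (i := j) (s := s)).2 fun k _ => hs k
  have hne : s - ctr i + ctr i - ctr j ≠ 0 := by simpa using sub_ne_zero.2 (hs j)
  -- Obtained by solving u = a + `ctr i` = a' + `ctr j` and v = ab = a'b' for (a', b').
  let τ : ℂ × ℂ → ℂ × ℂ := fun w => (w.1 + ctr i - ctr j, w.1 * w.2 / (w.1 + ctr i - ctr j))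
  have hτ : ContinuousAt τ (s - ctr i, 0) := by
    change ContinuousAt (fun w : ℂ × ℂ => _) _
    fun_prop (disch := assumption)
  have hτs : τ (s - ctr i, 0) = (s - ctr j, 0) := by simp [τ]
  have hj' : τ (s - ctr i, 0) ∈ (W.mid j 0).target := by rwa [hτs]
  rw [← hτs]
  refine eq_of_offAxes (g := fun w => (W.mid j 0).symm (τ w)) ((W.mid i 0).symm.continuousAt hi)
    (ContinuousAt.comp (g := (W.mid j 0).symm) ((W.mid j 0).symm.continuousAt hj') hτ) ?_
  have hc : ContinuousAt (fun w : ℂ × ℂ => w.1 + ctr i - ctr j) (s - ctr i, 0) := by fun_prop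
  filter_upwards [(W.mid i 0).open_target.eventually_mem hi,
    hτ.eventually_mem ((W.mid j 0).open_target.mem_nhds hj'), hc.eventually_ne hne]
    with v hv hvj hvn hv'
  rw [(W.mid_param i 0 (hn i)).2 v hv hv', (W.mid_param j 0 (hn j)).2 _ hvj
    ⟨hvn, div_ne_zero (mul_ne_zero hv'.1 hv'.2) hvn⟩]
  have hv1 := hv'.1
  have hv2 := hv'.2
  simp only [midUV, τ, pow_zero, mul_one]
  congr 3
  · ring
  · field_simp

theorem mid_symm_eq_inf {s : ℂ} (hs : ∀ k, s ≠ ctr k) :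
    (W.mid 0 0).symm (s - ctr 0, 0) = W.inf.symm (s⁻¹, 0) := by
  have h0 : s ≠ 0 := hs 0
  have hi := (W.mem_mid_zero_target hn (i := 0) (s := s)).2 fun k _ => hs k
  have hj : ((s⁻¹, 0) : ℂ × ℂ) ∈ W.inf.target := by
    rw [W.inf_target]
    intro _
    rw [inv_pow, Ne, inv_eq_one, ← Ne, sq_ne_one_iff_ne]
    exact ⟨hs 1, hs 2⟩
  -- As `ctr 0` is 0, here a = u, so y/x = 1/a and 1/x = v/u = b.
  let τ : ℂ × ℂ → ℂ × ℂ := fun w => (w.1⁻¹, w.2)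
  have hs0 : s - ctr 0 = s := by simp [ctr]
  rw [hs0] at hi ⊢
  have hτ : ContinuousAt τ (s, 0) := by
    change ContinuousAt (fun w : ℂ × ℂ => _) _
    fun_prop (disch := assumption)
  refine eq_of_offAxes (g := fun w => W.inf.symm (τ w)) ((W.mid 0 0).symm.continuousAt hi)
    (ContinuousAt.comp (g := W.inf.symm) (W.inf.symm.continuousAt hj) hτ) ?_
  filter_upwards [(W.mid 0 0).open_target.eventually_mem hi,
    hτ.eventually_mem (W.inf.open_target.mem_nhds hj)] with v hv hvj hv'
  rw [(W.mid_param 0 0 (hn 0)).2 v hv hv', W.inf_param.2 _ hvj ⟨inv_ne_zero hv'.1, hv'.2⟩]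
  have hv1 := hv'.1
  have hv2 := hv'.2
  simp only [midUV, τ, ofUV, ofEnd]
  congr 2
  · simp [ctr]
    field_simp
  · field_simp

omit hn

open Classical in
/-- The index of the chart used at the point `s` of the line at infinity. -/
noncomputable def lineIndex (s : ℂ) : Fin 3 := if s = 1 then 1 else if s = -1 then 2 else 0

theorem ne_ctr_of_ne_lineIndex {s : ℂ} : ∀ j, j ≠ lineIndex s → s ≠ ctr j := by
  intro j hj
  unfold lineIndex at hj
  split_ifs at hj with h1 h2
  · rw [h1, ← show ctr 1 = 1 from rfl]
    exact fun h => hj (ctr_injective h.symm)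
  · rw [h2, ← show ctr 2 = -1 from rfl]
    exact fun h => hj (ctr_injective h.symm)
  · fin_cases j
    · exact absurd rfl hj
    · exact h1
    · exact h2

/-- The parametrisation of the line at infinity by `x / y`. -/
noncomputable def lineA (s : ℂ) : X :=
  (W.mid (lineIndex s) 0).symm (s - ctr (lineIndex s), 0)

open Classical in
/-- The parametrisation of the line at infinity by `y / x`. -/
noncomputable def lineB (s : ℂ) : X := if s = 0 then W.inf.symm (0, 0) else W.lineA s⁻¹

include hn

/-- Frees the parametrisation from the discontinuous choice of `lineIndex`: near each s a single
chart serves. -/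
theorem lineA_eq {i : Fin 3} {s : ℂ} (h : ∀ j, j ≠ i → s ≠ ctr j) :
    W.lineA s = (W.mid i 0).symm (s - ctr i, 0) := by
  by_cases hi : lineIndex s = i
  · rw [lineA, hi]
  · refine W.mid_symm_eq_mid hn _ _ fun k => ?_
    by_cases hk : k = i
    · exact hk ▸ ne_ctr_of_ne_lineIndex i (Ne.symm hi)
    · exact h k hk

theorem lineB_eq {s : ℂ} (h : s ^ 2 ≠ 1) : W.lineB s = W.inf.symm (s, 0) := by
  by_cases h0 : s = 0
  · rw [lineB, if_pos h0, h0]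
  · have hs : ∀ k, s⁻¹ ≠ ctr k := by
      rw [← inv_inv s, inv_pow, Ne, inv_eq_one, ← Ne, sq_ne_one_iff_ne] at h
      intro k
      fin_cases k
      · exact inv_ne_zero h0
      · exact h.1
      · exact h.2
    rw [lineB, if_neg h0, W.lineA_eq hn (i := 0) fun k _ => hs k, W.mid_symm_eq_inf hn hs, inv_inv]

theorem contMDiff_lineA : ContMDiff 𝓘(ℂ, ℂ) 𝓘(ℂ, ℂ × ℂ) ω W.lineA := by
  intro s
  have hs := ne_ctr_of_ne_lineIndex (s := s)
  have h1 : ContMDiffAt 𝓘(ℂ, ℂ) 𝓘(ℂ, ℂ × ℂ) ω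
      (fun r => (W.mid (lineIndex s) 0).symm (r - ctr (lineIndex s), 0)) s :=
    contMDiffAt_symm_comp (W.mid_param _ 0 (hn _)).1 (by fun_prop)
      ((W.mem_mid_zero_target hn).2 hs)
  refine h1.congr_of_eventuallyEq ?_
  filter_upwards [eventually_ne_ctr hs] with r hr
  exact W.lineA_eq hn hr

theorem contMDiff_lineB : ContMDiff 𝓘(ℂ, ℂ) 𝓘(ℂ, ℂ × ℂ) ω W.lineB := by
  intro s
  -- The points s = ±1 are missing from the chart `inf`; there the other parametrisation is used
  -- after inversion.
  by_cases hs : s ^ 2 = 1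
  · have h0 : s ≠ 0 := fun h0 => by simp [h0] at hs
    have h1 : ContMDiffAt 𝓘(ℂ, ℂ) 𝓘(ℂ, ℂ × ℂ) ω (fun r => W.lineA r⁻¹) s :=
      ContMDiffAt.comp s (W.contMDiff_lineA hn s⁻¹) (contDiffAt_inv ℂ h0).contMDiffAt
    refine h1.congr_of_eventuallyEq ?_
    filter_upwards [isOpen_compl_singleton.eventually_mem h0] with r hr
    exact if_neg hr
  · have h1 : ContMDiffAt 𝓘(ℂ, ℂ) 𝓘(ℂ, ℂ × ℂ) ω (fun r => W.inf.symm (r, 0)) s :=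
      contMDiffAt_symm_comp W.inf_param.1 (by fun_prop) (by rw [W.inf_target]; exact fun _ => hs)
    refine h1.congr_of_eventuallyEq ?_
    have hc : ContinuousAt (fun r : ℂ => r ^ 2) s := by fun_prop
    filter_upwards [hc.eventually_ne hs] with r hr
    exact W.lineB_eq hn hr

theorem lineA_mem (s : ℂ) : W.lineA s ∈ (W.mid (lineIndex s) 0).source ∧
    W.mid (lineIndex s) 0 (W.lineA s) = (s - ctr (lineIndex s), 0) := by
  have h := (W.mem_mid_zero_target hn).2 (ne_ctr_of_ne_lineIndex (s := s))
  exact ⟨(W.mid _ 0).map_target h, (W.mid _ 0).right_inv h⟩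

theorem injective_lineA : Function.Injective W.lineA := by
  intro s s' h
  obtain ⟨h1, h2⟩ := W.lineA_mem hn s
  obtain ⟨h3, h4⟩ := W.lineA_mem hn s'
  rw [← h] at h3 h4
  have := congrArg Prod.fst (W.mid_mid_uv (hn _) (hn _) h1 h3)
  simpa [midUV, h2, h4] using this

omit hn in
theorem inf_zero_mem : ((0, 0) : ℂ × ℂ) ∈ W.inf.target := by
  rw [W.inf_target]
  simp

theorem lineB_zero_notMem : W.lineB 0 ∉ range W.lineA := by
  rintro ⟨s, hs⟩
  obtain ⟨h1, h2⟩ := W.lineA_mem hn s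
  have e : W.lineB 0 = W.inf.symm (0, 0) := if_pos rfl
  rw [hs, e] at h1
  have := (W.inf_mid (W.inf.map_target (W.inf_zero_mem)) (hn _) h1).1
  rw [W.inf.right_inv (W.inf_zero_mem)] at this
  simp at this

theorem injective_lineB : Function.Injective W.lineB := by
  have h0 : ∀ s, s ≠ 0 → W.lineB s ≠ W.lineB 0 := fun s hs h => by
    refine W.lineB_zero_notMem hn ⟨s⁻¹, ?_⟩
    rw [← h, lineB, if_neg hs]
  intro s s' h
  by_cases hs : s = 0
  · by_contra hne
    exact h0 s' (fun h' => hne (by rw [hs, h'])) (by rw [← h, hs])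
  · by_cases hs' : s' = 0
    · exact absurd (hs' ▸ h) (h0 s hs)
    · rw [lineB, lineB, if_neg hs, if_neg hs'] at h
      exact inv_injective (W.injective_lineA hn h)

theorem line_eq : W.line = range W.lineA ∪ range W.lineB := by
  ext q
  constructor
  · rintro (⟨h, h0⟩ | ⟨i, h, h0⟩)
    · refine Or.inr ⟨(W.inf q).1, ?_⟩
      rw [W.lineB_eq hn (W.inf_mem_target h h0), ← h0]
      exact W.inf.left_inv h
    · refine Or.inl ⟨(W.mid i 0 q).1 + ctr i, ?_⟩
      rw [W.lineA_eq hn (W.mid_mem_target (hn i) h rfl h0), add_sub_cancel_right, ← h0]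
      exact (W.mid i 0).left_inv h
  · have hA : ∀ s, W.lineA s ∈ W.line := fun s => by
      obtain ⟨h1, h2⟩ := W.lineA_mem hn s
      exact Or.inr ⟨_, h1, by rw [h2]⟩
    rintro (⟨s, rfl⟩ | ⟨s, rfl⟩)
    · exact hA s
    · by_cases hs : s = 0
      · rw [lineB, if_pos hs]
        exact Or.inl ⟨W.inf.map_target (W.inf_zero_mem),
          by rw [W.inf.right_inv (W.inf_zero_mem)]⟩
      · rw [lineB, if_neg hs]
        exact hA _

end parametrisation

/-! ### Local equations of the line at infinity -/

section equations

/-- The part of the chart `mid i 0` where `x / y` differs from the other two slopes. -/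
def lineNhd (i : Fin 3) : Set X :=
  {q | q ∈ (W.mid i 0).source ∧ ∀ j, j ≠ i → (W.mid i 0 q).1 + ctr i ≠ ctr j}

/-- A neighbourhood of the point at infinity of the line at infinity. -/
def endNhd : Set X := {q | q ∈ W.inf.source ∧ (W.inf q).1 ^ 2 ≠ 1}

theorem isOpen_lineNhd (i : Fin 3) : IsOpen (W.lineNhd i) := by
  have h : IsOpen {w : ℂ × ℂ | ∀ j, j ≠ i → w.1 + ctr i ≠ ctr j} := by
    simp only [ofPred_forall]
    exact isOpen_iInter_of_finite fun j => isOpen_iInter_of_finite fun _ =>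
      isOpen_ne_fun (by fun_prop) (by fun_prop)
  exact (W.mid i 0).isOpen_inter_preimage h

theorem isOpen_endNhd : IsOpen W.endNhd :=
  W.inf.isOpen_inter_preimage (s := {w : ℂ × ℂ | w.1 ^ 2 ≠ 1})
    (isOpen_ne_fun (by fun_prop) (by fun_prop))

open Classical in
/-- A chart containing a given point near the line at infinity. -/
noncomputable def nhdIndex (q : X) : Fin 3 := if h : ∃ i, q ∈ W.lineNhd i then h.choose else 0

theorem mem_nhdIndex {q : X} {i : Fin 3} (h : q ∈ W.lineNhd i) : q ∈ W.lineNhd (W.nhdIndex q) := by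
  have h' : ∃ i, q ∈ W.lineNhd i := ⟨i, h⟩
  rw [nhdIndex, dif_pos h']
  exact h'.choose_spec

/-- The function `x / y` near the line at infinity. -/
noncomputable def slope (q : X) : ℂ := (W.mid (W.nhdIndex q) 0 q).1 + ctr (W.nhdIndex q)

/-- The local equation of the line at infinity away from the point `y / x = 0`. -/
noncomputable def lineEq (q : X) : ℂ :=
  (W.mid (W.nhdIndex q) 0 q).2 / cofactor (W.nhdIndex q) (W.slope q)

open Classical in
/-- The local equation of the line at infinity away from the point `x / y = 0`. -/
noncomputable def endEq (q : X) : ℂ :=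
  if q ∈ W.endNhd then (W.inf q).2 / (1 - (W.inf q).1 ^ 2) else W.slope q ^ 2 * W.lineEq q

include hn

theorem slope_eq {q : X} {i : Fin 3} (h : q ∈ W.lineNhd i) :
    W.slope q = (W.mid i 0 q).1 + ctr i := by
  have := congrArg Prod.fst (W.mid_mid_uv (hn _) (hn _) (W.mem_nhdIndex h).1 h.1)
  simpa [midUV, slope, add_comm] using this

/-- Both sides are v/(u³ − u) by `mul_cofactor`. If the two charts differ, u is neither of their
centres, so the factors cancelled are nonzero. -/
theorem lineEq_eq {q : X} {i : Fin 3} (h : q ∈ W.lineNhd i) :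
    W.lineEq q = (W.mid i 0 q).2 / cofactor i ((W.mid i 0 q).1 + ctr i) := by
  have h' := W.mem_nhdIndex h
  have hs := W.slope_eq hn h
  have hs' : W.slope q = (W.mid (W.nhdIndex q) 0 q).1 + ctr (W.nhdIndex q) := rfl
  by_cases hij : W.nhdIndex q = i
  · rw [lineEq, hs, hij]
  · have hv := congrArg Prod.snd (W.mid_mid_uv (hn _) (hn _) h'.1 h.1)
    have h1 := h'.2 i (Ne.symm hij)
    have h2 := h.2 _ hij
    have c1 := cofactor_ne_zero h'.2
    have c2 := cofactor_ne_zero h.2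
    have m1 := mul_cofactor (W.nhdIndex q) (W.slope q)
    have m2 := mul_cofactor i (W.slope q)
    rw [← hs'] at h1 c1
    rw [← hs] at h2 c2
    have ha := sub_ne_zero.2 h2
    have hA := sub_ne_zero.2 h1
    have e1 : (W.mid (W.nhdIndex q) 0 q).1 = W.slope q - ctr (W.nhdIndex q) := by rw [hs']; ring
    have e2 : (W.mid i 0 q).1 = W.slope q - ctr i := by rw [hs]; ring
    simp only [midUV, e1, e2] at hv
    rw [lineEq, ← hs, div_eq_div_iff c1 c2]
    refine mul_left_cancel₀ (mul_ne_zero ha hA) ?_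
    linear_combination ((W.slope q - ctr i) * cofactor i (W.slope q)) * hv -
      ((W.slope q - ctr i) * (W.mid i 0 q).2) * (m1 - m2)

/-- In `inf` the coordinates are 1/u and v/u, and (v/u)/(1 − 1/u²) = u² · v/(u³ − u). -/
theorem endEq_eq {q : X} {i : Fin 3} (h : q ∈ W.lineNhd i) :
    W.endEq q = W.slope q ^ 2 * W.lineEq q := by
  by_cases he : q ∈ W.endNhd
  · have hs := W.slope_eq hn h
    obtain ⟨h1, h2⟩ := W.inf_mid he.1 (hn i) h.1
    have hc := cofactor_ne_zero h.2
    have m := mul_cofactor i (W.slope q)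
    have hs1 : 1 - (W.inf q).1 ^ 2 ≠ 0 := sub_ne_zero.2 (Ne.symm he.2)
    have e2 : (W.mid i 0 q).1 = W.slope q - ctr i := by rw [hs]; ring
    simp only [midUV, e2, pow_zero, mul_one, add_sub_cancel] at h1 h2
    have hu : W.slope q ≠ 0 := right_ne_zero_of_mul_eq_one h1
    have ha : W.slope q - ctr i ≠ 0 := fun h0 => hs1 <| by
      rw [h0, zero_mul] at m
      refine (mul_eq_zero.1 ?_).resolve_left (pow_ne_zero 3 hu)
      linear_combination -m - W.slope q * (W.inf q).1 * (W.slope q) * h1 - W.slope q * h1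
    rw [endEq, if_pos he, W.lineEq_eq hn h, ← hs, ← mul_div_assoc]
    rw [← hs] at hc
    rw [div_eq_div_iff hs1 hc]
    refine mul_left_cancel₀ ha ?_
    linear_combination (W.inf q).2 * m + W.slope q ^ 2 * (1 - (W.inf q).1 ^ 2) * h2 +
      (W.inf q).2 * W.slope q * ((W.inf q).1 * W.slope q + 1) * h1
  · rw [endEq, if_neg he]

theorem mem_line_iff_inf {q : X} (h : q ∈ W.inf.source) : q ∈ W.line ↔ (W.inf q).2 = 0 :=
  ⟨fun hq => by_contra fun h0 => W.aff_notMem_line hn (W.mem_aff_of_inf h h0) hq,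
    fun h0 => Or.inl ⟨h, h0⟩⟩

theorem lineEq_eventuallyEq {q : X} {i : Fin 3} (h : q ∈ W.lineNhd i) :
    W.lineEq =ᶠ[𝓝 q] fun r => (W.mid i 0 r).2 * (cofactor i ((W.mid i 0 r).1 + ctr i))⁻¹ := by
  filter_upwards [(W.isOpen_lineNhd i).mem_nhds h] with r hr
  rw [W.lineEq_eq hn hr, div_eq_mul_inv]

theorem endEq_eventuallyEq {q : X} {i : Fin 3} (h : q ∈ W.lineNhd i) :
    W.endEq =ᶠ[𝓝 q] fun r => (W.mid i 0 r).2 * (((W.mid i 0 r).1 + ctr i) ^ 2 *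
      (cofactor i ((W.mid i 0 r).1 + ctr i))⁻¹) := by
  filter_upwards [(W.isOpen_lineNhd i).mem_nhds h] with r hr
  rw [W.endEq_eq hn hr, W.lineEq_eq hn hr, W.slope_eq hn hr]
  ring

omit hn in
theorem endEq_eventuallyEq_inf {q : X} (h : q ∈ W.endNhd) :
    W.endEq =ᶠ[𝓝 q] fun r => (W.inf r).2 * (1 - (W.inf r).1 ^ 2)⁻¹ := by
  filter_upwards [W.isOpen_endNhd.mem_nhds h] with r hr
  rw [endEq, if_pos hr, div_eq_mul_inv]

/-- The equations v/(u³ − u) and u² v/(u³ − u) have the transition function u², equal to s² at the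
parameter s = u. The denominator has a simple zero at each of the three centres, which lowers the
self-intersection from 1 to −2. -/
theorem isRationalCurve_line : IsRationalCurve W.line (-2) := by
  have hm : ∀ i, W.mid i 0 ∈ X.charts := fun i => (W.mid_param i 0 (hn i)).1
  have hcof : ∀ i {q : X}, q ∈ W.lineNhd i → cofactor i ((W.mid i 0 q).1 + ctr i) ≠ 0 :=
    fun i _ hq => cofactor_ne_zero hq.2
  have hend : ∀ {q : X}, q ∈ W.endNhd → 1 - (W.inf q).1 ^ 2 ≠ 0 :=
    fun hq => sub_ne_zero.2 (Ne.symm hq.2)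
  have hu : ∀ {i} {q : X}, i ≠ 0 → q ∈ W.lineNhd i → (W.mid i 0 q).1 + ctr i ≠ 0 :=
    fun hi hq => hq.2 0 (Ne.symm hi)
  have hA : ∀ s, W.lineA s ∈ W.lineNhd (lineIndex s) := fun s => by
    obtain ⟨h1, h2⟩ := W.lineA_mem hn s
    refine ⟨h1, ?_⟩
    rw [h2, sub_add_cancel]
    exact ne_ctr_of_ne_lineIndex
  have hc : ∀ i, Differentiable ℂ fun a => cofactor i (a + ctr i) := fun i => by
    unfold cofactor; fun_prop
  refine ⟨W.lineA, W.lineB, W.contMDiff_lineA hn, W.contMDiff_lineB hn, W.injective_lineA hn,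
    W.injective_lineB hn, fun s hs => ?_, W.lineB_zero_notMem hn, W.line_eq hn,
    -- The set `lineNhd 0` is left out of the second neighbourhood because the factor u² of `endEq`
    -- vanishes at u = 0.
    ⋃ i, W.lineNhd i, W.endNhd ∪ ⋃ i, ⋃ (_ : i ≠ 0), W.lineNhd i, W.lineEq, W.endEq,
    fun q => W.slope q ^ 2, isOpen_iUnion W.isOpen_lineNhd,
    W.isOpen_endNhd.union (isOpen_iUnion fun i => isOpen_iUnion fun _ => W.isOpen_lineNhd i),
    ?_, ?_, ?_, ?_, ?_, ?_, ?_, ?_, ?_, ?_, ?_⟩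
  · rw [lineB, if_neg (inv_ne_zero hs), inv_inv]
  · rintro _ ⟨s, rfl⟩
    exact mem_iUnion.2 ⟨_, hA s⟩
  · rintro _ ⟨s, rfl⟩
    by_cases hs : s ^ 2 = 1
    · have h0 : s ≠ 0 := fun h0 => by simp [h0] at hs
      right
      rw [lineB, if_neg h0]
      refine mem_iUnion₂.2 ⟨_, ?_, hA _⟩
      unfold lineIndex
      rcases sq_eq_one_iff.1 hs with h1 | h1
      · simp [h1]
      · rw [if_neg (by rw [h1]; norm_num), if_pos (by rw [h1]; norm_num)]
        decide
    · left
      have ht : ((s, 0) : ℂ × ℂ) ∈ W.inf.target := by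
        rw [W.inf_target]
        exact fun _ => hs
      rw [W.lineB_eq hn hs]
      exact ⟨W.inf.map_target ht, by rwa [W.inf.right_inv ht]⟩
  · rintro q hq
    obtain ⟨i, hi⟩ := mem_iUnion.1 hq
    have h1 := hcof i hi
    refine (contMDiffAt_of_chart (h := fun w => w.2 * (cofactor i (w.1 + ctr i))⁻¹) (hm i) hi.1
      (W.lineEq_eventuallyEq hn hi) ?_).contMDiffWithinAt
    refine contDiffAt_snd.mul (ContDiffAt.inv ?_ h1)
    unfold cofactor
    fun_prop
  · rintro q (hq | hq)
    · refine (contMDiffAt_of_chart (h := fun w => w.2 * (1 - w.1 ^ 2)⁻¹) W.inf_param.1 hq.1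
        (W.endEq_eventuallyEq_inf hq) ?_).contMDiffWithinAt
      exact contDiffAt_snd.mul (ContDiffAt.inv (by fun_prop) (hend hq))
    · obtain ⟨i, hi0, hi⟩ := mem_iUnion₂.1 hq
      refine (contMDiffAt_of_chart (h := fun w => w.2 * ((w.1 + ctr i) ^ 2 *
        (cofactor i (w.1 + ctr i))⁻¹)) (hm i) hi.1
        (W.endEq_eventuallyEq hn hi) ?_).contMDiffWithinAt
      refine contDiffAt_snd.mul (ContDiffAt.mul (by fun_prop) (ContDiffAt.inv ?_ (hcof i hi)))
      unfold cofactor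
      fun_prop
  · rintro q hq
    obtain ⟨i, hi⟩ := mem_iUnion.1 hq
    rw [W.mem_line_iff hn (hn i) hi.1, W.lineEq_eq hn hi]
    simp [hcof i hi]
  · rintro q (hq | hq)
    · rw [W.mem_line_iff_inf hn hq.1, (W.endEq_eventuallyEq_inf hq).eq_of_nhds]
      simp [hend hq]
    · obtain ⟨i, hi0, hi⟩ := mem_iUnion₂.1 hq
      rw [W.mem_line_iff hn (hn i) hi.1, (W.endEq_eventuallyEq hn hi).eq_of_nhds]
      simp [hcof i hi, hu hi0 hi]
  · rintro q ⟨-, hq⟩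
    obtain ⟨i, hi⟩ := mem_iUnion.1 hq
    exact mfderiv_ne_zero_of_snd_mul (k := fun a => (cofactor i (a + ctr i))⁻¹) (hm i) hi.1
      (W.lineEq_eventuallyEq hn hi) ((hc i _).inv (hcof i hi)) (inv_ne_zero (hcof i hi))
  · rintro q ⟨-, hq | hq⟩
    · exact mfderiv_ne_zero_of_snd_mul (k := fun a => (1 - a ^ 2)⁻¹) W.inf_param.1 hq.1
        (W.endEq_eventuallyEq_inf hq) (DifferentiableAt.inv (by fun_prop) (hend hq))
        (inv_ne_zero (hend hq))
    · obtain ⟨i, hi0, hi⟩ := mem_iUnion₂.1 hq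
      exact mfderiv_ne_zero_of_snd_mul
        (k := fun a => (a + ctr i) ^ 2 * (cofactor i (a + ctr i))⁻¹) (hm i) hi.1
        (W.endEq_eventuallyEq hn hi)
        (DifferentiableAt.mul (by fun_prop) ((hc i _).inv (hcof i hi)))
        (mul_ne_zero (pow_ne_zero 2 (hu hi0 hi)) (inv_ne_zero (hcof i hi)))
  · rintro q ⟨hq, -⟩
    obtain ⟨i, hi⟩ := mem_iUnion.1 hq
    refine (contMDiffAt_of_chart (h := fun w => (w.1 + ctr i) ^ 2) (hm i) hi.1 ?_
      (by fun_prop)).contMDiffWithinAt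
    filter_upwards [(W.isOpen_lineNhd i).mem_nhds hi] with r hr
    rw [W.slope_eq hn hr]
  · rintro q ⟨hq, -⟩
    obtain ⟨i, hi⟩ := mem_iUnion.1 hq
    exact W.endEq_eq hn hi
  · intro s _
    have h := (W.lineA_mem hn s).2
    have : W.slope (W.lineA s) = s := by rw [W.slope_eq hn (hA s), h, sub_add_cancel]
    simp only [this]
    norm_cast

end equations

end Tower

theorem MeetOnceTransversally.symm {X : ComplexSurface} {C C' : Set X}
    (h : MeetOnceTransversally C C') : MeetOnceTransversally C' C := by
  obtain ⟨q, hq, φ, hφ, hqφ, h1, h2⟩ := h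
  refine ⟨q, by rw [inter_comm, hq], φ.trans (Homeomorph.prodComm ℂ ℂ).toOpenPartialHomeomorph,
    trans_mem_charts hφ _ (contDiff_snd.prodMk contDiff_fst).contDiffOn
    (contDiff_snd.prodMk contDiff_fst).contDiffOn, ⟨hqφ, trivial⟩,
    fun r hr => h2 r hr.1, fun r hr => h1 r hr.1⟩

/-- Membership in a list can be decided by computation, which settles adjacency for each pair of
vertices. -/
theorem affineE7_adj_iff (v w : Fin 8) : affineE7.Adj v w ↔
    (v, w) ∈ ([(0, 1), (0, 2), (2, 3), (3, 4), (0, 5), (5, 6), (6, 7)] : List (Fin 8 × Fin 8)) ∨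
    (w, v) ∈ ([(0, 1), (0, 2), (2, 3), (3, 4), (0, 5), (5, 6), (6, 7)] : List (Fin 8 × Fin 8)) := by
  simp only [affineE7, SimpleGraph.fromEdgeSet_adj, mem_insert_iff, mem_singleton_iff, Sym2.eq_iff]
  revert v w
  decide

theorem mult_pos (i : Fin 3) : 0 < mult i := by fin_cases i <;> simp [mult]

namespace Tower

variable {X : ComplexSurface} {ι : ℂ × ℂ → X} {n : Fin 3 → ℕ} (W : Tower X ι n)

include W

/-! ### The configuration of the curves -/

theorem exc_cases {i : Fin 3} {k : ℕ} {q : X} (h : q ∈ W.exc i k) :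
    q ∈ (W.mid i k).source ∨ q ∈ (W.mid i (k + 1)).source :=
  h.imp And.left And.left

theorem zero_mem_mid {i : Fin 3} {k : ℕ} (hk : k < n i) :
    (0 : ℂ × ℂ) ∈ (W.mid i k).target := by
  rw [W.mid_target i k hk]
  intro _ _ j hj h
  simp only [Prod.fst_zero, zero_add] at h
  exact hj (ctr_injective h).symm

/-- Two sets which are the coordinate axes in `mid i k`, and meet only there, meet transversally. -/
theorem meetOnceTransversally_of_mid {i : Fin 3} {k : ℕ} (hk : k < n i) {C C' : Set X}
    (h : ∀ q ∈ (W.mid i k).source, q ∈ C ↔ (W.mid i k q).1 = 0)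
    (h' : ∀ q ∈ (W.mid i k).source, q ∈ C' ↔ (W.mid i k q).2 = 0)
    (hCC : C ∩ C' ⊆ (W.mid i k).source) : MeetOnceTransversally C C' := by
  have h0 := W.zero_mem_mid hk
  have hs := (W.mid i k).map_target h0
  refine ⟨(W.mid i k).symm 0, ?_, W.mid i k, (W.mid_param i k hk).1, hs, h, h'⟩
  ext q
  constructor
  · intro hq
    have hqs := hCC hq
    have e : W.mid i k q = 0 := Prod.ext ((h q hqs).1 hq.1) ((h' q hqs).1 hq.2)
    rw [mem_singleton_iff, ← e, (W.mid i k).left_inv hqs]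
  · rintro rfl
    rw [mem_inter_iff, h _ hs, h' _ hs, (W.mid i k).right_inv h0]
    exact ⟨rfl, rfl⟩

theorem meet_exc_line (hn : ∀ j, 0 < n j) {i : Fin 3} (hi : 1 < n i) :
    MeetOnceTransversally (W.exc i 0) W.line := by
  refine W.meetOnceTransversally_of_mid (hn i) (fun q hq => ?_) (fun q hq => ?_) ?_
  · rw [W.mem_exc_iff (hn i) hi hq]
    simp
  · rw [W.mem_line_iff hn (hn i) hq]
    simp
  · rintro q ⟨h, h'⟩
    refine (W.exc_cases h).resolve_right fun h1 => ?_
    simpa using (W.mem_line_iff hn hi h1).1 h'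

theorem meet_exc_succ {i : Fin 3} {k : ℕ} (hk : k + 2 < n i) :
    MeetOnceTransversally (W.exc i (k + 1)) (W.exc i k) := by
  refine W.meetOnceTransversally_of_mid (i := i) (k := k + 1) (by omega) (fun q hq => ?_)
    (fun q hq => ?_) ?_
  · rw [W.mem_exc_iff (by omega) hk hq]
    simp
  · rw [W.mem_exc_iff (by omega) (by omega) hq]
    simp
  · rintro q ⟨h, h'⟩
    refine (W.exc_cases h).resolve_right fun h1 => ?_
    have := (W.mem_exc_iff hk (by omega) h1).1 h'
    omega

theorem disjoint_exc_line (hn : ∀ j, 0 < n j) {i : Fin 3} {k : ℕ} (hk : k + 2 < n i) :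
    Disjoint (W.exc i (k + 1)) W.line := by
  rw [Set.disjoint_left]
  intro q h h'
  rcases W.exc_cases h with h1 | h1
  · exact absurd ((W.mem_line_iff hn (by omega) h1).1 h').1 (by omega)
  · exact absurd ((W.mem_line_iff hn hk h1).1 h').1 (by omega)

theorem disjoint_exc_exc {i j : Fin 3} {k l : ℕ} (hk : k + 1 < n i) (hl : l + 1 < n j)
    (h : i = j → k + 1 < l ∨ l + 1 < k) : Disjoint (W.exc i k) (W.exc j l) := by
  rw [Set.disjoint_left]
  intro q h1 h2
  rcases h1 with ⟨h1, h0⟩ | ⟨h1, h0⟩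
  · obtain ⟨e, h3⟩ := (W.mem_exc_iff (by omega) hl h1).1 h2
    have := h e.symm
    omega
  · obtain ⟨e, h3⟩ := (W.mem_exc_iff hk hl h1).1 h2
    have := h e.symm
    omega

end Tower

namespace Tower

variable {X : ComplexSurface} {ι : ℂ × ℂ → X} (W : Tower X ι mult)

/-- The eight curves off the phase space. -/
def curves : Fin 8 → Set X :=
  ![W.line, W.exc 0 0, W.exc 1 0, W.exc 1 1, W.exc 1 2, W.exc 2 0, W.exc 2 1, W.exc 2 2]

theorem isE7Configuration : IsE7Configuration W.curves := by
  have hn := mult_pos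
  refine ⟨fun v => ?_, ?_⟩
  · fin_cases v
    · exact W.isRationalCurve_line hn
    all_goals exact W.isRationalCurve_exc (by decide)
  have key : ∀ v w, v < w → (affineE7.Adj v w → MeetOnceTransversally (W.curves v) (W.curves w)) ∧
      (¬ affineE7.Adj v w → Disjoint (W.curves v) (W.curves w)) := by
    intro v w hvw
    rw [affineE7_adj_iff]
    constructor
    · intro h
      fin_cases v <;> fin_cases w <;> first
        | exact absurd hvw (by decide)
        | exact absurd h (by decide)
        | exact (W.meet_exc_line hn (by decide)).symm
        | exact (W.meet_exc_succ (by decide)).symm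
    · intro h
      fin_cases v <;> fin_cases w <;> first
        | exact absurd hvw (by decide)
        | exact absurd (by decide) h
        | exact (W.disjoint_exc_line hn (by decide)).symm
        | exact W.disjoint_exc_exc (by decide) (by decide) (by decide)
  intro v w hvw
  rcases lt_or_gt_of_ne hvw with h | h
  · exact key v w h
  · obtain ⟨h1, h2⟩ := key w v h
    exact ⟨fun h => (h1 h.symm).symm, fun h => (h2 fun h' => h h'.symm).symm⟩

/-! ### The charts covering the complement of the curves -/

/-- The four coordinate charts covering the complement of the eight curves. -/
noncomputable def phaseChart (j : Fin 4) : OpenPartialHomeomorph X (ℂ × ℂ) :=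
  Fin.cases W.aff W.tip j

theorem phaseChart_mem (j : Fin 4) : W.phaseChart j ∈ X.charts := by
  refine Fin.cases W.aff_mem (fun i => (W.tip_param i).1) j

theorem phaseChart_target (j : Fin 4) : (W.phaseChart j).target = univ := by
  refine Fin.cases W.aff_target (fun i => ?_) j
  refine (W.tip_target i).trans (eq_univ_of_forall fun w h => ?_)
  exact absurd h (mult_pos i).ne'

theorem compl_curves :
    (⋃ v, W.curves v)ᶜ = ⋃ j, (W.phaseChart j).source := by
  have hn := mult_pos
  ext q
  rw [mem_compl_iff, mem_iUnion, mem_iUnion]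
  constructor
  · intro h
    rcases W.cover_compl q with h1 | ⟨i, k, hk, h1⟩ | h1 | ⟨i, h1⟩
    · exact absurd ⟨0, h1⟩ h
    · refine absurd ?_ h
      fin_cases i
      · have hk : k + 1 < 2 := hk
        obtain rfl : k = 0 := by omega
        exact ⟨1, h1⟩
      · have hk : k + 1 < 4 := hk
        have : k < 3 := by omega
        interval_cases k
        exacts [⟨2, h1⟩, ⟨3, h1⟩, ⟨4, h1⟩]
      · have hk : k + 1 < 4 := hk
        have : k < 3 := by omega
        interval_cases k
        exacts [⟨5, h1⟩, ⟨6, h1⟩, ⟨7, h1⟩]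
    · exact ⟨0, h1⟩
    · exact ⟨i.succ, h1⟩
  · rintro ⟨j, hj⟩ ⟨v, hv⟩
    revert hj
    refine Fin.cases (fun hj => ?_) (fun i hj => ?_) j
    · have hj : q ∈ W.aff.source := hj
      fin_cases v
      · exact W.aff_notMem_line hn hj hv
      all_goals exact W.aff_notMem_exc (by decide) hj hv
    · have hj : q ∈ (W.tip i).source := hj
      fin_cases v
      · exact W.tip_notMem_line hn hj hv
      all_goals exact W.tip_notMem_exc (hn i) (by decide) hj hv

end Tower

/-! ### Holomorphic differential equations -/

section ODE

variable {E : Type*} [NormedAddCommGroup E] [NormedSpace ℂ E]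

/-- The punctured disc is the image of a half-plane under the exponential map. It is needed because
a solution may be at infinity at the time t, so that the conserved quantity is only known to be
constant around t. -/
theorem isPreconnected_punctured_ball (t : ℂ) (ε : ℝ) :
    IsPreconnected (Metric.ball t ε \ {t}) := by
  by_cases hε : 0 < ε
  · have : Metric.ball t ε \ {t} = (fun z => Complex.exp z + t) '' {z | z.re < Real.log ε} := by
      ext s
      constructor
      · rintro ⟨h1, h2⟩
        have h0 : s - t ≠ 0 := sub_ne_zero.2 h2
        refine ⟨Complex.log (s - t), ?_, by simp [Complex.exp_log h0]⟩
        rw [mem_ofPred_eq, Complex.log_re]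
        exact Real.log_lt_log (norm_pos_iff.2 h0) (mem_ball_iff_norm.1 h1)
      · rintro ⟨z, hz, rfl⟩
        refine ⟨?_, ?_⟩
        · rw [mem_ball_iff_norm, add_sub_cancel_right, Complex.norm_exp]
          exact (Real.lt_log_iff_exp_lt hε).1 hz
        · simp [Complex.exp_ne_zero]
    rw [this]
    exact (convex_halfSpace_re_lt _).isPreconnected.image _ (by fun_prop)
  · rw [Metric.ball_eq_empty.2 (not_lt.1 hε)]
    simp [isPreconnected_empty]

theorem norm_sub_le_of_hasDerivAt {f f' : ℂ → E} {t s : ℂ} {r B : ℝ}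
    (hf : ∀ x ∈ Metric.ball t r, HasDerivAt f (f' x) x)
    (hB : ∀ x ∈ Metric.ball t r, ‖f' x‖ ≤ B) (hs : s ∈ Metric.ball t r) :
    ‖f s - f t‖ ≤ B * r := by
  have hr : 0 < r := Metric.pos_of_mem_ball hs
  have ht := Metric.mem_ball_self (x := t) hr
  refine ((convex_ball t r).norm_image_sub_le_of_norm_hasDerivWithin_le
    (fun x hx => (hf x hx).hasDerivWithinAt) hB ht hs).trans ?_
  exact mul_le_mul_of_nonneg_left (mem_ball_iff_norm.1 hs).le ((norm_nonneg _).trans (hB t ht))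

/-- Local uniqueness for holomorphic differential equations. -/
theorem eventuallyEq_of_hasDerivAt {F : E → E} {γ δ : ℂ → E} {t : ℂ}
    (hF : ContDiffAt ℂ 1 F (γ t)) (hγ : ∀ᶠ s in 𝓝 t, HasDerivAt γ (F (γ s)) s)
    (hδ : ∀ᶠ s in 𝓝 t, HasDerivAt δ (F (δ s)) s) (h : γ t = δ t) : γ =ᶠ[𝓝 t] δ := by
  obtain ⟨K, V, hV, hK⟩ := hF.exists_lipschitzOnWith
  have cγ := hγ.self_of_nhds.continuousAt
  have cδ := hδ.self_of_nhds.continuousAt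
  have cd : ContinuousAt (fun s => ‖γ s - δ s‖) t := (cγ.sub cδ).norm
  have hlt : ‖γ t - δ t‖ < 1 := by simp [h]
  obtain ⟨ε, hε, hball⟩ := Metric.eventually_nhds_iff_ball.1 (hγ.and (hδ.and
    ((cγ.eventually_mem hV).and ((cδ.eventually_mem (h ▸ hV)).and (cd.eventually_lt_const hlt)))))
  -- With K r ≤ 1/2 the mean value inequality halves the bound on the difference of the two
  -- solutions at each step of the induction.
  let r : ℝ := min ε (1 / (2 * (K + 1)))
  have hr : 0 < r := lt_min hε (by positivity)
  have hKr : K * r ≤ 1 / 2 := by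
    have h1 : r ≤ 1 / (2 * (K + 1)) := min_le_right _ _
    have h2 : (0 : ℝ) ≤ K := K.2
    calc (K : ℝ) * r ≤ (K + 1) * (1 / (2 * (K + 1))) := by gcongr; linarith
      _ = 1 / 2 := by field_simp
  have hsub : Metric.ball t r ⊆ Metric.ball t ε := Metric.ball_subset_ball (min_le_left _ _)
  have key : ∀ n : ℕ, ∀ s ∈ Metric.ball t r, ‖γ s - δ s‖ ≤ (1 / 2) ^ n := by
    intro n
    induction n with
    | zero => exact fun s hs => by simpa using (hball s (hsub hs)).2.2.2.2.le
    | succ n ih =>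
      intro s hs
      have h1 := norm_sub_le_of_hasDerivAt (f := fun s => γ s - δ s)
        (f' := fun s => F (γ s) - F (δ s)) (B := K * (1 / 2) ^ n)
        (fun x hx => (hball x (hsub hx)).1.sub (hball x (hsub hx)).2.1)
        (fun x hx => (hK.norm_sub_le (hball x (hsub hx)).2.2.1 (hball x (hsub hx)).2.2.2.1).trans
          (mul_le_mul_of_nonneg_left (ih x hx) K.2)) hs
      simp only [h, sub_self, sub_zero] at h1
      calc ‖γ s - δ s‖ ≤ K * (1 / 2) ^ n * r := h1
        _ = K * r * (1 / 2) ^ n := by ring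
        _ ≤ 1 / 2 * (1 / 2) ^ n := by gcongr
        _ = (1 / 2) ^ (n + 1) := by ring
  filter_upwards [Metric.ball_mem_nhds t hr] with s hs
  have hlim : Tendsto (fun n : ℕ => (1 / 2 : ℝ) ^ n) atTop (𝓝 0) :=
    tendsto_pow_atTop_nhds_zero_of_lt_one (by norm_num) (by norm_num)
  exact sub_eq_zero.1 (norm_le_zero_iff.1 (ge_of_tendsto' hlim fun n => key n s hs))

/-- Local existence for holomorphic differential equations, uniform in the initial value. -/
theorem exists_solution_ball [CompleteSpace E] {F : E → E} (hF : ContDiff ℂ 1 F) (w₀ : E) :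
    ∃ V ∈ 𝓝 w₀, ∃ r > 0, ∀ w ∈ V, ∃ γ : ℂ → E, γ 0 = w ∧
      ∀ t ∈ Metric.ball 0 r, HasDerivAt γ (F (γ t)) t := by
  obtain ⟨K, V, hV, hK⟩ := hF.contDiffAt (x := w₀) |>.exists_lipschitzOnWith
  obtain ⟨R, hR, hRV⟩ := Metric.nhds_basis_closedBall.mem_iff.1 hV
  have hK := hK.mono hRV
  have hK0 : (0 : ℝ) ≤ K := K.2
  let M : ℝ := ‖F w₀‖ + K * R
  have hM : ∀ w ∈ Metric.closedBall w₀ R, ‖F w‖ ≤ M := fun w hw => by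
    have h1 := hK.norm_sub_le hw (Metric.mem_closedBall_self hR.le)
    have h2 := norm_le_norm_add_norm_sub' (F w) (F w₀)
    have h3 : (K : ℝ) * ‖w - w₀‖ ≤ K * R :=
      mul_le_mul_of_nonneg_left (mem_closedBall_iff_norm.1 hw) hK0
    exact h2.trans (add_le_add_right (h1.trans h3) _)
  have hM0 : 0 ≤ M := (norm_nonneg _).trans (hM w₀ (Metric.mem_closedBall_self hR.le))
  -- The first bound keeps the Picard iterates, which start within R/2 of w₀ and have derivatives
  -- bounded by M, in the ball of radius R; the second makes the iteration contract by 1/2.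
  let r : ℝ := min (R / (2 * (M + 1))) (1 / (2 * (K + 1)))
  have hr : 0 < r := lt_min (by positivity) (by positivity)
  have hMr : M * r ≤ R / 2 := by
    have h1 : r ≤ R / (2 * (M + 1)) := min_le_left _ _
    calc M * r ≤ (M + 1) * (R / (2 * (M + 1))) := by gcongr; linarith
      _ = R / 2 := by field_simp
  have hKr : K * r ≤ 1 / 2 := by
    have h1 : r ≤ 1 / (2 * (K + 1)) := min_le_right _ _
    calc (K : ℝ) * r ≤ (K + 1) * (1 / (2 * (K + 1))) := by gcongr; linarith
      _ = 1 / 2 := by field_simp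
  refine ⟨Metric.ball w₀ (R / 2), Metric.ball_mem_nhds _ (by positivity), r, hr, fun w hw => ?_⟩
  let S : Type _ := {γ : ℂ → E // γ 0 = w ∧ DifferentiableOn ℂ γ (Metric.ball 0 r) ∧
    ∀ t ∈ Metric.ball 0 r, γ t ∈ Metric.closedBall w₀ R}
  have step : ∀ γ : S, ∃ δ : S, ∀ t ∈ Metric.ball 0 r, HasDerivAt δ.1 (F (γ.1 t)) t := by
    rintro ⟨γ, h0, hd, hb⟩
    have hFd : DifferentiableOn ℂ (fun t => F (γ t)) (Metric.ball 0 r) :=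
      (hF.differentiable one_ne_zero).comp_differentiableOn hd
    -- A primitive of a holomorphic function on a disc takes the place of the Picard integral.
    obtain ⟨δ, hδ0, hδ⟩ := hFd.isExactOn_ball.with_val_at 0 w
    refine ⟨⟨δ, hδ0, fun t ht => (hδ t ht).differentiableAt.differentiableWithinAt,
      fun t ht => ?_⟩, hδ⟩
    have h1 := norm_sub_le_of_hasDerivAt hδ (fun t ht => hM _ (hb t ht)) ht
    rw [hδ0] at h1
    have h2 := mem_ball_iff_norm.1 hw
    rw [mem_closedBall_iff_norm]
    calc ‖δ t - w₀‖ ≤ ‖δ t - w‖ + ‖w - w₀‖ := norm_sub_le_norm_sub_add_norm_sub _ _ _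
      _ ≤ R := by linarith
  choose Φ hΦ using step
  let γ₀ : S := ⟨fun _ => w, rfl, by fun_prop, fun _ _ => by
    have := mem_ball_iff_norm.1 hw
    rw [mem_closedBall_iff_norm]; linarith⟩
  let γ : ℕ → S := fun n => Φ^[n] γ₀
  have hγ : ∀ n, ∀ t ∈ Metric.ball 0 r, HasDerivAt (γ (n + 1)).1 (F ((γ n).1 t)) t := by
    intro n t ht
    have : γ (n + 1) = Φ (γ n) := Function.iterate_succ_apply' Φ n γ₀
    rw [this]
    exact hΦ _ t ht
  have hdist : ∀ n, ∀ t ∈ Metric.ball 0 r, dist ((γ n).1 t) ((γ (n + 1)).1 t) ≤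
      2 * R * (1 / 2) ^ n := by
    intro n
    induction n with
    | zero =>
      intro t ht
      have h1 := mem_closedBall_iff_norm.1 ((γ 0).2.2.2 t ht)
      have h2 := mem_closedBall_iff_norm'.1 ((γ 1).2.2.2 t ht)
      rw [dist_eq_norm]
      calc _ ≤ ‖(γ 0).1 t - w₀‖ + ‖w₀ - (γ 1).1 t‖ := norm_sub_le_norm_sub_add_norm_sub _ _ _
        _ ≤ _ := by linarith
    | succ n ih =>
      intro t ht
      have h1 := norm_sub_le_of_hasDerivAt (f := fun s => (γ (n + 1)).1 s - (γ (n + 2)).1 s)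
        (f' := fun s => F ((γ n).1 s) - F ((γ (n + 1)).1 s)) (B := K * (2 * R * (1 / 2) ^ n))
        (fun x hx => (hγ n x hx).sub (hγ (n + 1) x hx))
        (fun x hx => (hK.norm_sub_le ((γ n).2.2.2 x hx) ((γ (n + 1)).2.2.2 x hx)).trans
          (mul_le_mul_of_nonneg_left (by rw [← dist_eq_norm]; exact ih x hx) K.2)) ht
      simp only [(γ (n + 1)).2.1, (γ (n + 2)).2.1, sub_self, sub_zero] at h1
      rw [dist_eq_norm]
      calc _ ≤ K * (2 * R * (1 / 2) ^ n) * r := h1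
        _ = K * r * (2 * R * (1 / 2) ^ n) := by ring
        _ ≤ 1 / 2 * (2 * R * (1 / 2) ^ n) := by gcongr
        _ = _ := by ring
  have hlim : ∀ t, ∃ l, t ∈ Metric.ball (0 : ℂ) r → Tendsto (fun n => (γ n).1 t) atTop (𝓝 l) := by
    intro t
    by_cases ht : t ∈ Metric.ball (0 : ℂ) r
    · obtain ⟨l, hl⟩ := cauchySeq_tendsto_of_complete
        (cauchySeq_of_le_geometric (1 / 2) (2 * R) (by norm_num) fun n => hdist n t ht)
      exact ⟨l, fun _ => hl⟩
    · exact ⟨0, fun h => absurd h ht⟩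
  choose g hg using hlim
  have hgb : ∀ t ∈ Metric.ball 0 r, g t ∈ Metric.closedBall w₀ R := fun t ht =>
    Metric.isClosed_closedBall.mem_of_tendsto (hg t ht)
      (Eventually.of_forall fun n => (γ n).2.2.2 t ht)
  refine ⟨g, ?_, fun t ht => ?_⟩
  · refine tendsto_nhds_unique (hg 0 (Metric.mem_ball_self hr)) ?_
    simp only [(γ _).2.1]
    exact tendsto_const_nhds
  -- The derivatives F(γₙ) converge uniformly by the Lipschitz bound and the geometric rate of
  -- convergence, so the limit may be differentiated.
  · refine hasDerivAt_of_tendstoUniformlyOn (f := fun n => (γ (n + 1)).1)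
      (f' := fun n t => F ((γ n).1 t)) (g' := fun t => F (g t)) (l := atTop) Metric.isOpen_ball ?_
      (Eventually.of_forall fun n => hγ n)
      (fun x hx => (hg x hx).comp (tendsto_add_atTop_nat 1)) ht
    rw [Metric.tendstoUniformlyOn_iff]
    intro ε hε
    have h0 : Tendsto (fun n : ℕ => K * (2 * R * (1 / 2 : ℝ) ^ n / (1 - 1 / 2))) atTop (𝓝 0) := by
      have h1 : Tendsto (fun n : ℕ => (1 / 2 : ℝ) ^ n) atTop (𝓝 0) :=
        tendsto_pow_atTop_nhds_zero_of_lt_one (by norm_num) (by norm_num)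
      have := ((h1.const_mul (2 * R)).div_const (1 - 1 / 2)).const_mul (K : ℝ)
      simpa using this
    filter_upwards [h0.eventually_lt_const hε] with n hn x hx
    have h1 := dist_le_of_le_geometric_of_tendsto (1 / 2) (2 * R) (by norm_num)
      (fun n => hdist n x hx) (hg x hx) n
    rw [dist_comm] at h1
    rw [dist_eq_norm] at h1 ⊢
    exact ((hK.norm_sub_le (hgb x hx) ((γ n).2.2.2 x hx)).trans
      (mul_le_mul_of_nonneg_left h1 K.2)).trans_lt hn

end ODE

/-! ### The system in the coordinate charts -/

/-- The coordinates in the chart at the tip of a tower in terms of the affine ones. -/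
noncomputable def toTip (i : Fin 3) (z : ℂ × ℂ) : ℂ × ℂ :=
  -- From a = (u − c) v^(−m) = (x/y − c) y^m.
  ((z.1 - ctr i * z.2) * z.2 ^ (mult i - 1), 1 / z.2)

/-- The affine coordinates in terms of those in the chart at the tip of a tower. -/
noncomputable def ofTip (i : Fin 3) (w : ℂ × ℂ) : ℂ × ℂ := ofUV (tipUV i (mult i) w)

theorem gluingMap_zero (z : ℂ × ℂ) : gluingMap 0 z = z := rfl

theorem gluingMap_succ (i : Fin 3) (z : ℂ × ℂ) : gluingMap i.succ z = toTip i z := by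
  fin_cases i <;> simp [gluingMap, toTip, ctr, mult] <;> ring

theorem tipUV_toTip (i : Fin 3) {z : ℂ × ℂ} (hz : z.2 ≠ 0) :
    tipUV i (mult i) (toTip i z) = (z.1 / z.2, 1 / z.2) := by
  fin_cases i <;> simp [tipUV, toTip, ctr, mult] <;> field_simp <;> ring

theorem ofTip_toTip (i : Fin 3) {z : ℂ × ℂ} (hz : z.2 ≠ 0) : ofTip i (toTip i z) = z := by
  rw [ofTip, tipUV_toTip i hz, ofUV]
  ext
  · field_simp
  · simp

theorem toTip_ofTip (i : Fin 3) {w : ℂ × ℂ} (hw : w.2 ≠ 0) : toTip i (ofTip i w) = w := by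
  fin_cases i <;> ext <;> simp [tipUV, toTip, ofTip, ofUV, ctr, mult] <;> field_simp <;> ring

/-- The system in the chart at the tip of a tower. -/
noncomputable def tipField (i : Fin 3) (w : ℂ × ℂ) : ℂ × ℂ :=
  -- With u' = −2(u³ − u)/v and ε = u − c = a v^m, one finds a' = (a/v)(2 − m + (2m − 6)c² + c(4m −
  -- 6)ε + (2m − 2)ε²). The constant term vanishes exactly for m = 2 if c = 0 and m = 4 if c = ±1;
  -- the remaining terms contain ε and so absorb the pole.
  (w.1 ^ 2 * w.2 ^ (mult i - 1) *
      (ctr i * (4 * mult i - 6) + (2 * mult i - 2) * w.1 * w.2 ^ mult i),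
    1 - 2 * (ctr i + w.1 * w.2 ^ mult i) ^ 2)

/-- The system in the four charts. -/
noncomputable def chartField (j : Fin 4) : ℂ × ℂ → ℂ × ℂ := Fin.cases inceField tipField j

theorem contDiff_chartField (j : Fin 4) : ContDiff ℂ 1 (chartField j) := by
  refine Fin.cases ?_ (fun i => ?_) j
  · change ContDiff ℂ 1 fun z : ℂ × ℂ => (z.1 * z.2, 2 * z.1 ^ 2 - z.2 ^ 2)
    fun_prop
  · change ContDiff ℂ 1 fun w : ℂ × ℂ => (w.1 ^ 2 * w.2 ^ (mult i - 1) *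
      (ctr i * (4 * mult i - 6) + (2 * mult i - 2) * w.1 * w.2 ^ mult i),
      1 - 2 * (ctr i + w.1 * w.2 ^ mult i) ^ 2)
    fun_prop

theorem HasDerivAt.fst' {z : ℂ → ℂ × ℂ} {v : ℂ × ℂ} {s : ℂ} (h : HasDerivAt z v s) :
    HasDerivAt (fun r => (z r).1) v.1 s :=
  (hasFDerivAt_fst (𝕜 := ℂ) (p := z s)).comp_hasDerivAt s h

theorem HasDerivAt.snd' {z : ℂ → ℂ × ℂ} {v : ℂ × ℂ} {s : ℂ} (h : HasDerivAt z v s) :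
    HasDerivAt (fun r => (z r).2) v.2 s :=
  (hasFDerivAt_snd (𝕜 := ℂ) (p := z s)).comp_hasDerivAt s h

theorem hasDerivAt_toTip (i : Fin 3) {z : ℂ → ℂ × ℂ} {s : ℂ} (hz : (z s).2 ≠ 0)
    (h : HasDerivAt z (inceField (z s)) s) :
    HasDerivAt (fun r => toTip i (z r)) (tipField i (toTip i (z s))) s := by
  have h1 := h.fst'
  have h2 := h.snd'
  have h3 := ((h1.sub (h2.const_mul (ctr i))).mul (h2.pow (mult i - 1))).prodMk
    ((hasDerivAt_const s (1 : ℂ)).div h2 hz)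
  refine h3.congr_deriv ?_
  fin_cases i <;> ext <;> simp [inceField, tipField, toTip, ctr, mult] <;> field_simp <;> ring

theorem hasDerivAt_ofTip (i : Fin 3) {w : ℂ → ℂ × ℂ} {s : ℂ} (hw : (w s).2 ≠ 0)
    (h : HasDerivAt w (tipField i (w s)) s) :
    HasDerivAt (fun r => ofTip i (w r)) (inceField (ofTip i (w s))) s := by
  have h1 := h.fst'
  have h2 := h.snd'
  have h3 := (((h1.mul (h2.pow (mult i))).const_add (ctr i)).div h2 hw).prodMk
    ((hasDerivAt_const s (1 : ℂ)).div h2 hw)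
  refine h3.congr_deriv ?_
  fin_cases i <;> ext <;> simp [inceField, tipField, ofTip, ofUV, tipUV, ctr, mult] <;>
    field_simp <;> ring

theorem differentiableAt_toTip (i : Fin 3) {z : ℂ × ℂ} (hz : z.2 ≠ 0) :
    DifferentiableAt ℂ (toTip i) z := by
  change DifferentiableAt ℂ
    (fun z : ℂ × ℂ => ((z.1 - ctr i * z.2) * z.2 ^ (mult i - 1), 1 / z.2)) z
  fun_prop (disch := assumption)

/-- The formula `hasDerivAt_toTip` requires the system at a single time only, so it applies to the
straight line through z in the direction of the field. -/
theorem fderiv_gluingMap (j : Fin 4) {z : ℂ × ℂ} (hz : z.2 ≠ 0) :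
    fderiv ℂ (gluingMap j) z (inceField z) = chartField j (gluingMap j z) := by
  refine Fin.cases ?_ (fun i => ?_) j
  · have : gluingMap 0 = id := funext gluingMap_zero
    rw [this, fderiv_id]
    rfl
  · have e : gluingMap i.succ = toTip i := funext (gluingMap_succ i)
    rw [e]
    have h0 : HasDerivAt (fun s : ℂ => z + s • inceField z) (inceField z) 0 := by
      simpa using ((hasDerivAt_id (0 : ℂ)).smul_const (inceField z)).const_add z
    have h1 := hasDerivAt_toTip i (z := fun s : ℂ => z + s • inceField z) (s := 0)
      (by simpa using hz) (by simpa using h0)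
    have h2 : HasFDerivAt (toTip i) (fderiv ℂ (toTip i) z) (z + (0 : ℂ) • inceField z) := by
      simpa using (differentiableAt_toTip i hz).hasFDerivAt
    have h3 : HasDerivAt (fun s : ℂ => toTip i (z + s • inceField z))
        (fderiv ℂ (toTip i) z (inceField z)) 0 :=
      HasFDerivAt.comp_hasDerivAt (f := fun s : ℂ => z + s • inceField z) 0 h2 h0
    refine (h3.unique h1).trans ?_
    simp [chartField]

open MvPolynomial in
theorem chartField_polynomial (j : Fin 4) : ∃ P Q : MvPolynomial (Fin 2) ℂ, ∀ w : ℂ × ℂ,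
    chartField j w = (eval ![w.1, w.2] P, eval ![w.1, w.2] Q) := by
  refine Fin.cases ?_ (fun i => ?_) j
  · exact ⟨X 0 * X 1, C 2 * X 0 ^ 2 - X 1 ^ 2, fun w => by simp [chartField, inceField]⟩
  · exact ⟨X 0 ^ 2 * X 1 ^ (mult i - 1) * (C (ctr i * (4 * (mult i : ℂ) - 6)) +
      C (2 * (mult i : ℂ) - 2) * X 0 * X 1 ^ mult i),
      1 - C 2 * (C (ctr i) + X 0 * X 1 ^ mult i) ^ 2, fun w => by
        simp only [chartField, tipField, Fin.cases_succ, map_mul, map_add, map_sub, map_pow, eval_X,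
          eval_C, map_one]
        rfl⟩

/-! ### The conserved quantity at infinity -/

/-- The conserved quantity of the system. -/
def hamiltonian (z : ℂ × ℂ) : ℂ := z.1 ^ 2 * (z.2 ^ 2 - z.1 ^ 2)

theorem continuous_hamiltonian : Continuous hamiltonian := by unfold hamiltonian; fun_prop

theorem hasDerivAt_hamiltonian {z : ℂ → ℂ × ℂ} {s : ℂ}
    (h : HasDerivAt z (inceField (z s)) s) : HasDerivAt (fun r => hamiltonian (z r)) 0 s := by
  have h1 := h.fst'
  have h2 := h.snd'
  refine ((h1.pow 2).mul ((h2.pow 2).sub (h1.pow 2))).congr_deriv ?_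
  simp [inceField]
  ring

theorem hamiltonian_ofUV {w : ℂ × ℂ} (hw : w.2 ≠ 0) :
    hamiltonian (ofUV w) * w.2 ^ 4 = w.1 ^ 2 * (1 - w.1 ^ 2) := by
  simp only [hamiltonian, ofUV]
  field_simp

theorem hamiltonian_ofEnd {w : ℂ × ℂ} (hw : w.2 ≠ 0) :
    hamiltonian (ofEnd w) * w.2 ^ 4 = w.1 ^ 2 - 1 := by
  simp only [hamiltonian, ofEnd]
  field_simp

/-- The level sets of the conserved quantity in the first two charts at the slope `0`. -/
theorem hamiltonian_mid_zero {k : ℕ} (hk : k < 2) {w : ℂ × ℂ} (hw : w ∈ offAxes) :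
    hamiltonian (ofUV (midUV 0 k w)) * (w.1 ^ (2 - 2 * k) * w.2 ^ (4 - 2 * k)) =
      1 - (midUV 0 k w).1 ^ 2 := by
  have h1 := hw.1
  have h2 := hw.2
  have h := hamiltonian_ofUV (midUV_ne (i := 0) (k := k) hw)
  generalize hamiltonian (ofUV (midUV 0 k w)) = H at h ⊢
  interval_cases k
  · refine mul_left_cancel₀ (pow_ne_zero 2 h1) ?_
    simp only [midUV, show ctr 0 = 0 from rfl] at h ⊢
    linear_combination h
  · refine mul_left_cancel₀ (pow_ne_zero 2 (mul_ne_zero h1 (mul_ne_zero h1 h2))) ?_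
    simp only [midUV, show ctr 0 = 0 from rfl] at h ⊢
    linear_combination h

/-- The level sets of the conserved quantity in the charts at the slopes `1` and `-1`. -/
theorem hamiltonian_mid_succ {i : Fin 3} (hi : i ≠ 0) {k : ℕ} (hk : k < 4) {w : ℂ × ℂ}
    (hw : w ∈ offAxes) :
    hamiltonian (ofUV (midUV i k w)) * (w.1 ^ (3 - k) * w.2 ^ (4 - k)) =
      -((midUV i k w).1 ^ 2 * ((midUV i k w).1 + ctr i)) := by
  have h1 := hw.1
  have h2 := hw.2
  have h := hamiltonian_ofUV (midUV_ne (i := i) (k := k) hw)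
  generalize hamiltonian (ofUV (midUV i k w)) = H at h ⊢
  -- Thus 1 − u² = −(u − c)(u + c), and the factor u − c = a(ab)^k cancels against powers of v = ab
  -- on the other side.
  have hc : ctr i ^ 2 = 1 := by
    fin_cases i
    · exact absurd rfl hi
    · simp [ctr]
    · simp [ctr]
  refine mul_left_cancel₀ (mul_ne_zero h1 (pow_ne_zero k (mul_ne_zero h1 h2))) ?_
  have e : w.1 * (w.1 * w.2) ^ k = (midUV i k w).1 - ctr i := by simp [midUV]
  have e2 : w.1 * (w.1 * w.2) ^ k * (H * (w.1 ^ (3 - k) * w.2 ^ (4 - k))) =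
      H * (midUV i k w).2 ^ 4 := by
    simp only [midUV]
    interval_cases k <;> ring
  rw [e2, h, e]
  linear_combination -(midUV i k w).1 ^ 2 * hc

/-! ### Solutions with values in the surface -/

section Solutions

variable {X : ComplexSurface} {ι : ℂ × ℂ → X} {γ δ : ℂ → X} {t : ℂ}

/-- The curve `γ` runs in `ℂ²` near the time `s` and satisfies the system at this time. -/
def IsRegularAt (ι : ℂ × ℂ → X) (γ : ℂ → X) (s : ℂ) : Prop :=
  ∃ z : ℂ → ℂ × ℂ, (∀ᶠ r in 𝓝 s, γ r = ι (z r)) ∧ HasDerivAt z (inceField (z s)) s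

/-- The curve `γ` is a solution with values in the surface near the time `t`. -/
def IsSolutionAt (ι : ℂ × ℂ → X) (γ : ℂ → X) (t : ℂ) : Prop :=
  ContMDiffAt 𝓘(ℂ, ℂ) 𝓘(ℂ, ℂ × ℂ) ω γ t ∧ ∀ᶠ s in 𝓝[≠] t, IsRegularAt ι γ s

theorem IsRegularAt.congr (h : IsRegularAt ι γ t) (e : γ =ᶠ[𝓝 t] δ) : IsRegularAt ι δ t := by
  obtain ⟨z, h1, h2⟩ := h
  exact ⟨z, by filter_upwards [h1, e] with r h h'; rw [← h', h], h2⟩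

theorem IsSolutionAt.congr (h : IsSolutionAt ι γ t) (e : γ =ᶠ[𝓝 t] δ) : IsSolutionAt ι δ t := by
  refine ⟨h.1.congr_of_eventuallyEq e.symm, ?_⟩
  filter_upwards [h.2, nhdsWithin_le_nhds e.eventuallyEq_nhds] with s hs hs'
  exact hs.congr hs'

theorem IsSolutionAt.continuousAt (h : IsSolutionAt ι γ t) : ContinuousAt γ t := h.1.continuousAt

/-- The closure of a level set of the conserved quantity. -/
def levelClosure (ι : ℂ × ℂ → X) (c : ℂ) : Set X := closure (ι '' {z | hamiltonian z = c})

end Solutions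

namespace Tower

variable {X : ComplexSurface} {ι : ℂ × ℂ → X} (W : Tower X ι mult) {γ δ : ℂ → X} {t : ℂ}

include W

theorem phaseChart_symm_zero (w : ℂ × ℂ) : (W.phaseChart 0).symm w = ι w := W.aff_symm w

theorem phaseChart_symm_succ (i : Fin 3) {w : ℂ × ℂ} (hw : w.2 ≠ 0) :
    (W.phaseChart i.succ).symm w = ι (ofTip i w) :=
  W.tip_symm (i := i) (by
    have := W.phaseChart_target i.succ
    rw [show (W.tip i).target = univ from this]
    trivial) hw

theorem phaseChart_succ {i : Fin 3} {z : ℂ × ℂ} (h : ι z ∈ (W.phaseChart i.succ).source) :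
    z.2 ≠ 0 ∧ W.phaseChart i.succ (ι z) = toTip i z := by
  have h1 : z.2 * (W.phaseChart i.succ (ι z)).2 = 1 := by
    have := W.aff_tip (W.mem_aff z) h
    rwa [W.aff_apply] at this
  refine ⟨left_ne_zero_of_mul_eq_one h1, ?_⟩
  have h2 := right_ne_zero_of_mul_eq_one h1
  have h3 := W.phaseChart_symm_succ i h2
  rw [(W.phaseChart i.succ).left_inv h] at h3
  conv_rhs => rw [W.injective h3]
  exact (toTip_ofTip i h2).symm

/-- A solution of the system in one of the charts is a solution with values in the surface. -/
theorem isSolutionAt_of_chart (j : Fin 4) {w : ℂ → ℂ × ℂ}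
    (hw : ∀ᶠ s in 𝓝 t, HasDerivAt w (chartField j (w s)) s) :
    IsSolutionAt ι (fun s => (W.phaseChart j).symm (w s)) t := by
  constructor
  · refine contMDiffAt_symm_comp (W.phaseChart_mem j) (AnalyticAt.contDiffAt ?_)
      (by rw [W.phaseChart_target]; trivial)
    exact DifferentiableOn.analyticAt
      (fun s hs => (HasDerivAt.differentiableAt hs).differentiableWithinAt) hw
  · revert hw
    refine Fin.cases (fun hw => ?_) (fun i hw => ?_) j
    · filter_upwards [nhdsWithin_le_nhds hw] with s hs
      exact ⟨w, Eventually.of_forall fun r => W.phaseChart_symm_zero _, hs⟩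
    -- If v vanishes at t, then v' = 1 − 2c² = ±1 there, and the solution leaves the exceptional
    -- curve at once.
    · have h2 : ∀ᶠ s in 𝓝[≠] t, (w s).2 ≠ 0 := by
        have h := hw.self_of_nhds.snd'
        by_cases h0 : (w t).2 = 0
        · refine h.eventually_ne ?_
          change (tipField i (w t)).2 ≠ 0
          fin_cases i <;> simp [tipField, h0, ctr, mult] <;> norm_num
        · exact nhdsWithin_le_nhds (h.continuousAt.eventually_ne h0)
      filter_upwards [nhdsWithin_le_nhds hw, h2] with s hs hs2
      refine ⟨fun r => ofTip i (w r), ?_, hasDerivAt_ofTip i hs2 hs⟩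
      filter_upwards [hs.snd'.continuousAt.eventually_ne hs2] with r hr
      exact W.phaseChart_symm_succ i hr

theorem hasDerivAt_of_isRegularAt (h : IsRegularAt ι γ t) {j : Fin 4}
    (ht : γ t ∈ (W.phaseChart j).source) :
    HasDerivAt (fun r => W.phaseChart j (γ r)) (chartField j (W.phaseChart j (γ t))) t := by
  obtain ⟨z, h1, h2⟩ := h
  have e0 := h1.self_of_nhds
  revert ht
  refine Fin.cases (fun ht => ?_) (fun i ht => ?_) j
  · have e : ∀ r, γ r = ι (z r) → W.phaseChart 0 (γ r) = z r := fun r hr => by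
      rw [hr]; exact W.aff_apply _
    rw [e _ e0]
    exact h2.congr_of_eventuallyEq (h1.mono e)
  · have h3 := W.phaseChart_succ (e0 ▸ ht)
    have h4 := hasDerivAt_toTip i h3.1 h2
    rw [e0, h3.2]
    refine HasDerivAt.congr_of_eventuallyEq h4 ?_
    have hs : ∀ᶠ r in 𝓝 t, ι (z r) ∈ (W.phaseChart i.succ).source :=
      (ContinuousAt.comp (g := ι) W.continuous.continuousAt h2.continuousAt).eventually_mem
        ((W.phaseChart i.succ).open_source.mem_nhds (by rw [Function.comp_apply, ← e0]; exact ht))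
    filter_upwards [h1, hs] with r hr hr'
    rw [hr, (W.phaseChart_succ hr').2]

/-- A solution satisfies the system in the charts. -/
theorem eventually_hasDerivAt (h : IsSolutionAt ι γ t) {j : Fin 4}
    (ht : γ t ∈ (W.phaseChart j).source) :
    ∀ᶠ s in 𝓝 t, HasDerivAt (fun r => W.phaseChart j (γ r))
      (chartField j (W.phaseChart j (γ s))) s := by
  have ha : AnalyticAt ℂ (fun r => W.phaseChart j (γ r)) t := by
    refine ContDiffAt.analyticAt (contMDiffAt_iff_contDiffAt.1 ?_)
    exact ContMDiffAt.comp (I' := 𝓘(ℂ, ℂ × ℂ)) (g := W.phaseChart j) (f := γ) t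
      ((contMDiffOn_of_mem_maximalAtlas (W.phaseChart_mem j)).contMDiffAt
        ((W.phaseChart j).open_source.mem_nhds ht)) h.1
  have hs : ∀ᶠ s in 𝓝 t, γ s ∈ (W.phaseChart j).source :=
    h.continuousAt.eventually_mem ((W.phaseChart j).open_source.mem_nhds ht)
  have h1 : deriv (fun r => W.phaseChart j (γ r)) =ᶠ[𝓝[≠] t]
      fun s => chartField j (W.phaseChart j (γ s)) := by
    filter_upwards [h.2, nhdsWithin_le_nhds hs] with s h1 h2
    exact (W.hasDerivAt_of_isRegularAt h1 h2).deriv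
  have hc : ContinuousAt (fun s => chartField j (W.phaseChart j (γ s))) t :=
    ContinuousAt.comp (g := chartField j) (contDiff_chartField j).continuous.continuousAt
      ha.continuousAt
  -- Both sides of the differential equation are continuous at t, so it extends to the exceptional
  -- time t.
  rw [ContinuousAt.eventuallyEq_nhds_iff_eventuallyEq_nhdsNE ha.deriv.continuousAt hc] at h1
  filter_upwards [h1, ha.eventually_analyticAt] with s h2 h3
  rw [← h2]
  exact h3.differentiableAt.hasDerivAt

theorem eventuallyEq_of_isSolutionAt (hγ : IsSolutionAt ι γ t) (hδ : IsSolutionAt ι δ t)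
    (h : γ t = δ t) {j : Fin 4} (ht : γ t ∈ (W.phaseChart j).source) : γ =ᶠ[𝓝 t] δ := by
  have h1 := eventuallyEq_of_hasDerivAt (contDiff_chartField j).contDiffAt
    (W.eventually_hasDerivAt hγ ht) (W.eventually_hasDerivAt hδ (h ▸ ht))
    (congrArg (W.phaseChart j) h)
  have ho := (W.phaseChart j).open_source
  filter_upwards [h1, hγ.continuousAt.eventually_mem (ho.mem_nhds ht),
    hδ.continuousAt.eventually_mem (ho.mem_nhds (h ▸ ht))] with s h2 h3 h4
  exact (W.phaseChart j).injOn h3 h4 h2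

/-! ### Solutions avoid the curves -/

/-- The conserved quantity is constant along a solution. -/
theorem exists_level (h : IsSolutionAt ι γ t) :
    ∃ c, ∀ᶠ s in 𝓝[≠] t, γ s ∈ ι '' {z | hamiltonian z = c} := by
  obtain ⟨ε, hε, hb⟩ := Metric.eventually_nhds_iff_ball.1 (eventually_nhdsWithin_iff.1 h.2)
  have hd : ∀ s ∈ Metric.ball t ε \ {t}, γ s ∈ W.aff.source ∧
      HasDerivAt (fun r => hamiltonian (W.aff (γ r))) 0 s := by
    intro s hs
    have hr := hb s hs.1 hs.2
    have hm : γ s ∈ W.aff.source := by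
      obtain ⟨z, h1, -⟩ := hr
      rw [h1.self_of_nhds]
      exact W.mem_aff _
    exact ⟨hm, hasDerivAt_hamiltonian (W.hasDerivAt_of_isRegularAt hr (j := 0) hm)⟩
  have hnhds : Metric.ball t ε \ {t} ∈ 𝓝[≠] t :=
    sdiff_mem_nhdsWithin_compl (Metric.ball_mem_nhds t hε) _
  obtain ⟨s₀, hs₀⟩ := Filter.nonempty_of_mem hnhds
  refine ⟨hamiltonian (W.aff (γ s₀)), ?_⟩
  filter_upwards [hnhds] with s hs
  refine ⟨W.aff (γ s), ?_, W.eq_of_mem_aff (hd s hs).1⟩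
  exact (Metric.isOpen_ball.sdiff isClosed_singleton).is_const_of_deriv_eq_zero
    (isPreconnected_punctured_ball t ε)
    (fun r hr => (hd r hr).2.differentiableAt.differentiableWithinAt)
    (fun r hr => (hd r hr).2.deriv) hs hs₀

omit W in
theorem mem_levelClosure {c : ℂ} (h : ContinuousAt γ t)
    (hc : ∀ᶠ s in 𝓝[≠] t, γ s ∈ ι '' {z | hamiltonian z = c}) : γ t ∈ levelClosure ι c :=
  mem_closure_of_tendsto (h.tendsto.mono_left nhdsWithin_le_nhds) hc

/-- A relation between the affine coordinates and those in a chart, on a level set of the conserved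
quantity, extends to the closure. -/
theorem rel_of_mem_levelClosure {c : ℂ} {e : OpenPartialHomeomorph X (ℂ × ℂ)} {P : ℂ × ℂ → ℂ × ℂ}
    (he : HasParam ι e P) {A B : ℂ × ℂ → ℂ} (hA : Continuous A) (hB : Continuous B)
    (hrel : ∀ w ∈ offAxes, hamiltonian (P w) * A w = B w) {q : X} (hq : q ∈ levelClosure ι c)
    (hqe : q ∈ e.source) : c * A (e q) = B (e q) := by
  by_contra hne
  have h1 : ContinuousAt (fun r => c * A (e r)) q :=
    continuousAt_const.mul (hA.continuousAt.comp (e.continuousAt hqe))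
  have h2 : ContinuousAt (fun r => B (e r)) q := hB.continuousAt.comp (e.continuousAt hqe)
  obtain ⟨_, ⟨z, hz, rfl⟩, h4, h5⟩ := ((mem_closure_iff_frequently.1 hq).and_eventually
    ((h1.ne_iff_eventually_ne h2).1 hne |>.and (e.open_source.eventually_mem hqe))).exists
  refine h4 ?_
  -- The point `ι z` may lie on an axis of the chart, where `hrel` says nothing; `HasParam.rel`
  -- extends the relation to it.
  have hF : Continuous fun w : (ℂ × ℂ) × (ℂ × ℂ) => hamiltonian w.1 * A w.2 - B w.2 :=
    ((continuous_hamiltonian.comp continuous_fst).mul (hA.comp continuous_snd)).sub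
      (hB.comp continuous_snd)
  have := W.aff_param.rel he W.injective _ hF (fun w _ w' hw' e => by
    change hamiltonian (id w) * A w' - B w' = 0
    rw [e, hrel w' hw', sub_self]) (W.mem_aff z) h5
  rw [W.aff_apply, show hamiltonian z = c from hz] at this
  exact sub_eq_zero.1 this

theorem mid_zero_rel {c : ℂ} {k : ℕ} (hk : k < 2) {q : X} (hq : q ∈ levelClosure ι c)
    (h : q ∈ (W.mid 0 k).source) :
    c * ((W.mid 0 k q).1 ^ (2 - 2 * k) * (W.mid 0 k q).2 ^ (4 - 2 * k)) =
      1 - (midUV 0 k (W.mid 0 k q)).1 ^ 2 :=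
  W.rel_of_mem_levelClosure (W.mid_param 0 k hk)
    (A := fun w => w.1 ^ (2 - 2 * k) * w.2 ^ (4 - 2 * k)) (B := fun w => 1 - (midUV 0 k w).1 ^ 2)
    (by fun_prop) (by have := continuous_midUV 0 k; fun_prop)
    (fun w hw => hamiltonian_mid_zero hk hw) hq h

theorem mid_succ_rel {c : ℂ} {i : Fin 3} (hi : i ≠ 0) {k : ℕ} (hk : k < 4) {q : X}
    (hq : q ∈ levelClosure ι c) (h : q ∈ (W.mid i k).source) :
    c * ((W.mid i k q).1 ^ (3 - k) * (W.mid i k q).2 ^ (4 - k)) =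
      -((midUV i k (W.mid i k q)).1 ^ 2 * ((midUV i k (W.mid i k q)).1 + ctr i)) :=
  W.rel_of_mem_levelClosure (W.mid_param i k (by fin_cases i <;> simp [mult] at hi ⊢ <;> omega))
    (A := fun w => w.1 ^ (3 - k) * w.2 ^ (4 - k))
    (B := fun w => -((midUV i k w).1 ^ 2 * ((midUV i k w).1 + ctr i)))
    (by fun_prop) (by have := continuous_midUV i k; fun_prop)
    (fun w hw => hamiltonian_mid_succ hi hk hw) hq h

omit W in
theorem ctr_ne_zero {i : Fin 3} (hi : i ≠ 0) : ctr i ≠ 0 := fun h =>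
  hi (ctr_injective (h.trans rfl))

/-- On such a curve u is the centre and the left-hand side of the relation vanishes, its exponent at
the vanishing coordinate being positive, while the right-hand side is 1 for the centre 0 and −2 `ctr
i` ^ 3 ≠ 0 otherwise. Positivity of the exponent fails on the last exceptional curve, which level
curves do meet. -/
theorem levelClosure_notMem_exc {c : ℂ} {q : X} (hq : q ∈ levelClosure ι c) {i : Fin 3} {k : ℕ}
    (hk : k + 1 < mult i) : q ∉ W.exc i k := by
  by_cases hi : i = 0
  · subst hi
    have hk : k + 1 < 2 := hk
    obtain rfl : k = 0 := by omega
    rintro (⟨h, h0⟩ | ⟨h, h0⟩)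
    · have := W.mid_zero_rel (by omega) hq h
      simp [midUV, h0, ctr] at this
    · have := W.mid_zero_rel (by omega) hq h
      simp [midUV, h0, ctr] at this
  · have hk : k < 3 := by
      fin_cases i <;> simp [mult] at hi hk <;> omega
    have hc := ctr_ne_zero hi
    have h2 : ctr i + ctr i ≠ 0 := by rw [← two_mul]; exact mul_ne_zero two_ne_zero hc
    rintro (⟨h, h0⟩ | ⟨h, h0⟩)
    · have := W.mid_succ_rel hi (by omega) hq h
      have h3 : 3 - k ≠ 0 := by omega
      simp [midUV, h0, h3, hc, h2] at this
    · have := W.mid_succ_rel hi (by omega) hq h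
      have h3 : 3 - k ≠ 0 := by omega
      simp [midUV, h0, h3, hc, h2] at this

/-- At v = 0 the relation forces u to be a centre other than that of the chart, and those have been
left out of its target. -/
theorem levelClosure_notMem_line {c : ℂ} {q : X} (hq : q ∈ levelClosure ι c) : q ∉ W.line := by
  rintro (⟨h, h0⟩ | ⟨i, h, h0⟩)
  · have := W.rel_of_mem_levelClosure W.inf_param (A := fun w => w.2 ^ 4)
      (B := fun w => w.1 ^ 2 - 1) (by fun_prop) (by fun_prop)
      (fun w hw => hamiltonian_ofEnd hw.2) hq h
    simp only [h0] at this
    exact W.inf_mem_target h h0 (by linear_combination -this)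
  · have ht := W.mid_mem_target (mult_pos i) h rfl h0
    by_cases hi : i = 0
    · subst hi
      have := W.mid_zero_rel (by omega) hq h
      have h1 := ht 1 (by decide)
      have h2 := ht 2 (by decide)
      simp only [midUV, h0, show ctr 0 = 0 from rfl, show ctr 1 = 1 from rfl,
        show ctr 2 = -1 from rfl, add_zero] at this h1 h2
      rcases sq_eq_sq_iff_eq_or_eq_neg.1
        (by linear_combination this : (W.mid 0 0 q).1 ^ 2 = 1 ^ 2) with h | h
      · exact h1 h
      · exact h2 h
    · have := W.mid_succ_rel hi (by omega) hq h
      have h1 := ht 0 (Ne.symm hi)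
      simp only [midUV, h0] at this
      have h2 : ((W.mid i 0 q).1 + ctr i) ^ 2 * ((W.mid i 0 q).1 + ctr i + ctr i) = 0 := by
        linear_combination this
      rcases mul_eq_zero.1 h2 with h3 | h3
      · exact h1 (pow_eq_zero_iff two_ne_zero |>.1 h3)
      · fin_cases i
        · exact hi rfl
        · exact ht 2 (by decide) (by simp [ctr] at h3 ⊢; linear_combination h3)
        · exact ht 1 (by decide) (by simp [ctr] at h3 ⊢; linear_combination h3)

theorem levelClosure_subset (c : ℂ) : levelClosure ι c ⊆ ⋃ j, (W.phaseChart j).source := by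
  rw [← W.compl_curves]
  intro q hq h
  obtain ⟨v, hv⟩ := mem_iUnion.1 h
  fin_cases v
  · exact W.levelClosure_notMem_line hq hv
  all_goals exact W.levelClosure_notMem_exc hq (by decide) hv

/-- Even at an exceptional time the value is a limit of points of one level set. -/
theorem exists_mem_phaseChart (h : IsSolutionAt ι γ t) : ∃ j, γ t ∈ (W.phaseChart j).source := by
  obtain ⟨c, hc⟩ := W.exists_level h
  exact mem_iUnion.1 (W.levelClosure_subset c (mem_levelClosure h.continuousAt hc))

/-! ### Uniqueness of solutions -/

/-- Solutions on a connected open set are determined by their value at one time. -/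
theorem eqOn_of_isSolutionOn {U : Set ℂ} (hU : IsPreconnected U)
    (hγ : IsSolutionOn ι γ U) (hδ : IsSolutionOn ι δ U) (ht : t ∈ U) (h : γ t = δ t) :
    EqOn γ δ U := by
  have key : ∀ s ∈ U, γ s = δ s → γ =ᶠ[𝓝 s] δ := fun s hs e => by
    obtain ⟨j, hj⟩ := W.exists_mem_phaseChart (hγ s hs)
    exact W.eventuallyEq_of_isSolutionAt (hγ s hs) (hδ s hs) e hj
  have hsub : U ⊆ {s | γ =ᶠ[𝓝 s] δ} := by
    -- The set of times near which the solutions agree is open, and closed in U because X is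
    -- Hausdorff and local uniqueness applies at limit times.
    refine hU.subset_of_closure_inter_subset isOpen_setOfPred_eventually_nhds ⟨t, ht, key t ht h⟩ ?_
    rintro s ⟨hs, hsU⟩
    refine key s hsU ?_
    by_contra hne
    obtain ⟨r, hr, hr'⟩ := ((mem_closure_iff_frequently.1 hs).and_eventually
      (((hγ s hsU).1.continuousAt.ne_iff_eventually_ne (hδ s hsU).1.continuousAt).1 hne)).exists
    exact hr' (EventuallyEq.eq_of_nhds hr)
  exact fun s hs => (hsub hs).eq_of_nhds

/-- A solution which starts on a level set of the conserved quantity stays in its closure. -/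
theorem mem_levelClosure_of_isSolutionOn {U : Set ℂ} (hU : IsPreconnected U)
    (hγ : IsSolutionOn ι γ U) (ht : t ∈ U) {z : ℂ × ℂ} (h : γ t = ι z) {s : ℂ} (hs : s ∈ U) :
    γ s ∈ levelClosure ι (hamiltonian z) := by
  set c := hamiltonian z
  -- This set is open, and closed in U: around a limit time the solution has some level by
  -- `exists_level`, and it must be c because levels are disjoint in ℂ².
  let S : Set ℂ := {s | ∀ᶠ r in 𝓝[≠] s, γ r ∈ ι '' {z | hamiltonian z = c}}
  have hS : IsOpen S := by
    rw [isOpen_iff_eventually]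
    intro s hs
    refine eventually_nhds_iff.2 ?_
    obtain ⟨O, hO, hOo, hsO⟩ := eventually_nhds_iff.1 (eventually_nhdsWithin_iff.1 hs)
    refine ⟨O, fun r hr => ?_, hOo, hsO⟩
    by_cases hrs : r = s
    · exact hrs ▸ hs
    · filter_upwards [nhdsWithin_le_nhds (hOo.mem_nhds hr),
        nhdsWithin_le_nhds (isOpen_ne.mem_nhds hrs)] with x hx hx'
      exact hO x hx hx'
  have hlevel : ∀ {r a b}, γ r ∈ ι '' {z | hamiltonian z = a} →
      γ r ∈ ι '' {z | hamiltonian z = b} → a = b := by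
    rintro r a b ⟨z, hz, e⟩ ⟨z', hz', e'⟩
    rw [W.injective (e'.trans e.symm)] at hz'
    exact hz.symm.trans hz'
  have htS : t ∈ S := by
    obtain ⟨b, hb⟩ := W.exists_level (hγ t ht)
    have hm : γ t ∈ (W.phaseChart 0).source := by rw [h]; exact W.mem_aff z
    have hcont : ContinuousAt (fun r => hamiltonian (W.aff (γ r))) t :=
      (hasDerivAt_hamiltonian (W.eventually_hasDerivAt (hγ t ht) hm).self_of_nhds).continuousAt
    have he : (fun r => hamiltonian (W.aff (γ r))) =ᶠ[𝓝[≠] t] fun _ => b := by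
      filter_upwards [hb] with r hr
      obtain ⟨z', hz', e⟩ := hr
      rw [← e, W.aff_apply]
      exact hz'
    rw [ContinuousAt.eventuallyEq_nhds_iff_eventuallyEq_nhdsNE hcont continuousAt_const] at he
    have := he.eq_of_nhds
    rw [h, W.aff_apply] at this
    have hcb : c = b := this
    change ∀ᶠ r in 𝓝[≠] t, γ r ∈ ι '' {z | hamiltonian z = c}
    rwa [hcb]
  have hsub : U ⊆ S := by
    refine hU.subset_of_closure_inter_subset hS ⟨t, ht, htS⟩ ?_
    rintro s ⟨hs, hsU⟩
    obtain ⟨b, hb⟩ := W.exists_level (hγ s hsU)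
    obtain ⟨O, hO, hOo, hsO⟩ := eventually_nhds_iff.1 (eventually_nhdsWithin_iff.1 hb)
    obtain ⟨r, hr, hrO⟩ := ((mem_closure_iff_frequently.1 hs).and_eventually
      (hOo.eventually_mem hsO)).exists
    have hne : ∀ᶠ x in 𝓝[≠] r, x ≠ s := by
      by_cases hrs : r = s
      · rw [hrs]; exact self_mem_nhdsWithin
      · exact nhdsWithin_le_nhds (isOpen_ne.mem_nhds hrs)
    have hr : ∀ᶠ x in 𝓝[≠] r, γ x ∈ ι '' {z | hamiltonian z = c} := hr
    obtain ⟨x, hx, hxs, hxO⟩ := (hr.and (hne.and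
      (nhdsWithin_le_nhds (hOo.mem_nhds hrO)))).exists
    change ∀ᶠ x in 𝓝[≠] s, γ x ∈ ι '' {z | hamiltonian z = c}
    rwa [hlevel hx (hO x hxO hxs)]
  exact mem_levelClosure (hγ s hs).1.continuousAt (hsub hs)

/-! ### Existence of solutions -/

/-- Local existence of solutions, uniform in the initial value. -/
theorem exists_isSolutionOn_ball {q : X} (hq : q ∈ ⋃ j, (W.phaseChart j).source) :
    ∃ N ∈ 𝓝 q, ∃ r > 0, ∀ q' ∈ N, ∀ t : ℂ, ∃ γ : ℂ → X, γ t = q' ∧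
      IsSolutionOn ι γ (Metric.ball t r) := by
  obtain ⟨j, hj⟩ := mem_iUnion.1 hq
  obtain ⟨V, hV, r, hr, h⟩ := exists_solution_ball (contDiff_chartField j) (W.phaseChart j q)
  refine ⟨(W.phaseChart j).source ∩ W.phaseChart j ⁻¹' V,
    inter_mem ((W.phaseChart j).open_source.mem_nhds hj) ((W.phaseChart j).continuousAt hj hV),
    r, hr, fun q' hq' t => ?_⟩
  obtain ⟨w, hw0, hw⟩ := h _ hq'.2
  -- The system is autonomous, so a translation in time makes the radius independent of t.
  refine ⟨fun s => (W.phaseChart j).symm (w (s - t)), ?_, fun s hs => ?_⟩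
  · change (W.phaseChart j).symm (w (t - t)) = q'
    rw [sub_self, hw0, (W.phaseChart j).left_inv hq'.1]
  · refine W.isSolutionAt_of_chart j (w := fun s => w (s - t)) ?_
    filter_upwards [Metric.isOpen_ball.mem_nhds hs] with x hx
    exact HasDerivAt.comp_sub_const x t (hw _ (by simpa [dist_eq_norm] using hx))

/-- The property passes to subsets and, with the smaller radius, to finite unions, so compactness
reduces it to the local statement. -/
theorem exists_isSolutionOn_of_isCompact {K : Set X} (hK : IsCompact K)
    (hsub : K ⊆ ⋃ j, (W.phaseChart j).source) :
    ∃ r > 0, ∀ q ∈ K, ∀ t : ℂ, ∃ γ : ℂ → X, γ t = q ∧ IsSolutionOn ι γ (Metric.ball t r) := by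
  refine hK.induction_on (p := fun K => ∃ r > 0, ∀ q ∈ K, ∀ t : ℂ, ∃ γ : ℂ → X, γ t = q ∧
    IsSolutionOn ι γ (Metric.ball t r)) ⟨1, one_pos, by simp⟩ ?_ ?_ ?_
  · rintro S T hST ⟨r, hr, h⟩
    exact ⟨r, hr, fun q hq => h q (hST hq)⟩
  · rintro S T ⟨r, hr, h⟩ ⟨r', hr', h'⟩
    refine ⟨min r r', lt_min hr hr', fun q hq t => ?_⟩
    rcases hq with hq | hq
    · obtain ⟨γ, h1, h2⟩ := h q hq t
      exact ⟨γ, h1, fun s hs => h2 s (Metric.ball_subset_ball (min_le_left _ _) hs)⟩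
    · obtain ⟨γ, h1, h2⟩ := h' q hq t
      exact ⟨γ, h1, fun s hs => h2 s (Metric.ball_subset_ball (min_le_right _ _) hs)⟩
  · intro q hq
    obtain ⟨N, hN, h⟩ := W.exists_isSolutionOn_ball (hsub hq)
    exact ⟨N, nhdsWithin_le_nhds hN, h⟩

/-- A solution on a disc, through each point of which there are solutions on discs of radius `r`,
extends to a larger disc. -/
theorem exists_extension {R r : ℝ} (hR : 0 < R) (hr : 0 < r)
    (hγ : IsSolutionOn ι γ (Metric.ball t R))
    (h : ∀ s ∈ Metric.ball t R, ∃ δ : ℂ → X, δ s = γ s ∧ IsSolutionOn ι δ (Metric.ball s r)) :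
    ∃ δ : ℂ → X, δ t = γ t ∧ IsSolutionOn ι δ (Metric.ball t (R + r)) := by
  classical
  have : Nonempty X := ⟨γ t⟩
  choose! δ hδ0 hδ using h
  have h1 : ∀ s ∈ Metric.ball t R, ∀ x ∈ Metric.ball t R, x ∈ Metric.ball s r → δ s x = γ x := by
    intro s hs x hx hx'
    exact W.eqOn_of_isSolutionOn ((convex_ball t R).inter (convex_ball s r)).isPreconnected
      (fun y hy => hδ s hs y hy.2) (fun y hy => hγ y hy.1) ⟨hs, Metric.mem_ball_self hr⟩
      (hδ0 s hs) ⟨hx, hx'⟩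
  have h2 : ∀ s ∈ Metric.ball t R, ∀ s' ∈ Metric.ball t R, ∀ x ∈ Metric.ball s r,
      x ∈ Metric.ball s' r → δ s x = δ s' x := by
    intro s hs s' hs' x hx hx'
    -- If two of the small discs meet, the midpoint of their centres lies in both of them and in the
    -- large disc, where the two local solutions agree with γ; uniqueness on the convex intersection
    -- does the rest.
    have hm : midpoint ℝ s s' ∈ Metric.ball t R := (convex_ball t R).midpoint_mem hs hs'
    have hd : dist s s' < 2 * r := by
      have := dist_triangle_left s s' x
      rw [Metric.mem_ball] at hx hx'
      linarith
    have hm1 : midpoint ℝ s s' ∈ Metric.ball s r := by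
      rw [Metric.mem_ball, dist_midpoint_left, Real.norm_ofNat]
      linarith
    have hm2 : midpoint ℝ s s' ∈ Metric.ball s' r := by
      rw [Metric.mem_ball, dist_midpoint_right, Real.norm_ofNat]
      linarith
    exact W.eqOn_of_isSolutionOn ((convex_ball s r).inter (convex_ball s' r)).isPreconnected
      (fun y hy => hδ s hs y hy.1) (fun y hy => hδ s' hs' y hy.2) ⟨hm1, hm2⟩
      ((h1 s hs _ hm hm1).trans (h1 s' hs' _ hm hm2).symm) ⟨hx, hx'⟩
  let η : ℂ → X := fun x =>
    if h : ∃ s ∈ Metric.ball t R, x ∈ Metric.ball s r then δ h.choose x else γ t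
  have h3 : ∀ s ∈ Metric.ball t R, ∀ x ∈ Metric.ball s r, η x = δ s x := by
    intro s hs x hx
    have hex : ∃ s ∈ Metric.ball t R, x ∈ Metric.ball s r := ⟨s, hs, hx⟩
    simp only [η, dif_pos hex]
    exact h2 _ hex.choose_spec.1 s hs x hex.choose_spec.2 hx
  have ht := Metric.mem_ball_self (x := t) hR
  refine ⟨η, (h3 t ht t (Metric.mem_ball_self hr)).trans (hδ0 t ht), fun x hx => ?_⟩
  have hpos : 0 < R + r := add_pos hR hr
  have hx : ‖x - t‖ < R + r := mem_ball_iff_norm.1 hx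
  obtain ⟨s, hs, hxs⟩ : ∃ s ∈ Metric.ball t R, x ∈ Metric.ball s r := by
    -- The point dividing the segment from t to x in the ratio R : r.
    refine ⟨t + (R / (R + r) : ℝ) • (x - t), ?_, ?_⟩
    · rw [mem_ball_iff_norm, add_sub_cancel_left, norm_smul, Real.norm_of_nonneg (by positivity),
        div_mul_eq_mul_div, div_lt_iff₀ hpos]
      exact mul_lt_mul_of_pos_left hx hR
    · have e : x - (t + (R / (R + r) : ℝ) • (x - t)) = (r / (R + r) : ℝ) • (x - t) := by
        have : (r / (R + r) : ℝ) = 1 - R / (R + r) := by field_simp; ring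
        rw [this, sub_smul, one_smul]
        ring
      rw [mem_ball_iff_norm, e, norm_smul, Real.norm_of_nonneg (by positivity),
        div_mul_eq_mul_div, div_lt_iff₀ hpos]
      exact mul_lt_mul_of_pos_left hx hr
  refine IsSolutionAt.congr (hδ s hs x hxs) ?_
  filter_upwards [Metric.isOpen_ball.mem_nhds hxs] with y hy
  exact (h3 s hs y hy).symm

/-- The solution through a point of the affine plane is global. -/
theorem exists_isSolutionOn_univ_of_affine (z : ℂ × ℂ) (t : ℂ) :
    ∃ γ : ℂ → X, IsSolutionOn ι γ univ ∧ γ t = ι z := by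
  have := W.compact
  obtain ⟨r, hr, hloc⟩ := W.exists_isSolutionOn_of_isCompact
    (isClosed_closure.isCompact : IsCompact (levelClosure ι (hamiltonian z)))
    (W.levelClosure_subset _)
  have hz : ι z ∈ levelClosure ι (hamiltonian z) := subset_closure ⟨z, rfl, rfl⟩
  -- The same r serves at every step, since the solution stays in the compact closure of its level
  -- set.
  have key : ∀ n : ℕ, ∃ γ : ℂ → X, γ t = ι z ∧ IsSolutionOn ι γ (Metric.ball t (n * r + r)) := by
    intro n
    induction n with
    | zero =>
      obtain ⟨γ, h1, h2⟩ := hloc _ hz t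
      exact ⟨γ, h1, by simpa using h2⟩
    | succ n ih =>
      obtain ⟨γ, h1, h2⟩ := ih
      have hpos : 0 < n * r + r := by positivity
      obtain ⟨δ, h3, h4⟩ := W.exists_extension hpos hr h2 fun s hs =>
        hloc _ (W.mem_levelClosure_of_isSolutionOn (convex_ball _ _).isPreconnected h2
          (Metric.mem_ball_self hpos) h1 hs) s
      refine ⟨δ, h3.trans h1, ?_⟩
      rwa [Nat.cast_succ, add_mul, one_mul]
  choose γ h0 hγ using key
  have hagree : ∀ m n : ℕ, ∀ s, s ∈ Metric.ball t (m * r + r) → s ∈ Metric.ball t (n * r + r) →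
      γ m s = γ n s := fun m n s hm hn =>
    W.eqOn_of_isSolutionOn ((convex_ball _ _).inter (convex_ball _ _)).isPreconnected
      (fun y hy => hγ m y hy.1) (fun y hy => hγ n y hy.2)
      ⟨Metric.mem_ball_self (by positivity), Metric.mem_ball_self (by positivity)⟩
      ((h0 m).trans (h0 n).symm) ⟨hm, hn⟩
  have hex : ∀ s, ∃ n : ℕ, s ∈ Metric.ball t (n * r + r) := fun s => by
    obtain ⟨n, hn⟩ := exists_nat_gt (dist s t / r)
    exact ⟨n, ((div_lt_iff₀ hr).1 hn).trans (lt_add_of_pos_right _ hr)⟩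
  choose N hN using hex
  refine ⟨fun s => γ (N s) s, fun s _ => ?_, h0 _⟩
  refine IsSolutionAt.congr (hγ (N s) s (hN s)) ?_
  filter_upwards [Metric.isOpen_ball.mem_nhds (hN s)] with x hx
  exact hagree _ _ x hx (hN x)

/-- A local solution through q is in ℂ² at some nearby time; the global solution through that point
agrees with it by uniqueness. -/
theorem exists_isSolutionOn_univ {q : X} (hq : q ∈ ⋃ j, (W.phaseChart j).source) (t : ℂ) :
    ∃ γ : ℂ → X, IsSolutionOn ι γ univ ∧ γ t = q := by
  obtain ⟨N, hN, r, hr, h⟩ := W.exists_isSolutionOn_ball hq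
  obtain ⟨δ, hδt, hδ⟩ := h q (mem_of_mem_nhds hN) t
  have ht := Metric.mem_ball_self (x := t) hr
  obtain ⟨s, ⟨z, hz, -⟩, hs⟩ := ((hδ t ht).2.and
    (nhdsWithin_le_nhds (Metric.isOpen_ball.mem_nhds ht))).exists
  obtain ⟨γ, hγ, hγs⟩ := W.exists_isSolutionOn_univ_of_affine (z s) s
  refine ⟨γ, hγ, ?_⟩
  rw [← hδt]
  exact W.eqOn_of_isSolutionOn (convex_ball t r).isPreconnected (fun y _ => hγ y trivial) hδ hs
    (hγs.trans hz.self_of_nhds.symm) ht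

/-! ### The phase space -/

theorem phaseSpace_eq : phaseSpace ι = (⋃ v, W.curves v)ᶜ ×ˢ univ := by
  rw [W.compl_curves]
  ext ⟨q, t⟩
  constructor
  · rintro ⟨γ, U, -, ht, hγ, e⟩
    exact ⟨mem_iUnion.2 (e ▸ W.exists_mem_phaseChart (hγ t ht)), trivial⟩
  · rintro ⟨hq, -⟩
    obtain ⟨γ, hγ, h⟩ := W.exists_isSolutionOn_univ hq t
    exact ⟨γ, univ, isOpen_univ, trivial, hγ, h⟩

theorem range_phaseChart_symm (j : Fin 4) :
    range (W.phaseChart j).symm = (W.phaseChart j).source := by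
  rw [← image_univ, ← W.phaseChart_target j, (W.phaseChart j).symm_image_target_eq_source]

theorem phaseSpace_eq_iUnion :
    phaseSpace ι = ⋃ j, range (Prod.map (W.phaseChart j).symm (id : ℂ → ℂ)) := by
  rw [W.phaseSpace_eq, W.compl_curves]
  simp only [range_prodMap, range_id, range_phaseChart_symm, iUnion_prod_const]

theorem phaseChart_symm_injective (j : Fin 4) : Function.Injective (W.phaseChart j).symm := by
  rw [← injOn_univ, ← W.phaseChart_target j]
  exact (W.phaseChart j).symm.injOn

theorem isLocalDiffeomorph_phaseChart_symm (j : Fin 4) :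
    IsLocalDiffeomorph 𝓘(ℂ, ℂ × ℂ) 𝓘(ℂ, ℂ × ℂ) ω (W.phaseChart j).symm := fun w =>
  ⟨{  toPartialEquiv := (W.phaseChart j).symm.toPartialEquiv
      open_source := (W.phaseChart j).open_target
      open_target := (W.phaseChart j).open_source
      contMDiffOn_toFun := contMDiffOn_symm_of_mem_maximalAtlas (W.phaseChart_mem j)
      contMDiffOn_invFun := contMDiffOn_of_mem_maximalAtlas (W.phaseChart_mem j) },
    (W.phaseChart_target j).ge (mem_univ w), fun _ _ => rfl⟩

theorem phaseChart_symm_gluingMap (j : Fin 4) {z : ℂ × ℂ} (hz : z.2 ≠ 0) :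
    (W.phaseChart j).symm (gluingMap j z) = ι z := by
  refine Fin.cases (W.phaseChart_symm_zero z) (fun i => ?_) j
  rw [gluingMap_succ, W.phaseChart_symm_succ i (one_div_ne_zero hz), ofTip_toTip i hz]

/-- The charts are glued through the birational maps. -/
theorem phaseChart_symm_eq_iff {j k : Fin 4} (hjk : j ≠ k) (w w' : ℂ × ℂ) :
    (W.phaseChart j).symm w = (W.phaseChart k).symm w' ↔
      ∃ z : ℂ × ℂ, z.2 ≠ 0 ∧ gluingMap j z = w ∧ gluingMap k z = w' := by
  have hmem : ∀ j w, (W.phaseChart j).symm w ∈ (W.phaseChart j).source := fun j w =>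
    (W.phaseChart j).map_target ((W.phaseChart_target j).ge (mem_univ w))
  have haff : ∀ z i w', ι z = (W.phaseChart (Fin.succ i)).symm w' →
      z.2 ≠ 0 ∧ gluingMap (Fin.succ i) z = w' := fun z i w' e => by
    have h := W.phaseChart_succ (e ▸ hmem i.succ w')
    refine ⟨h.1, W.phaseChart_symm_injective i.succ ?_⟩
    rw [W.phaseChart_symm_gluingMap _ h.1, e]
  constructor
  · intro e
    rcases Fin.eq_zero_or_eq_succ j with rfl | ⟨i, rfl⟩
    · obtain ⟨i, rfl⟩ := Fin.exists_succ_eq.2 hjk.symm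
      rw [W.phaseChart_symm_zero] at e
      obtain ⟨h1, h2⟩ := haff _ _ _ e
      exact ⟨w, h1, rfl, h2⟩
    · have hw2 : w.2 ≠ 0 := by
        rcases Fin.eq_zero_or_eq_succ k with rfl | ⟨l, rfl⟩
        · rw [W.phaseChart_symm_zero] at e
          obtain ⟨h1, rfl⟩ := haff _ _ _ e.symm
          rw [gluingMap_succ]
          exact one_div_ne_zero h1
        · intro h0
          -- At v = 0 the slope u would equal two different centres, so the charts at distinct tips
          -- overlap only within ℂ².
          have h := W.tip_tip_uv (q := (W.phaseChart i.succ).symm w) (hmem i.succ w)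
            (e ▸ hmem l.succ w')
          have e1 : W.tip i ((W.phaseChart i.succ).symm w) = w :=
            (W.phaseChart i.succ).right_inv ((W.phaseChart_target i.succ).ge (mem_univ w))
          rw [e1] at h
          have h2 := congrArg Prod.snd h
          have h1 := congrArg Prod.fst h
          simp only [tipUV] at h1 h2
          rw [← h2, h0, zero_pow (mult_pos i).ne', zero_pow (mult_pos l).ne', mul_zero,
            mul_zero, add_zero, add_zero] at h1
          exact hjk (congrArg Fin.succ (ctr_injective h1))
      rw [W.phaseChart_symm_succ i hw2] at e
      have hg : gluingMap i.succ (ofTip i w) = w := by rw [gluingMap_succ, toTip_ofTip i hw2]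
      have hz : (ofTip i w).2 ≠ 0 := one_div_ne_zero hw2
      refine ⟨ofTip i w, hz, hg, ?_⟩
      rcases Fin.eq_zero_or_eq_succ k with rfl | ⟨l, rfl⟩
      · rw [W.phaseChart_symm_zero] at e
        exact W.injective e
      · exact (haff _ _ _ e).2
  · rintro ⟨z, hz, rfl, rfl⟩
    rw [W.phaseChart_symm_gluingMap j hz, W.phaseChart_symm_gluingMap k hz]

/-! ### Connectedness -/

/-- In every chart the points off the axes belong to ℂ². Thus X is the closure of a connected set.
-/
theorem denseRange : DenseRange ι := by
  have hP : ∀ {e : OpenPartialHomeomorph X (ℂ × ℂ)} {P : ℂ × ℂ → ℂ × ℂ} {q : X},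
      HasParam ι e P → q ∈ e.source → q ∈ closure (range ι) := fun h hq => by
    rw [mem_closure_iff_frequently]
    refine (frequently_offAxes isOpen_univ (mem_univ _) hq).mono ?_
    rintro r ⟨-, h1, h2⟩
    exact ⟨_, (h.eq h1 h2).symm⟩
  intro q
  rcases W.cover q with h | h | ⟨i, h⟩ | ⟨i, k, hk, h⟩
  exacts [hP W.aff_param h, hP W.inf_param h, hP (W.tip_param i) h, hP (W.mid_param i k hk) h]

theorem connectedSpace : ConnectedSpace X :=
  { toPreconnectedSpace := W.denseRange.preconnectedSpace W.continuous
    toNonempty := ⟨ι 0⟩ }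

end Tower

/-! ### The main theorem -/

theorem mainTheorem3 :
    ∃ (X : ComplexSurface) (ι : ℂ × ℂ → X) (D : Fin 8 → Set X) (κ : Fin 4 → ℂ × ℂ → X),
      -- ten blow-ups of the projective plane give a rational surface of type `E_7^{(1)}`
      IsIteratedBlowUp [-1, -1, -1, -1, 1, 1, 1, 1, 0, 0] X ι ∧
      CompactSpace X ∧ ConnectedSpace X ∧ IsE7Configuration D ∧
      -- the phase space is the complement of the eight curves
      phaseSpace ι = (⋃ v, D v)ᶜ ×ˢ univ ∧
      -- it is covered by four open copies of `ℂ² × ℂ`, the first one being the original one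
      κ 0 = ι ∧
      (∀ j, Function.Injective (κ j) ∧
        IsLocalDiffeomorph 𝓘(ℂ, ℂ × ℂ) 𝓘(ℂ, ℂ × ℂ) ω (κ j)) ∧
      phaseSpace ι = ⋃ j, range (Prod.map (κ j) (id : ℂ → ℂ)) ∧
      -- any two of these copies are glued through the birational maps
      (∀ j k, j ≠ k → ∀ w w', κ j w = κ k w' ↔
        ∃ z : ℂ × ℂ, z.2 ≠ 0 ∧ gluingMap j z = w ∧ gluingMap k z = w') ∧
      -- in every copy the system is polynomial
      (∀ j, ∃ P Q : MvPolynomial (Fin 2) ℂ, ∀ z : ℂ × ℂ, z.2 ≠ 0 →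
        fderiv ℂ (gluingMap j) z (inceField z) =
          (MvPolynomial.eval ![(gluingMap j z).1, (gluingMap j z).2] P,
            MvPolynomial.eval ![(gluingMap j z).1, (gluingMap j z).2] Q)) ∧
      -- through every point of the phase space passes exactly one solution, and it is global
      (∀ q t, (q, t) ∈ phaseSpace ι → ∃ γ : ℂ → X, IsSolutionOn ι γ univ ∧ γ t = q ∧
        ∀ (U : Set ℂ) (δ : ℂ → X), IsOpen U → IsPreconnected U → t ∈ U → IsSolutionOn ι δ U →
          δ t = q → EqOn δ γ U) := by
  obtain ⟨X, ι, hι, ⟨W⟩⟩ := exists_tower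
  refine ⟨X, ι, W.curves, fun j => (W.phaseChart j).symm, hι, W.compact, W.connectedSpace,
    W.isE7Configuration, W.phaseSpace_eq, funext W.phaseChart_symm_zero,
    fun j => ⟨W.phaseChart_symm_injective j, W.isLocalDiffeomorph_phaseChart_symm j⟩,
    W.phaseSpace_eq_iUnion, fun j k hjk w w' => W.phaseChart_symm_eq_iff hjk w w', fun j => ?_,
    fun q t hq => ?_⟩
  · obtain ⟨P, Q, h⟩ := chartField_polynomial j
    exact ⟨P, Q, fun z hz => (fderiv_gluingMap j hz).trans (h _)⟩
  · rw [W.phaseSpace_eq, W.compl_curves] at hq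
    obtain ⟨γ, hγ, hγt⟩ := W.exists_isSolutionOn_univ hq.1 t
    refine ⟨γ, hγ, hγt, fun U δ _ hU ht hδ hδt => ?_⟩
    exact W.eqOn_of_isSolutionOn hU hδ (fun s _ => hγ s trivial) ht (hδt.trans hγt.symm)
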